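/- **Conventions.** Let $\mathcal A$ be a bicomplete abelian category (i.e. an abelian category with all small limits and colimits). A model structure on $\mathcal A$ is *abelian* if the cofibrations are exactly the monomorphisms with cofibrant cokernel and the fibrations are exactly the epimorphisms with fibrant kernel. Write $\mathcal C,\mathcal W,\mathcal F$ for its classes of cofibrant, weakly trivial and fibrant objects. It is *injective* if $\mathcal C=\mathcal A$, *projective* if $\mathcal F=\mathcal A$, and *hereditary* if $\mathcal C$ and $\mathcal C\cap\mathcal W$ are closed under kernels of epimorphisms and $\mathcal F$ and $\mathcal W\cap\mathcal F$ are closed under cokernels of monomorphisms. An injective abelian model structure is written $(\mathcal W,\mathcal F)$ and a projective one $(\mathcal C,\mathcal W)$. A class of objects is *thick* if it is closed under direct summands and, whenever two of the three terms of a short exact sequence belong to it, so does the third. The homotopy category $\mathrm{Ho}(\mathcal M)$ is the localization of $\mathcal A$ at the weak equivalences. For $\mathcal M$ hereditary it is considered with its standard triangulated structure, in which the distinguished triangles are those isomorphic to a triangle $X\to Y\to Z\to X[1]$ given by a short exact sequence $0\to X\to Y\to Z\to 0$ in $\mathcal A$ and its natural connecting morphism. A sequence $\mathcal T'\xrightarrow{F}\mathcal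 T\xrightarrow{G}\mathcal T''$ of exact functors of triangulated categories is a *colocalization sequence* if $F$ and $G$ have left adjoints $F_\lambda$, $G_\lambda$ such that the counit $F_\lambda F\to\mathrm{Id}$ and the unit $\mathrm{Id}\to GG_\lambda$ are isomorphisms, and $GX=0$ if and only if $X\cong FX'$ for some $X'$. It is a *localization sequence* if $F$ and $G$ have right adjoints $F_\rho$, $G_\rho$ such that $\mathrm{Id}\to F_\rho F$ and $GG_\rho\to\mathrm{Id}$ are isomorphisms, and again $GX=0$ if and only if $X\cong FX'$ for some $X'$. **Statement.** (1) Let $\mathcal M_1=(\mathcal W_1,\mathcal F_1)$ and $\mathcal M_2=(\mathcal W_2,\mathcal F_2)$ be injective abelian model structures on $\mathcal A$ with $\mathcal F_2\subseteq\mathcal F_1$. Then there is a hereditary abelian model structure $\mathcal M_1/\mathcal M_2$ on $\mathcal A$ with $\mathcal C=\mathcal W_2$, $\mathcal F=\mathcal F_1$ and $$\begin{aligned}\mathcal W&=\{X\mid \exists\text{ a short exact sequence }0\to X\to A\to B\to 0\text{ with }A\in\mathcal F_2,\ B\in\mathcal W_1\}\\&=\{X\mid \exists\text{ a short exact sequence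 }0\to A\to B\to X\to 0\text{ with }A\in\mathcal F_2,\ B\in\mathcal W_1\}.\end{aligned}$$ The class $\mathcal W$ is thick, and $X\in\mathcal W$ if and only if $X$ belongs to the essential image of $\mathcal F_2\to\mathrm{Ho}(\mathcal M_1)$. Moreover, the total right derived functors of the identity form a colocalization sequence of triangulated categories $$\mathrm{Ho}(\mathcal M_2)\xrightarrow{\ \mathbf R\mathrm{id}\ }\mathrm{Ho}(\mathcal M_1)\xrightarrow{\ \mathbf R\mathrm{id}\ }\mathrm{Ho}(\mathcal M_1/\mathcal M_2).$$ (2) Dually, let $\mathcal M_1=(\mathcal C_1,\mathcal W_1)$ and $\mathcal M_2=(\mathcal C_2,\mathcal W_2)$ be projective abelian model structures on $\mathcal A$ with $\mathcal C_2\subseteq\mathcal C_1$. Then there is a hereditary abelian model structure $\mathcal M_2\backslash\mathcal M_1$ on $\mathcal A$ with $\mathcal C=\mathcal C_1$, $\mathcal F=\mathcal W_2$ and $$\begin{aligned}\mathcal W&=\{X\mid \exists\text{ a short exact sequence }0\to X\to A\to B\to 0\text{ with }A\in\mathcal W_1,\ B\in\mathcal C_2\}\\&=\{X\mid \exists\text{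 a short exact sequence }0\to A\to B\to X\to 0\text{ with }A\in\mathcal W_1,\ B\in\mathcal C_2\}.\end{aligned}$$ The class $\mathcal W$ is thick, and $X\in\mathcal W$ if and only if $X$ belongs to the essential image of $\mathcal C_2\to\mathrm{Ho}(\mathcal M_1)$. Moreover, the total left derived functors of the identity form a localization sequence of triangulated categories $$\mathrm{Ho}(\mathcal M_2)\xrightarrow{\ \mathbf L\mathrm{id}\ }\mathrm{Ho}(\mathcal M_1)\xrightarrow{\ \mathbf L\mathrm{id}\ }\mathrm{Ho}(\mathcal M_2\backslash\mathcal M_1).$$ -/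

import Mathlib

open CategoryTheory Limits Pretriangulated HomotopicalAlgebra

universe v u

namespace AbModel

section Classes

variable {A : Type u} [Category.{v} A] [Abelian A]

/-- `P` is closed under kernels of epimorphisms. -/
def ClosedUnderKernelsOfEpis (P : ObjectProperty A) : Prop :=
  ∀ S : ShortComplex A, S.ShortExact → P S.X₂ → P S.X₃ → P S.X₁

/-- `P` is closed under cokernels of monomorphisms. -/
def ClosedUnderCokernelsOfMonos (P : ObjectProperty A) : Prop :=
  ∀ S : ShortComplex A, S.ShortExact → P S.X₁ → P S.X₂ → P S.X₃

/-- `P` is closed under direct summands and, whenever two out of the three terms of a short exact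
sequence belong to `P`, then so does the third. In an abelian category, a direct summand is the
same thing as a retract. -/
structure IsThick (P : ObjectProperty A) : Prop where
  summands : P.IsStableUnderRetracts
  extensions : ∀ S : ShortComplex A, S.ShortExact → P S.X₁ → P S.X₃ → P S.X₂
  kernels : ClosedUnderKernelsOfEpis P
  cokernels : ClosedUnderCokernelsOfMonos P

/-- The objects `X` for which there is a short exact sequence `0 ⟶ X ⟶ K ⟶ L ⟶ 0` with `K` in `P`
and `L` in `Q`. -/
def kernelClass (P Q : ObjectProperty A) : ObjectProperty A := fun X =>
  ∃ (K L : A) (f : X ⟶ K) (g : K ⟶ L) (w : f ≫ g = 0),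
    (ShortComplex.mk f g w).ShortExact ∧ P K ∧ Q L

/-- The objects `X` for which there is a short exact sequence `0 ⟶ K ⟶ L ⟶ X ⟶ 0` with `K` in `P`
and `L` in `Q`. -/
def cokernelClass (P Q : ObjectProperty A) : ObjectProperty A := fun X =>
  ∃ (K L : A) (f : K ⟶ L) (g : L ⟶ X) (w : f ≫ g = 0),
    (ShortComplex.mk f g w).ShortExact ∧ P K ∧ Q L

end Classes

section Models

variable {A : Type u} [Category.{v} A] (M : ModelCategory A)

/-- The cofibrations of the model structure `M`. -/
abbrev cof : MorphismProperty A := M.categoryWithCofibrations.cofibrations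

/-- The weak equivalences of the model structure `M`. -/
abbrev weq : MorphismProperty A := M.categoryWithWeakEquivalences.weakEquivalences

/-- The fibrations of the model structure `M`. -/
abbrev fib : MorphismProperty A := M.categoryWithFibrations.fibrations

/-- The homotopy category of the model structure `M`. -/
abbrev Ho := (weq M).Localization

/-- The localization functor to the homotopy category. -/
abbrev toHo : A ⥤ Ho M := (weq M).Q

variable [Abelian A]

/-- The class of cofibrant objects. -/
def cofibrant : ObjectProperty A := fun X => cof M (initial.to X)

/-- The class of weakly trivial objects. -/
def weaklyTrivial : ObjectProperty A := fun X => weq M (initial.to X)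

/-- The class of fibrant objects. -/
def fibrant : ObjectProperty A := fun X => fib M (terminal.from X)

/-- A model structure on an abelian category is abelian if the cofibrations are the monomorphisms
with cofibrant cokernel and the fibrations are the epimorphisms with fibrant kernel. -/
structure IsAbelianModel : Prop where
  cof_iff {X Y : A} (f : X ⟶ Y) : cof M f ↔ Mono f ∧ cofibrant M (cokernel f)
  fib_iff {X Y : A} (f : X ⟶ Y) : fib M f ↔ Epi f ∧ fibrant M (kernel f)

/-- An abelian model structure in which every object is cofibrant. -/
structure IsInjectiveModel : Prop extends IsAbelianModel M where
  cofibrant_all (X : A) : cofibrant M X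

/-- An abelian model structure in which every object is fibrant. -/
structure IsProjectiveModel : Prop extends IsAbelianModel M where
  fibrant_all (X : A) : fibrant M X

/-- An abelian model structure `(C, W, F)` is hereditary if both of its cotorsion pairs
`(C, W ∩ F)` and `(C ∩ W, F)` are hereditary, i.e. their left hand classes are closed under kernels
of epimorphisms and their right hand classes are closed under cokernels of monomorphisms. -/
structure IsHereditaryModel : Prop extends IsAbelianModel M where
  resolving : ClosedUnderKernelsOfEpis (cofibrant M)
  coresolving_trivial : ClosedUnderCokernelsOfMonos (weaklyTrivial M ⊓ fibrant M)
  resolving_trivial : ClosedUnderKernelsOfEpis (cofibrant M ⊓ weaklyTrivial M)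
  coresolving : ClosedUnderCokernelsOfMonos (fibrant M)

/-- The standard triangulated structure on the homotopy category of a (hereditary) abelian model
structure: a natural connecting morphism `Z ⟶ X⟦1⟧` is attached to every short exact sequence
`0 ⟶ X ⟶ Y ⟶ Z ⟶ 0` of the abelian category, and the distinguished triangles are precisely the
triangles isomorphic to some `X ⟶ Y ⟶ Z ⟶ X⟦1⟧` obtained in this way.

This determines the triangulated structure up to isomorphism: every `X` embeds in a weakly trivial
object `I`, and for `0 ⟶ X ⟶ I ⟶ Σ X ⟶ 0` the connecting morphism is an isomorphism `Σ X ≅ X⟦1⟧`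
in the homotopy category, so that the translation is the usual suspension; by naturality all other
connecting morphisms, and hence all distinguished triangles, are then determined as well. -/
structure HoTriangulation where
  preadditive : Preadditive (Ho M)
  hasZeroObject : HasZeroObject (Ho M)
  hasShift : HasShift (Ho M) ℤ
  shift_additive : ∀ n : ℤ, (shiftFunctor (Ho M) n).Additive
  pretriangulated : Pretriangulated (Ho M)
  isTriangulated : IsTriangulated (Ho M)
  toHo_additive : (toHo M).Additive
  δ (S : ShortComplex A) (hS : S.ShortExact) :
    (toHo M).obj S.X₃ ⟶ ((toHo M).obj S.X₁)⟦(1 : ℤ)⟧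
  δ_naturality {S S' : ShortComplex A} (φ : S ⟶ S') (hS : S.ShortExact) (hS' : S'.ShortExact) :
    δ S hS ≫ ((toHo M).map φ.τ₁)⟦(1 : ℤ)⟧' = (toHo M).map φ.τ₃ ≫ δ S' hS'
  distinguished_iff (T : Triangle (Ho M)) : (T ∈ distTriang (Ho M)) ↔
    ∃ (S : ShortComplex A) (hS : S.ShortExact),
      Nonempty (T ≅ Triangle.mk ((toHo M).map S.f) ((toHo M).map S.g) (δ S hS))


end Models

section Derived

variable {A : Type u} [Category.{v} A]

/-- `R` is the total right derived functor `Ho(M) ⥤ Ho(N)` of the identity functor. -/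
def IsRightDerivedId (M N : ModelCategory A) (R : Ho M ⥤ Ho N) : Prop :=
  ∃ α : toHo N ⟶ toHo M ⋙ R, R.IsRightDerivedFunctor α (weq M)

/-- `L` is the total left derived functor `Ho(M) ⥤ Ho(N)` of the identity functor. -/
def IsLeftDerivedId (M N : ModelCategory A) (L : Ho M ⥤ Ho N) : Prop :=
  ∃ α : toHo M ⋙ L ⟶ toHo N, L.IsLeftDerivedFunctor α (weq M)

end Derived

section Sequences

variable {T' T T'' : Type*} [Category* T'] [Category* T] [Category* T'']
  [HasZeroObject T'] [HasZeroObject T] [HasZeroObject T'']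
  [Preadditive T'] [Preadditive T] [Preadditive T'']
  [HasShift T' ℤ] [HasShift T ℤ] [HasShift T'' ℤ]
  [∀ n : ℤ, (shiftFunctor T' n).Additive] [∀ n : ℤ, (shiftFunctor T n).Additive]
  [∀ n : ℤ, (shiftFunctor T'' n).Additive]
  [Pretriangulated T'] [Pretriangulated T] [Pretriangulated T'']

/-- A sequence `T' ⥤ T ⥤ T''` of exact functors between triangulated categories is a localization
sequence if both functors `F` and `G` have right adjoints `Fρ` and `Gρ`, with `Fρ ∘ F ≅ 𝟭` (through
the unit) and `G ∘ Gρ ≅ 𝟭` (through the counit), and the kernel of `G` is the essential image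
of `F`. -/
structure IsLocalizationSequence (F : T' ⥤ T) (G : T ⥤ T'') : Prop where
  exact_left : ∃ _ : F.CommShift ℤ, F.IsTriangulated
  exact_right : ∃ _ : G.CommShift ℤ, G.IsTriangulated
  adjoint_left : ∃ (Fρ : T ⥤ T') (adj : F ⊣ Fρ), IsIso adj.unit
  adjoint_right : ∃ (Gρ : T'' ⥤ T) (adj : G ⊣ Gρ), IsIso adj.counit
  kernel_eq (X : T) : IsZero (G.obj X) ↔ F.essImage X

/-- A sequence `T' ⥤ T ⥤ T''` of exact functors between triangulated categories is a colocalization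
sequence if the sequence of opposite functors is a localization sequence, i.e. if both functors `F`
and `G` have left adjoints `Fl` and `Gl`, with `Fl ∘ F ≅ 𝟭` (through the counit) and `G ∘ Gl ≅ 𝟭`
(through the unit), and the kernel of `G` is the essential image of `F`. -/
structure IsColocalizationSequence (F : T' ⥤ T) (G : T ⥤ T'') : Prop where
  exact_left : ∃ _ : F.CommShift ℤ, F.IsTriangulated
  exact_right : ∃ _ : G.CommShift ℤ, G.IsTriangulated
  adjoint_left : ∃ (Fl : T ⥤ T') (adj : Fl ⊣ F), IsIso adj.counit
  adjoint_right : ∃ (Gl : T'' ⥤ T) (adj : Gl ⊣ G), IsIso adj.unit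
  kernel_eq (X : T) : IsZero (G.obj X) ↔ F.essImage X

end Sequences

section HoSequences

variable {A : Type u} [Category.{v} A] [Abelian A] {M' M M'' : ModelCategory A}

/-- `Ho(M') ⥤ Ho(M) ⥤ Ho(M'')` is a localization sequence with respect to the given
triangulations. -/
def IsHoLocalizationSequence (t' : HoTriangulation M') (t : HoTriangulation M)
    (t'' : HoTriangulation M'') (F : Ho M' ⥤ Ho M) (G : Ho M ⥤ Ho M'') : Prop :=
  letI := t'.preadditive
  letI := t.preadditive
  letI := t''.preadditive
  letI := t'.hasZeroObject
  letI := t.hasZeroObject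
  letI := t''.hasZeroObject
  letI := t'.hasShift
  letI := t.hasShift
  letI := t''.hasShift
  letI := t'.shift_additive
  letI := t.shift_additive
  letI := t''.shift_additive
  letI := t'.pretriangulated
  letI := t.pretriangulated
  letI := t''.pretriangulated
  IsLocalizationSequence F G

/-- `Ho(M') ⥤ Ho(M) ⥤ Ho(M'')` is a colocalization sequence with respect to the given
triangulations. -/
def IsHoColocalizationSequence (t' : HoTriangulation M') (t : HoTriangulation M)
    (t'' : HoTriangulation M'') (F : Ho M' ⥤ Ho M) (G : Ho M ⥤ Ho M'') : Prop :=
  letI := t'.preadditive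
  letI := t.preadditive
  letI := t''.preadditive
  letI := t'.hasZeroObject
  letI := t.hasZeroObject
  letI := t''.hasZeroObject
  letI := t'.hasShift
  letI := t.hasShift
  letI := t''.hasShift
  letI := t'.shift_additive
  letI := t.shift_additive
  letI := t''.shift_additive
  letI := t'.pretriangulated
  letI := t.pretriangulated
  letI := t''.pretriangulated
  IsColocalizationSequence F G

end HoSequences

end AbModel

open AbModel

/-!
Let `M₁` and `M₂` be injective, with `F₂ ⊆ F₁`; the projective case is dual. The quotient model
structure is read off from a semiorthogonal decomposition `(U, V)` of the triangulated category
`Ho M₁`, in which `U` comes from `W₂` and `V` comes from `F₂`.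

*The triangulation of `Ho M`.* For an injective `M`, the homotopy category is realized inside a
Verdier quotient of the derived category of `A`. Let `N` consist of the complexes without nonzero
morphisms to the large shifts of the fibrant objects (`eventuallyLeftOrthogonal`). It contains the
weakly trivial objects, since they have no higher extensions by fibrant objects, so that
`A ⥤ D(A)/N` inverts the weak equivalences. Let `Y` be fibrant. Splicing sequences
`0 ⟶ Y'' ⟶ I ⟶ Y' ⟶ 0` with `I` fibrant and weakly trivial, hence injective, gives extension
classes starting at `Y`, and every denominator out of `Y` divides one of them
(`IsInjectiveModel.exists_leftDenominator`). Fractions with these denominators are represented by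
morphisms of `A`, up to those that factor through a weakly trivial object; hence `Ho M ⥤ D(A)/N` is
fully faithful. Its essential image is a triangulated subcategory, and the connecting morphisms of
the derived category induce those of `Ho M` (`IsInjectiveModel.exists_hoTriangulation`).

*The decomposition.* A morphism in `Ho M₁` from an object of `W₂` to one of `F₂` vanishes, because
it extends along an embedding of the source into an object of `W₁`; and the fibrant replacements
of `M₂` make every object of `Ho M₁` an extension of the two kinds. This gives `(U, V)` with
`W₂` the inverse image of `U` and `F₂` the part of `F₁` lying in `V`
(`IsInjectiveModel.exists_isSemiorthogonal`).

*The model structure.* Take as cofibrations the trivial cofibrations of `M₂`, as fibrations the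
fibrations of `M₁`, and as weak equivalences the morphisms whose cone in `Ho M₁` is in `V`. Since
`U ∩ V = 0`, the trivial cofibrations are those of `M₁` and the trivial fibrations are the
fibrations of `M₂`, so that both factorization systems are known already
(`IsInjectiveModel.exists_quotient`). The weakly trivial objects are those with image in
`V`, from which the descriptions of this class follow.

*The colocalization sequence.* The weak equivalences of `M₂` are the morphisms with cone in `U`.
Thus `Ho M₂` and the homotopy category of the quotient are the Verdier quotients of `Ho M₁` by `U`
and by `V`. The adjoint of the first quotient functor embeds `Ho M₂` as `V`, and is a derived
functor because it is a Kan extension (`isLeftKanExtension_of_adjunction`,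
`exists_isHoColocalizationSequence`).
-/

namespace AbModel

/-! ### Abelian model structures -/

section AbelianLemmas

variable {A : Type u} [Category.{v} A] [Abelian A]

/-- The right hand square of a morphism of short exact sequences is a pullback if the left hand
component is an isomorphism. -/
lemma isPullback_of_shortExact {S S' : ShortComplex A} (hS : S.ShortExact) (hS' : S'.ShortExact)
    (φ : S ⟶ S') [IsIso φ.τ₁] : IsPullback S.g φ.τ₂ φ.τ₃ S'.g := by
  have := hS.mono_f
  have := hS'.mono_f
  have := hS.epi_g
  have sq : CommSq S.g φ.τ₂ φ.τ₃ S'.g := ⟨φ.comm₂₃.symm⟩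
  let k : S.X₂ ⟶ pullback φ.τ₃ S'.g := pullback.lift S.g φ.τ₂ sq.w
  have hk₁ : k ≫ pullback.fst _ _ = S.g := pullback.lift_fst _ _ _
  have hk₂ : k ≫ pullback.snd _ _ = φ.τ₂ := pullback.lift_snd _ _ _
  have : Mono k := by
    refine Preadditive.mono_of_cancel_zero _ fun {T} x hx => ?_
    have h₁ : x ≫ S.g = 0 := by rw [← hk₁, ← Category.assoc, hx, zero_comp]
    have h₂ : x ≫ φ.τ₂ = 0 := by rw [← hk₂, ← Category.assoc, hx, zero_comp]
    have hy := hS.exact.lift_f x h₁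
    have : hS.exact.lift x h₁ = 0 := by
      rw [← cancel_mono φ.τ₁, ← cancel_mono S'.f, Category.assoc, φ.comm₁₂,
        reassoc_of% hy, h₂, zero_comp, zero_comp]
    rw [← hy, this, zero_comp]
  have : Epi k := by
    rw [epi_iff_surjective_up_to_refinements]
    intro T y
    obtain ⟨T', π, hπ, x, hx⟩ :=
      surjective_up_to_refinements_of_epi S.g (y ≫ pullback.fst _ _)
    have h₁ : (π ≫ y ≫ pullback.snd _ _ - x ≫ φ.τ₂) ≫ S'.g = 0 := by
      rw [Preadditive.sub_comp, sub_eq_zero, Category.assoc, Category.assoc,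
        ← pullback.condition, Category.assoc, φ.comm₂₃, ← reassoc_of% hx]
    refine ⟨T', π, hπ, x + hS'.exact.lift _ h₁ ≫ inv φ.τ₁ ≫ S.f, ?_⟩
    apply pullback.hom_ext
    · simp [hk₁, hx]
    · have := hS'.exact.lift_f _ h₁
      rw [Category.assoc, Category.assoc, Preadditive.add_comp, hk₂, Category.assoc, Category.assoc,
        ← φ.comm₁₂, IsIso.inv_hom_id_assoc, this, add_sub_cancel]
  have : IsIso k := isIso_of_mono_of_epi k
  exact IsPullback.of_iso_pullback sq (asIso k) hk₁ hk₂

/-- The left hand square of a morphism of short exact sequences is a pushout if the right hand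
component is an isomorphism. -/
lemma isPushout_of_shortExact {S S' : ShortComplex A} (hS : S.ShortExact) (hS' : S'.ShortExact)
    (φ : S ⟶ S') [IsIso φ.τ₃] : IsPushout S.f φ.τ₁ φ.τ₂ S'.f := by
  have : IsIso (ShortComplex.opMap φ).τ₁ := inferInstanceAs (IsIso φ.τ₃.op)
  exact (isPullback_of_shortExact hS'.op hS.op (ShortComplex.opMap φ)).unop

/-- The short exact sequence given by a monomorphism and its cokernel. -/
lemma shortExact_cokernel {X Y : A} (f : X ⟶ Y) [Mono f] :
    (ShortComplex.mk f (cokernel.π f) (cokernel.condition f)).ShortExact where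
  exact := ShortComplex.exact_of_g_is_cokernel _ (cokernelIsCokernel f)

/-- The short exact sequence given by an epimorphism and its kernel. -/
lemma shortExact_kernel {X Y : A} (f : X ⟶ Y) [Epi f] :
    (ShortComplex.mk (kernel.ι f) f (kernel.condition f)).ShortExact where
  exact := ShortComplex.exact_of_f_is_kernel _ (kernelIsKernel f)

end AbelianLemmas

section Models

variable {A : Type u} [Category.{v} A] (M : ModelCategory A)

lemma wfs_trivialCof_fib : (cof M ⊓ weq M).IsWeakFactorizationSystem (fib M) :=
  letI := M
  inferInstanceAs ((trivialCofibrations A).IsWeakFactorizationSystem (fibrations A))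

lemma wfs_cof_trivialFib : (cof M).IsWeakFactorizationSystem (fib M ⊓ weq M) :=
  letI := M
  inferInstanceAs ((cofibrations A).IsWeakFactorizationSystem (trivialFibrations A))

instance : (weq M).HasTwoOutOfThreeProperty :=
  letI := M
  inferInstanceAs (weakEquivalences A).HasTwoOutOfThreeProperty

instance : (weq M).IsStableUnderRetracts :=
  letI := M
  inferInstanceAs (weakEquivalences A).IsStableUnderRetracts

instance : (cof M).IsStableUnderRetracts :=
  letI := M
  inferInstanceAs (cofibrations A).IsStableUnderRetracts

instance : (fib M).IsStableUnderRetracts :=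
  letI := M
  inferInstanceAs (fibrations A).IsStableUnderRetracts

instance : (cof M ⊓ weq M).IsStableUnderCobaseChange :=
  letI := M
  inferInstanceAs (trivialCofibrations A).IsStableUnderCobaseChange

instance : (fib M ⊓ weq M).IsStableUnderBaseChange :=
  letI := M
  inferInstanceAs (trivialFibrations A).IsStableUnderBaseChange

instance : (cof M).IsMultiplicative :=
  letI := M
  inferInstanceAs (cofibrations A).IsMultiplicative

instance : (fib M).IsMultiplicative :=
  letI := M
  inferInstanceAs (fibrations A).IsMultiplicative

lemma weq_of_isIso {X Y : A} (f : X ⟶ Y) [IsIso f] : weq M f := by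
  exact (inferInstance : WeakEquivalence f).mem

variable {M}

lemma weq_comp {X Y Z : A} {f : X ⟶ Y} {g : Y ⟶ Z} (hf : weq M f) (hg : weq M g) :
    weq M (f ≫ g) := (weq M).comp_mem _ _ hf hg

lemma exists_trivialCof_fib (M : ModelCategory A) {X Y : A} (f : X ⟶ Y) :
    ∃ (Z : A) (i : X ⟶ Z) (p : Z ⟶ Y), i ≫ p = f ∧ cof M i ∧ weq M i ∧ fib M p := by
  have := wfs_trivialCof_fib M
  let d := MorphismProperty.factorizationData (cof M ⊓ weq M) (fib M) f
  exact ⟨_, d.i, d.p, d.fac, d.hi.1, d.hi.2, d.hp⟩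

lemma exists_cof_trivialFib (M : ModelCategory A) {X Y : A} (f : X ⟶ Y) :
    ∃ (Z : A) (i : X ⟶ Z) (p : Z ⟶ Y), i ≫ p = f ∧ cof M i ∧ fib M p ∧ weq M p := by
  have := wfs_cof_trivialFib M
  let d := MorphismProperty.factorizationData (cof M) (fib M ⊓ weq M) f
  exact ⟨_, d.i, d.p, d.fac, d.hi, d.hp.1, d.hp.2⟩

lemma exists_lift_of_trivialCof {X Y Z W : A} {i : X ⟶ Y} {p : Z ⟶ W} (hi : cof M i)
    (hi' : weq M i) (hp : fib M p) (f : X ⟶ Z) (g : Y ⟶ W) (h : f ≫ p = i ≫ g) :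
    ∃ l : Y ⟶ Z, i ≫ l = f ∧ l ≫ p = g := by
  have := wfs_trivialCof_fib M
  have := MorphismProperty.hasLiftingProperty_of_wfs (W₁ := cof M ⊓ weq M) (W₂ := fib M)
    i p ⟨hi, hi'⟩ hp
  exact ⟨(CommSq.mk h).lift, by simp, by simp⟩

lemma exists_lift_of_trivialFib {X Y Z W : A} {i : X ⟶ Y} {p : Z ⟶ W} (hi : cof M i)
    (hp : fib M p) (hp' : weq M p) (f : X ⟶ Z) (g : Y ⟶ W) (h : f ≫ p = i ≫ g) :
    ∃ l : Y ⟶ Z, i ≫ l = f ∧ l ≫ p = g := by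
  have := wfs_cof_trivialFib M
  have := MorphismProperty.hasLiftingProperty_of_wfs (W₁ := cof M) (W₂ := fib M ⊓ weq M)
    i p hi ⟨hp, hp'⟩
  exact ⟨(CommSq.mk h).lift, by simp, by simp⟩

lemma cofibrant_iff_of_isZero {Z X : A} (hZ : IsZero Z) (f : Z ⟶ X) :
    cofibrant M X ↔ cof M f :=
  (cof M).arrow_mk_iso_iff (Arrow.isoMk (initialIsInitial.uniqueUpToIso hZ.isInitial) (Iso.refl _)
    (initialIsInitial.hom_ext _ _))

lemma weaklyTrivial_iff_of_isZero {Z X : A} (hZ : IsZero Z) (f : Z ⟶ X) :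
    weaklyTrivial M X ↔ weq M f :=
  (weq M).arrow_mk_iso_iff (Arrow.isoMk (initialIsInitial.uniqueUpToIso hZ.isInitial) (Iso.refl _)
    (initialIsInitial.hom_ext _ _))

lemma weaklyTrivial_iff_of_isZero' {Z X : A} (hZ : IsZero Z) (f : X ⟶ Z) :
    weaklyTrivial M X ↔ weq M f := by
  rw [weaklyTrivial_iff_of_isZero hZ (hZ.to_ X)]
  have : weq M (hZ.to_ X ≫ f) := by
    have : IsIso (hZ.to_ X ≫ f) := ⟨𝟙 _, hZ.eq_of_src _ _, hZ.eq_of_src _ _⟩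
    exact weq_of_isIso M _
  exact ⟨fun h => (weq M).of_precomp _ _ h this, fun h => (weq M).of_postcomp _ _ h this⟩

variable [Abelian A]

lemma fibrant_iff_of_isZero {Z X : A} (hZ : IsZero Z) (f : X ⟶ Z) :
    fibrant M X ↔ fib M f :=
  (fib M).arrow_mk_iso_iff (Arrow.isoMk (Iso.refl _)
    (terminalIsTerminal.uniqueUpToIso hZ.isTerminal) (hZ.eq_of_tgt _ _))

instance : (cofibrant M).IsStableUnderRetracts where
  of_retract {X Y} r hY := by
    have h0 := isZero_zero A
    rw [cofibrant_iff_of_isZero h0 (h0.to_ _)] at hY ⊢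
    exact (cof M).of_retract (f := h0.to_ X) (g := h0.to_ Y)
      { i := Arrow.homMk (𝟙 _) r.i (h0.eq_of_src _ _)
        r := Arrow.homMk (𝟙 _) r.r (h0.eq_of_src _ _) } hY

instance : (fibrant M).IsStableUnderRetracts where
  of_retract {X Y} r hY := by
    have h0 := isZero_zero A
    rw [fibrant_iff_of_isZero h0 (h0.from_ _)] at hY ⊢
    exact (fib M).of_retract (f := h0.from_ X) (g := h0.from_ Y)
      { i := Arrow.homMk r.i (𝟙 _) (h0.eq_of_tgt _ _)
        r := Arrow.homMk r.r (𝟙 _) (h0.eq_of_tgt _ _) } hY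

instance : (weaklyTrivial M).IsStableUnderRetracts where
  of_retract {X Y} r hY := by
    have h0 := isZero_zero A
    rw [weaklyTrivial_iff_of_isZero h0 (h0.to_ _)] at hY ⊢
    exact (weq M).of_retract (f := h0.to_ X) (g := h0.to_ Y)
      { i := Arrow.homMk (𝟙 _) r.i (h0.eq_of_src _ _)
        r := Arrow.homMk (𝟙 _) r.r (h0.eq_of_src _ _) } hY

lemma weaklyTrivial_of_weq {X Y : A} {f : X ⟶ Y} (hf : weq M f) :
    weaklyTrivial M X ↔ weaklyTrivial M Y := by
  have h0 := isZero_zero A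
  rw [weaklyTrivial_iff_of_isZero h0 (h0.to_ X), weaklyTrivial_iff_of_isZero h0 (h0.to_ Y),
    ← h0.eq_of_src (h0.to_ X ≫ f) (h0.to_ Y)]
  exact ⟨fun h => weq_comp h hf, fun h => (weq M).of_postcomp _ _ hf h⟩

/-- A morphism between weakly trivial objects is a weak equivalence. -/
lemma weq_of_weaklyTrivial {X Y : A} (f : X ⟶ Y) (hX : weaklyTrivial M X)
    (hY : weaklyTrivial M Y) : weq M f := by
  have h0 := isZero_zero A
  rw [weaklyTrivial_iff_of_isZero h0 (h0.to_ _)] at hX hY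
  exact (weq M).of_precomp _ _ hX ((h0.eq_of_src (h0.to_ X ≫ f) (h0.to_ Y)).symm ▸ hY)

namespace IsAbelianModel

variable (h : IsAbelianModel M)
include h

lemma cof_f_iff {S : ShortComplex A} (hS : S.ShortExact) : cof M S.f ↔ cofibrant M S.X₃ := by
  have := hS.mono_f
  rw [h.cof_iff]
  have e : cokernel S.f ≅ S.X₃ :=
    (cokernelIsCokernel S.f).coconePointUniqueUpToIso hS.gIsCokernel
  rw [(cofibrant M).prop_iff_of_iso e]
  exact and_iff_right this

lemma fib_g_iff {S : ShortComplex A} (hS : S.ShortExact) : fib M S.g ↔ fibrant M S.X₁ := by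
  have := hS.epi_g
  rw [h.fib_iff]
  have e : kernel S.g ≅ S.X₁ :=
    (kernelIsKernel S.g).conePointUniqueUpToIso hS.fIsKernel
  rw [(fibrant M).prop_iff_of_iso e]
  exact and_iff_right this

lemma mono_of_cof {X Y : A} {f : X ⟶ Y} (hf : cof M f) : Mono f := ((h.cof_iff f).1 hf).1

lemma epi_of_fib {X Y : A} {f : X ⟶ Y} (hf : fib M f) : Epi f := ((h.fib_iff f).1 hf).1

omit h in
open ZeroObject in
lemma isPushout_zero_of_shortExact {S : ShortComplex A} (hS : S.ShortExact) :
    IsPushout S.f (0 : S.X₁ ⟶ 0) S.g (0 : 0 ⟶ S.X₃) :=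
  have := hS.epi_g
  have h0 := isZero_zero A
  have H (s : PushoutCocone S.f (0 : S.X₁ ⟶ 0)) : S.f ≫ s.inl = 0 := by
    rw [s.condition, h0.eq_of_src s.inr 0, comp_zero]
  { w := by simp
    isColimit' := ⟨PushoutCocone.IsColimit.mk _ (fun s => hS.exact.desc s.inl (H s))
      (fun s => hS.exact.g_desc _ (H s)) (fun s => h0.eq_of_src _ _)
      (fun s m h₁ _ => by rw [← cancel_epi S.g, h₁, hS.exact.g_desc])⟩ }

omit h in
open ZeroObject in
lemma isPullback_zero_of_shortExact {S : ShortComplex A} (hS : S.ShortExact) :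
    IsPullback S.f (0 : S.X₁ ⟶ 0) S.g (0 : 0 ⟶ S.X₃) :=
  have := hS.mono_f
  have h0 := isZero_zero A
  have H (s : PullbackCone S.g (0 : 0 ⟶ S.X₃)) : s.fst ≫ S.g = 0 := by
    rw [s.condition, comp_zero]
  { w := by simp
    isLimit' := ⟨PullbackCone.IsLimit.mk _ (fun s => hS.exact.lift s.fst (H s))
      (fun s => hS.exact.lift_f _ (H s)) (fun s => h0.eq_of_tgt _ _)
      (fun s m h₁ _ => by rw [← cancel_mono S.f, h₁, hS.exact.lift_f])⟩ }

omit h in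
lemma weaklyTrivial_of_trivialCof {S : ShortComplex A} (hS : S.ShortExact) (hf : cof M S.f)
    (hf' : weq M S.f) : weaklyTrivial M S.X₃ := by
  rw [weaklyTrivial_iff_of_isZero (isZero_zero A) 0]
  exact ((cof M ⊓ weq M).of_isPushout (isPushout_zero_of_shortExact hS).flip ⟨hf, hf'⟩).2

omit h in
lemma weaklyTrivial_of_trivialFib {S : ShortComplex A} (hS : S.ShortExact) (hf : fib M S.g)
    (hf' : weq M S.g) : weaklyTrivial M S.X₁ := by
  rw [weaklyTrivial_iff_of_isZero' (isZero_zero A) 0]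
  exact ((fib M ⊓ weq M).of_isPullback (isPullback_zero_of_shortExact hS) ⟨hf, hf'⟩).2

/-- A monomorphism with weakly trivial cokernel is a weak equivalence: if it is factored as a
trivial cofibration `j` followed by a fibration `q`, then `q` is a pullback of a fibration from the
cokernel of `j` to the given cokernel, which is a weak equivalence as both are weakly trivial. -/
lemma weq_f {S : ShortComplex A} (hS : S.ShortExact)
    (hw : weaklyTrivial M S.X₃) : weq M S.f := by
  have := hS.mono_f
  have := hS.epi_g
  obtain ⟨Z, j, q, fac, hj, hj', hq⟩ := exists_trivialCof_fib M S.f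
  have := h.mono_of_cof hj
  have := h.epi_of_fib hq
  let T := ShortComplex.mk j (cokernel.π j) (cokernel.condition j)
  have hT : T.ShortExact := shortExact_cokernel j
  let φ : T ⟶ S :=
    { τ₁ := 𝟙 _
      τ₂ := q
      τ₃ := cokernel.desc j (q ≫ S.g) (by rw [reassoc_of% fac, S.zero])
      comm₁₂ := by simp [T, fac]
      comm₂₃ := by simp [T] }
  have : IsIso φ.τ₁ := inferInstanceAs (IsIso (𝟙 S.X₁))
  have sq := isPullback_of_shortExact hT hS φ
  have : Epi φ.τ₂ := inferInstanceAs (Epi q)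
  have : Epi (T.g ≫ φ.τ₃) := by rw [sq.w]; infer_instance
  have : Epi φ.τ₃ := epi_of_epi T.g _
  have hφ : fib M φ.τ₃ := by
    rw [h.fib_iff]
    refine ⟨this, ((fibrant M).prop_iff_of_iso ?_).1 ((h.fib_iff q).1 hq).2⟩
    have := isIso_kernel_map_of_isPullback sq.flip
    exact asIso (kernel.map φ.τ₂ φ.τ₃ T.g S.g sq.flip.w)
  have hφ' : weq M φ.τ₃ :=
    weq_of_weaklyTrivial _ (weaklyTrivial_of_trivialCof hT hj hj') hw
  rw [← fac]
  exact weq_comp hj' ((fib M ⊓ weq M).of_isPullback sq ⟨hφ, hφ'⟩).2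

/-- An epimorphism with weakly trivial kernel is a weak equivalence, by the argument dual to the one
for `weq_f`. -/
lemma weq_g {S : ShortComplex A} (hS : S.ShortExact)
    (hw : weaklyTrivial M S.X₁) : weq M S.g := by
  have := hS.mono_f
  have := hS.epi_g
  obtain ⟨Z, j, q, fac, hj, hq, hq'⟩ := exists_cof_trivialFib M S.g
  have := h.mono_of_cof hj
  have := h.epi_of_fib hq
  let T := ShortComplex.mk (kernel.ι q) q (kernel.condition q)
  have hT : T.ShortExact := shortExact_kernel q
  let φ : S ⟶ T :=
    { τ₁ := kernel.lift q (S.f ≫ j) (by rw [Category.assoc, fac, S.zero])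
      τ₂ := j
      τ₃ := 𝟙 _
      comm₁₂ := by simp [T]
      comm₂₃ := by simp [T, fac] }
  have : IsIso φ.τ₃ := inferInstanceAs (IsIso (𝟙 S.X₃))
  have sq := isPushout_of_shortExact hS hT φ
  have : Mono φ.τ₂ := inferInstanceAs (Mono j)
  have : Mono (φ.τ₁ ≫ T.f) := by rw [← sq.w]; infer_instance
  have : Mono φ.τ₁ := mono_of_mono _ T.f
  have hφ : cof M φ.τ₁ := by
    rw [h.cof_iff]
    refine ⟨this, ((cofibrant M).prop_iff_of_iso ?_).2 ((h.cof_iff j).1 hj).2⟩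
    have := isIso_cokernel_map_of_isPushout sq.flip
    exact asIso (cokernel.map φ.τ₁ φ.τ₂ S.f T.f sq.flip.w)
  have hφ' : weq M φ.τ₁ :=
    weq_of_weaklyTrivial _ hw (weaklyTrivial_of_trivialFib hT hq hq')
  rw [← fac]
  exact weq_comp ((cof M ⊓ weq M).of_isPushout sq ⟨hφ, hφ'⟩).2 hq'

end IsAbelianModel

end Models

/-! ### Replacements, and the homotopy category -/

section Ho

variable {A : Type u} [Category.{v} A] {M : ModelCategory A}

lemma isIso_toHo_map {X Y : A} {f : X ⟶ Y} (hf : weq M f) : IsIso ((toHo M).map f) :=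
  Localization.inverts (toHo M) (weq M) f hf

variable [Abelian A]

lemma exists_cofibrant_replacement (M : ModelCategory A) (X : A) :
    ∃ (Q : A) (p : Q ⟶ X), cofibrant M Q ∧ fib M p ∧ weq M p := by
  have h0 := isZero_zero A
  obtain ⟨Q, i, p, -, hi, hp, hp'⟩ := exists_cof_trivialFib M (h0.to_ X)
  exact ⟨Q, p, (cofibrant_iff_of_isZero h0 i).2 hi, hp, hp'⟩

lemma exists_fibrant_replacement (M : ModelCategory A) (X : A) :
    ∃ (R : A) (i : X ⟶ R), fibrant M R ∧ cof M i ∧ weq M i := by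
  have h0 := isZero_zero A
  obtain ⟨R, i, p, -, hi, hi', hp⟩ := exists_trivialCof_fib M (h0.from_ X)
  exact ⟨R, i, (fibrant_iff_of_isZero h0 p).2 hp, hi, hi'⟩

lemma exists_cof_weaklyTrivial (M : ModelCategory A) (X : A) :
    ∃ (J : A) (i : X ⟶ J), cof M i ∧ fibrant M J ∧ weaklyTrivial M J := by
  have h0 := isZero_zero A
  obtain ⟨R, i, p, -, hi, hp, hp'⟩ := exists_cof_trivialFib M (h0.from_ X)
  exact ⟨R, i, hi, (fibrant_iff_of_isZero h0 p).2 hp, (weaklyTrivial_iff_of_isZero' h0 p).2 hp'⟩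

lemma exists_fib_weaklyTrivial (M : ModelCategory A) (X : A) :
    ∃ (J : A) (p : J ⟶ X), fib M p ∧ cofibrant M J ∧ weaklyTrivial M J := by
  have h0 := isZero_zero A
  obtain ⟨R, i, p, -, hi, hi', hp⟩ := exists_trivialCof_fib M (h0.to_ X)
  exact ⟨R, p, hp, (cofibrant_iff_of_isZero h0 i).2 hi, (weaklyTrivial_iff_of_isZero h0 i).2 hi'⟩

lemma cofibrant_of_cof {X Y : A} {f : X ⟶ Y} (hf : cof M f) (hX : cofibrant M X) :
    cofibrant M Y := by
  have h0 := isZero_zero A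
  rw [cofibrant_iff_of_isZero h0 (h0.to_ _)] at hX
  exact (cofibrant_iff_of_isZero h0 _).2 ((cof M).comp_mem _ _ hX hf)

lemma fibrant_of_fib {X Y : A} {f : X ⟶ Y} (hf : fib M f) (hY : fibrant M Y) :
    fibrant M X := by
  have h0 := isZero_zero A
  rw [fibrant_iff_of_isZero h0 (h0.from_ _)] at hY
  exact (fibrant_iff_of_isZero h0 _).2 ((fib M).comp_mem _ _ hf hY)

lemma toHo_map_surjective {X Y : A} (hX : cofibrant M X) (hY : fibrant M Y) :
    Function.Surjective ((toHo M).map : (X ⟶ Y) → _) := by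
  have : IsCofibrant X := ⟨hX⟩
  have : IsFibrant Y := ⟨hY⟩
  have : (toHo M).IsLocalization (weakEquivalences A) :=
    inferInstanceAs ((weq M).Q.IsLocalization (weq M))
  exact map_surjective_of_isLocalization (toHo M) X Y

/-- Every object of the homotopy category comes from a bifibrant object. -/
lemma exists_bifibrant_iso (X : Ho M) :
    ∃ (B : A), cofibrant M B ∧ fibrant M B ∧ Nonempty ((toHo M).obj B ≅ X) := by
  have := Localization.essSurj (toHo M) (weq M)
  obtain ⟨Q, p, hQ, hp, hp'⟩ := exists_cofibrant_replacement M ((toHo M).objPreimage X)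
  obtain ⟨B, i, hB, hi, hi'⟩ := exists_fibrant_replacement M Q
  have := isIso_toHo_map hp'
  have := isIso_toHo_map hi'
  exact ⟨B, cofibrant_of_cof hi hQ, hB, ⟨(asIso ((toHo M).map i)).symm ≪≫
    asIso ((toHo M).map p) ≪≫ (toHo M).objObjPreimageIso X⟩⟩

/-- Every morphism of the homotopy category is isomorphic to the image of a monomorphism, which is
presented here as the first map of a short exact sequence. -/
lemma IsAbelianModel.exists_arrow_iso_map_f (h : IsAbelianModel M) {X Y : Ho M} (f : X ⟶ Y) :
    ∃ (S : ShortComplex A) (_ : S.ShortExact),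
      Nonempty (Arrow.mk f ≅ Arrow.mk ((toHo M).map S.f)) := by
  obtain ⟨X', hX, -, ⟨eX⟩⟩ := exists_bifibrant_iso X
  obtain ⟨Y', -, hY, ⟨eY⟩⟩ := exists_bifibrant_iso Y
  obtain ⟨g, hg⟩ := toHo_map_surjective hX hY (eX.hom ≫ f ≫ eY.inv)
  obtain ⟨Z, i, p, fac, hi, -, hp⟩ := exists_cof_trivialFib M g
  have := h.mono_of_cof hi
  have := isIso_toHo_map hp
  refine ⟨_, shortExact_cokernel i, ⟨Arrow.isoMk eX.symm
    (eY.symm ≪≫ (asIso ((toHo M).map p)).symm) ?_⟩⟩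
  simp only [Iso.symm_hom, Arrow.mk_hom, Iso.trans_hom, asIso_inv]
  rw [← cancel_mono ((toHo M).map p), Category.assoc, ← Functor.map_comp, fac, hg]
  simp

end Ho

section Hereditary

variable {A : Type u} [Category.{v} A] [Abelian A] {M : ModelCategory A}

namespace IsInjectiveModel

variable (h : IsInjectiveModel M)
include h

lemma cof_of_mono {X Y : A} (f : X ⟶ Y) [Mono f] : cof M f :=
  (h.cof_iff f).2 ⟨inferInstance, h.cofibrant_all _⟩

/-- The fibrant and weakly trivial objects of an injective model are injective. -/
lemma injective {J : A} (hJ : fibrant M J) (hJ' : weaklyTrivial M J) : Injective J where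
  factors {X Y} g f _ := by
    have h0 := isZero_zero A
    obtain ⟨l, hl, -⟩ := exists_lift_of_trivialFib (h.cof_of_mono f)
      ((fibrant_iff_of_isZero h0 (h0.from_ J)).1 hJ)
      ((weaklyTrivial_iff_of_isZero' h0 (h0.from_ J)).1 hJ') g (h0.from_ Y) (h0.eq_of_tgt _ _)
    exact ⟨l, hl⟩

/-- Morphisms to a fibrant object extend along the monomorphisms with weakly trivial cokernel. -/
lemma exists_extension {S : ShortComplex A} (hS : S.ShortExact) (hW : weaklyTrivial M S.X₃)
    {F : A} (hF : fibrant M F) (f : S.X₁ ⟶ F) : ∃ g : S.X₂ ⟶ F, S.f ≫ g = f := by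
  have h0 := isZero_zero A
  have := hS.mono_f
  obtain ⟨l, hl, -⟩ := exists_lift_of_trivialCof (h.cof_of_mono S.f)
      (h.weq_f hS hW) ((fibrant_iff_of_isZero h0 (h0.from_ F)).1 hF) f (h0.from_ _)
      (h0.eq_of_tgt _ _)
  exact ⟨l, hl⟩

lemma exists_lift {S : ShortComplex A} (hS : S.ShortExact) (hF : fibrant M S.X₁)
    {W : A} (hW : weaklyTrivial M W) (f : W ⟶ S.X₃) : ∃ g : W ⟶ S.X₂, g ≫ S.g = f := by
  have h0 := isZero_zero A
  have := hS.epi_g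
  obtain ⟨l, -, hl⟩ := exists_lift_of_trivialCof
      ((cofibrant_iff_of_isZero h0 (h0.to_ W)).1 (h.cofibrant_all W))
      ((weaklyTrivial_iff_of_isZero h0 (h0.to_ W)).1 hW) ((h.fib_g_iff hS).2 hF) (h0.to_ _) f
      (h0.eq_of_src _ _)
  exact ⟨l, hl⟩

/-- The fibrant objects of an injective model are closed under cokernels of monomorphisms: if
`0 ⟶ X ⟶ Y ⟶ Z ⟶ 0` is exact with `X` and `Y` fibrant, and `Z ⟶ E` is a fibrant replacement of
`Z`, the lifting properties of `X` and `Y` with respect to a weakly trivial cover of `E` provide a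
retraction of `Z ⟶ E`. -/
lemma closedUnderCokernelsOfMonos_fibrant : ClosedUnderCokernelsOfMonos (fibrant M) := by
  intro S hS hX hY
  have := hS.epi_g
  obtain ⟨E, z, hE, hz, hz'⟩ := exists_fibrant_replacement M S.X₃
  have := h.mono_of_cof hz
  have hB := IsAbelianModel.weaklyTrivial_of_trivialCof (shortExact_cokernel z) hz hz'
  obtain ⟨P, q, hq, -, hP⟩ := exists_fib_weaklyTrivial M E
  have := h.epi_of_fib hq
  -- `kernel r` is the preimage of `S.X₃` in the weakly trivial cover `P` of `E`
  let r : P ⟶ cokernel z := q ≫ cokernel.π z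
  have hr := shortExact_kernel r
  have hK : weaklyTrivial M (kernel r) :=
    (weaklyTrivial_of_weq (h.weq_f hr hB)).2 hP
  obtain ⟨k, hk⟩ : ∃ k : kernel r ⟶ S.X₃, k ≫ z = kernel.ι r ≫ q :=
    ⟨(shortExact_cokernel z).exact.lift (kernel.ι r ≫ q)
      ((Category.assoc _ _ _).trans (kernel.condition r)),
      (shortExact_cokernel z).exact.lift_f _ _⟩
  have : Epi k := by
    rw [epi_iff_surjective_up_to_refinements]
    intro T t
    obtain ⟨T', π, hπ, x, hx⟩ := surjective_up_to_refinements_of_epi q (t ≫ z)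
    refine ⟨T', π, hπ, kernel.lift r x (by simp [r, ← reassoc_of% hx]), ?_⟩
    simp only [← cancel_mono z, Category.assoc, hk, kernel.lift_ι_assoc, hx]
  obtain ⟨l, hl⟩ := h.exists_lift hS hX hK k
  obtain ⟨m, hm⟩ := h.exists_extension hr hB hY l
  dsimp at hm
  have hker : kernel.ι q ≫ m ≫ S.g = 0 := by
    have h₁ : kernel.ι q = kernel.lift r (kernel.ι q) (by simp [r]) ≫ kernel.ι r := by simp
    have h₂ : kernel.lift r (kernel.ι q) (by simp [r]) ≫ k = 0 := by
      rw [← cancel_mono z, Category.assoc, hk]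
      simp
    rw [h₁, Category.assoc, reassoc_of% hm, hl, h₂]
  have fac : q ≫ (shortExact_kernel q).exact.desc (m ≫ S.g) hker = m ≫ S.g :=
    (shortExact_kernel q).exact.g_desc _ _
  refine (fibrant M).prop_of_retract
    (show Retract S.X₃ E from ⟨z, (shortExact_kernel q).exact.desc (m ≫ S.g) hker, ?_⟩) hE
  rw [← cancel_epi k, reassoc_of% hk, fac, reassoc_of% hm, hl, Category.comp_id]

end IsInjectiveModel

namespace IsProjectiveModel

variable (h : IsProjectiveModel M)
include h

lemma fib_of_epi {X Y : A} (f : X ⟶ Y) [Epi f] : fib M f :=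
  (h.fib_iff f).2 ⟨inferInstance, h.fibrant_all _⟩

/-- The cofibrant and weakly trivial objects of a projective model are projective. -/
lemma projective {J : A} (hJ : cofibrant M J) (hJ' : weaklyTrivial M J) : Projective J where
  factors {X Y} g f _ := by
    have h0 := isZero_zero A
    obtain ⟨l, -, hl⟩ := exists_lift_of_trivialCof
      ((cofibrant_iff_of_isZero h0 (h0.to_ J)).1 hJ)
      ((weaklyTrivial_iff_of_isZero h0 (h0.to_ J)).1 hJ') (h.fib_of_epi f)
      (h0.to_ X) g (h0.eq_of_src _ _)
    exact ⟨l, hl⟩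

lemma exists_lift {S : ShortComplex A} (hS : S.ShortExact) (hW : weaklyTrivial M S.X₁)
    {C : A} (hC : cofibrant M C) (f : C ⟶ S.X₃) : ∃ g : C ⟶ S.X₂, g ≫ S.g = f := by
  have h0 := isZero_zero A
  have := hS.epi_g
  obtain ⟨l, -, hl⟩ := exists_lift_of_trivialFib
      ((cofibrant_iff_of_isZero h0 (h0.to_ C)).1 hC) (h.fib_of_epi S.g) (h.weq_g hS hW)
      (h0.to_ _) f (h0.eq_of_src _ _)
  exact ⟨l, hl⟩

lemma exists_extension {S : ShortComplex A} (hS : S.ShortExact) (hC : cofibrant M S.X₃)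
    {W : A} (hW : weaklyTrivial M W) (f : S.X₁ ⟶ W) : ∃ g : S.X₂ ⟶ W, S.f ≫ g = f := by
  have h0 := isZero_zero A
  have := hS.mono_f
  obtain ⟨l, hl, -⟩ := exists_lift_of_trivialFib ((h.cof_f_iff hS).2 hC)
      ((fibrant_iff_of_isZero h0 (h0.from_ W)).1 (h.fibrant_all W))
      ((weaklyTrivial_iff_of_isZero' h0 (h0.from_ W)).1 hW) f (h0.from_ _)
      (h0.eq_of_tgt _ _)
  exact ⟨l, hl⟩

/-- The cofibrant objects of a projective model are closed under kernels of epimorphisms. -/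
lemma closedUnderKernelsOfEpis_cofibrant : ClosedUnderKernelsOfEpis (cofibrant M) := by
  intro S hS hY hX
  have := hS.mono_f
  obtain ⟨E, z, hE, hz, hz'⟩ := exists_cofibrant_replacement M S.X₁
  have := h.epi_of_fib hz
  have hB := IsAbelianModel.weaklyTrivial_of_trivialFib (shortExact_kernel z) hz hz'
  obtain ⟨P, q, hq, -, hP⟩ := exists_cof_weaklyTrivial M E
  have := h.mono_of_cof hq
  -- `cokernel r` is the pushout of the embedding `q` of `E` in a weakly trivial object along `z`
  let r : kernel z ⟶ P := kernel.ι z ≫ q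
  have hr := shortExact_cokernel r
  have hK : weaklyTrivial M (cokernel r) :=
    (weaklyTrivial_of_weq (h.weq_g hr hB)).1 hP
  obtain ⟨k, hk⟩ : ∃ k : S.X₁ ⟶ cokernel r, z ≫ k = q ≫ cokernel.π r :=
    ⟨(shortExact_kernel z).exact.desc (q ≫ cokernel.π r)
      ((Category.assoc _ _ _).symm.trans (cokernel.condition r)),
      (shortExact_kernel z).exact.g_desc _ _⟩
  have : Mono k := by
    refine Preadditive.mono_of_cancel_zero _ fun {T} t ht => ?_
    obtain ⟨T', π, hπ, x, hx⟩ := surjective_up_to_refinements_of_epi z t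
    have h₁ : (x ≫ q) ≫ cokernel.π r = 0 := by
      rw [Category.assoc, ← hk, ← reassoc_of% hx, ht, comp_zero]
    have h₂ := hr.exact.lift_f (x ≫ q) h₁
    have h₃ : x = hr.exact.lift (x ≫ q) h₁ ≫ kernel.ι z := by
      rw [← cancel_mono q, Category.assoc]
      exact h₂.symm
    rw [← cancel_epi π, hx, h₃, Category.assoc, kernel.condition, comp_zero, comp_zero]
  obtain ⟨l, hl⟩ := h.exists_extension hS hX hK k
  obtain ⟨m, hm⟩ := h.exists_lift hr hB hY l
  dsimp at hm
  have hker : (S.f ≫ m) ≫ cokernel.π q = 0 := by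
    have h₁ : cokernel.π q = cokernel.π r ≫ cokernel.desc r (cokernel.π q) (by simp [r]) := by simp
    have h₂ : k ≫ cokernel.desc r (cokernel.π q) (by simp [r]) = 0 := by
      rw [← cancel_epi z, reassoc_of% hk]
      simp
    rw [h₁, Category.assoc, reassoc_of% hm, reassoc_of% hl, h₂]
  have fac : (shortExact_cokernel q).exact.lift (S.f ≫ m) hker ≫ q = S.f ≫ m :=
    (shortExact_cokernel q).exact.lift_f _ _
  refine (cofibrant M).prop_of_retract
    (show Retract S.X₁ E from ⟨(shortExact_cokernel q).exact.lift (S.f ≫ m) hker, z, ?_⟩) hE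
  rw [← cancel_mono k, Category.assoc, hk, reassoc_of% fac, hm, hl, Category.id_comp]

end IsProjectiveModel

end Hereditary

/-! ### Connecting morphisms, and adjoints of Verdier quotients -/

section ConnectingMorphisms

variable {A : Type u} [Category.{v} A] [Abelian A]
  {T : Type*} [Category* T] [Preadditive T] [HasZeroObject T] [HasShift T ℤ]
  [∀ n : ℤ, (shiftFunctor T n).Additive] [Pretriangulated T]

/-- Natural connecting morphisms for a functor `Φ` from an abelian category to a triangulated
category, by which `Φ` sends short exact sequences to distinguished triangles. -/
structure ConnectingMorphisms (Φ : A ⥤ T) where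
  δ (S : ShortComplex A) (hS : S.ShortExact) : Φ.obj S.X₃ ⟶ (Φ.obj S.X₁)⟦(1 : ℤ)⟧
  naturality {S S' : ShortComplex A} (φ : S ⟶ S') (hS : S.ShortExact) (hS' : S'.ShortExact) :
    δ S hS ≫ (Φ.map φ.τ₁)⟦(1 : ℤ)⟧' = Φ.map φ.τ₃ ≫ δ S' hS'
  distinguished (S : ShortComplex A) (hS : S.ShortExact) :
    Triangle.mk (Φ.map S.f) (Φ.map S.g) (δ S hS) ∈ distTriang T

namespace ConnectingMorphisms

variable {Φ Ψ : A ⥤ T}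

/-- Transport of connecting morphisms along an isomorphism of functors. -/
def ofIso (E : ConnectingMorphisms Φ) (e : Φ ≅ Ψ) : ConnectingMorphisms Ψ where
  δ S hS := e.inv.app S.X₃ ≫ E.δ S hS ≫ (e.hom.app S.X₁)⟦(1 : ℤ)⟧'
  naturality φ hS hS' := by
    rw [Category.assoc, Category.assoc, ← Functor.map_comp, ← e.hom.naturality, Functor.map_comp,
      reassoc_of% (E.naturality φ hS hS'), e.inv.naturality_assoc]
  distinguished S hS := by
    refine isomorphic_distinguished _ (E.distinguished S hS) _
      (Triangle.isoMk _ _ (e.symm.app _) (e.symm.app _) (e.symm.app _) (e.inv.naturality S.f)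
        (e.inv.naturality S.g) ?_)
    change (e.inv.app S.X₃ ≫ E.δ S hS ≫ (e.hom.app S.X₁)⟦(1 : ℤ)⟧') ≫
      (e.inv.app S.X₁)⟦(1 : ℤ)⟧' = e.inv.app S.X₃ ≫ E.δ S hS
    rw [Category.assoc, Category.assoc, ← Functor.map_comp, e.hom_inv_id_app,
      CategoryTheory.Functor.map_id, Category.comp_id]

lemma isIso_δ (E : ConnectingMorphisms Φ) {S : ShortComplex A} (hS : S.ShortExact)
    (hZ : IsZero (Φ.obj S.X₂)) : IsIso (E.δ S hS) :=
  (Triangle.isZero₂_iff_isIso₃ _ (E.distinguished S hS)).1 hZ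

/-- The image of a class of objects is stable under the shifts if the class is closed under
syzygies and cosyzygies with respect to objects which are killed by `Φ`. -/
lemma isStableUnderShift_map (E : ConnectingMorphisms Φ) (Q : ObjectProperty A)
    (h₁ : ∀ X, Q X → ∃ (J : A) (i : X ⟶ J), Mono i ∧ IsZero (Φ.obj J) ∧ Q (cokernel i))
    (h₂ : ∀ X, Q X → ∃ (J : A) (p : J ⟶ X), Epi p ∧ IsZero (Φ.obj J) ∧ Q (kernel p)) :
    (Q.map Φ).IsStableUnderShift ℤ := by
  have h₁' {P : T} (hP : Q.map Φ P) : Q.map Φ (P⟦(1 : ℤ)⟧) := by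
    obtain ⟨X, hX, ⟨f⟩⟩ := (Q.prop_map_iff Φ P).1 hP
    obtain ⟨J, i, _, hJ, hi⟩ := h₁ X hX
    have := E.isIso_δ (shortExact_cokernel i) hJ
    exact (Q.prop_map_iff Φ _).2
      ⟨_, hi, ⟨asIso (E.δ _ (shortExact_cokernel i)) ≪≫ (shiftFunctor T 1).mapIso f⟩⟩
  have h₂' {P : T} (hP : Q.map Φ P) : Q.map Φ (P⟦(-1 : ℤ)⟧) := by
    obtain ⟨X, hX, ⟨f⟩⟩ := (Q.prop_map_iff Φ P).1 hP
    obtain ⟨J, p, _, hJ, hp⟩ := h₂ X hX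
    have := E.isIso_δ (shortExact_kernel p) hJ
    exact (Q.prop_map_iff Φ _).2 ⟨_, hp, ⟨(shiftFunctorCompIsoId T (1 : ℤ) (-1) (by lia)).symm.app _
      ≪≫ (shiftFunctor T (-1)).mapIso ((asIso (E.δ _ (shortExact_kernel p))).symm ≪≫ f)⟩⟩
  refine { isStableUnderShiftBy n := ⟨fun P hP => ?_⟩ }
  change Q.map Φ (P⟦n⟧)
  induction n with
  | zero => exact (Q.map Φ).prop_of_iso ((shiftFunctorZero T ℤ).symm.app P) hP
  | succ n hn => exact (Q.map Φ).prop_of_iso ((shiftFunctorAdd' T _ 1 _ rfl).symm.app P) (h₁' hn)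
  | pred n hn =>
    exact (Q.map Φ).prop_of_iso ((shiftFunctorAdd' T _ (-1) _ rfl).symm.app P) (h₂' hn)

variable {V : Type*} [Category* V] [Preadditive V] [HasZeroObject V] [HasShift V ℤ]
  [∀ n : ℤ, (shiftFunctor V n).Additive] [Pretriangulated V]

/-- The image of connecting morphisms under an exact functor. -/
def comp (E : ConnectingMorphisms Φ) (Q : T ⥤ V) [Q.CommShift ℤ] [Q.IsTriangulated] :
    ConnectingMorphisms (Φ ⋙ Q) where
  δ S hS := Q.map (E.δ S hS) ≫ (Q.commShiftIso (1 : ℤ)).hom.app _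
  naturality φ hS hS' := by
    have h : Q.map ((Φ.map φ.τ₁)⟦(1 : ℤ)⟧') ≫ (Q.commShiftIso (1 : ℤ)).hom.app _ =
        (Q.commShiftIso (1 : ℤ)).hom.app _ ≫ (Q.map (Φ.map φ.τ₁))⟦(1 : ℤ)⟧' :=
      (Q.commShiftIso (1 : ℤ)).hom.naturality (Φ.map φ.τ₁)
    change (Q.map (E.δ _ hS) ≫ (Q.commShiftIso (1 : ℤ)).hom.app _) ≫
      (Q.map (Φ.map φ.τ₁))⟦(1 : ℤ)⟧' =
        Q.map (Φ.map φ.τ₃) ≫ Q.map (E.δ _ hS') ≫ (Q.commShiftIso (1 : ℤ)).hom.app _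
    rw [Category.assoc, ← h, ← Q.map_comp_assoc, E.naturality φ hS hS', Q.map_comp_assoc]
  distinguished S hS := Q.map_distinguished _ (E.distinguished S hS)

/-- Connecting morphisms can be lifted along a fully faithful exact functor. -/
noncomputable def ofCompFullyFaithful (Q : T ⥤ V) [Q.CommShift ℤ] [Q.IsTriangulated]
    [Q.Full] [Q.Faithful] (E : ConnectingMorphisms (Φ ⋙ Q)) : ConnectingMorphisms Φ where
  δ S hS := Q.preimage (E.δ S hS ≫ (Q.commShiftIso (1 : ℤ)).inv.app _)
  naturality φ hS hS' := by
    have h : (Q.map (Φ.map φ.τ₁))⟦(1 : ℤ)⟧' ≫ (Q.commShiftIso (1 : ℤ)).inv.app _ =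
        (Q.commShiftIso (1 : ℤ)).inv.app _ ≫ Q.map ((Φ.map φ.τ₁)⟦(1 : ℤ)⟧') :=
      (Q.commShiftIso (1 : ℤ)).inv.naturality (Φ.map φ.τ₁)
    have h' : E.δ _ hS ≫ (Q.map (Φ.map φ.τ₁))⟦(1 : ℤ)⟧' =
        Q.map (Φ.map φ.τ₃) ≫ E.δ _ hS' := E.naturality φ hS hS'
    apply Q.map_injective
    rw [Q.map_comp, Q.map_comp, Q.map_preimage, Q.map_preimage, Category.assoc, ← h,
      reassoc_of% h']
  distinguished S hS := by
    rw [← Q.map_distinguished_iff]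
    refine isomorphic_distinguished _ (E.distinguished S hS) _
      (Triangle.isoMk _ _ (Iso.refl _) (Iso.refl _) (Iso.refl _) ?_ ?_ ?_)
    · exact (Category.comp_id _).trans (Category.id_comp _).symm
    · exact (Category.comp_id _).trans (Category.id_comp _).symm
    · have h : Q.map (Q.preimage (E.δ S hS ≫ (Q.commShiftIso (1 : ℤ)).inv.app _)) ≫
          (Q.commShiftIso (1 : ℤ)).hom.app _ = E.δ S hS := by
        rw [Q.map_preimage, Category.assoc, Iso.inv_hom_id_app]
        exact Category.comp_id _
      exact (congrArg₂ _ h (CategoryTheory.Functor.map_id _ _)).trans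
        ((Category.comp_id _).trans (Category.id_comp _).symm)

end ConnectingMorphisms

/-- The functor `L` is exact, for some compatibility isomorphisms with the shift. -/
def HoTriangulation.IsExact {M : ModelCategory A} (t : HoTriangulation M) (L : T ⥤ Ho M) : Prop :=
  letI := t.preadditive
  letI := t.hasZeroObject
  letI := t.hasShift
  letI := t.shift_additive
  letI := t.pretriangulated
  ∃ _ : L.CommShift ℤ, L.IsTriangulated

/-- If the homotopy category of an abelian model structure is a Verdier quotient of a triangulated
category `T`, then it inherits a triangulation from connecting morphisms with values in `T`. -/
theorem exists_hoTriangulation {M : ModelCategory A} (hM : IsAbelianModel M) [IsTriangulated T]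
    {Φ : A ⥤ T} [Φ.Additive] (E : ConnectingMorphisms Φ) (K : ObjectProperty T) [K.IsTriangulated]
    (L : T ⥤ Ho M) [L.IsLocalization K.trW] (e : Φ ⋙ L ≅ toHo M) :
    ∃ t : HoTriangulation M, t.IsExact L := by
  let : Preadditive (Ho M) := Localization.preadditive L K.trW
  have : L.Additive := Localization.functor_additive L K.trW
  have : HasZeroObject (Ho M) := L.hasZeroObject_of_additive
  let : HasShift (Ho M) ℤ := HasShift.localized L K.trW ℤ
  let : L.CommShift ℤ := Functor.CommShift.localized L K.trW ℤ
  have (n : ℤ) : (shiftFunctor (Ho M) n).Additive := by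
    rw [Localization.functor_additive_iff L K.trW]
    exact Functor.additive_of_iso (L.commShiftIso n)
  let : Pretriangulated (Ho M) := Triangulated.Localization.pretriangulated L K.trW
  have : L.IsTriangulated := Triangulated.Localization.isTriangulated_functor L K.trW
  let E' := (E.comp L).ofIso e
  refine ⟨{ preadditive := inferInstance
            hasZeroObject := inferInstance
            hasShift := inferInstance
            shift_additive := inferInstance
            pretriangulated := inferInstance
            isTriangulated := Triangulated.Localization.isTriangulated L K.trW
            toHo_additive := Functor.additive_of_iso e
            δ := E'.δ
            δ_naturality := E'.naturality
            distinguished_iff := fun T' => ⟨?_, ?_⟩ }, ⟨inferInstance, inferInstance⟩⟩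
  · intro hT'
    obtain ⟨S, hS, ⟨ε⟩⟩ := hM.exists_arrow_iso_map_f T'.mor₁
    exact ⟨S, hS, ⟨(exists_iso_of_arrow_iso T' _ hT' (E'.distinguished S hS) ε).choose⟩⟩
  · rintro ⟨S, hS, ⟨ε⟩⟩
    exact isomorphic_distinguished _ (E'.distinguished S hS) _ ε

end ConnectingMorphisms

section Orthogonal

variable {T D : Type*} [Category* T] [Category* D] [Preadditive T] [HasZeroObject T] [HasShift T ℤ]
  [∀ n : ℤ, (shiftFunctor T n).Additive] [Pretriangulated T] [IsTriangulated T]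
  (K : ObjectProperty T) [K.IsTriangulated] (L : T ⥤ D) [L.IsLocalization K.trW]

include K in
/-- A Verdier quotient functor `T ⥤ T/K` has a fully faithful right adjoint, with essential image
the right orthogonal of `K`, if every object of `T` has a morphism to a `K`-local object whose
cone is in `K`. -/
theorem exists_rightAdjoint_of_localization
    (hK : ∀ X : T, ∃ (Y : T) (s : X ⟶ Y), K.rightOrthogonal Y ∧ K.trW s) :
    ∃ (R : D ⥤ T) (adj : L ⊣ R), IsIso adj.counit ∧ ∀ X, R.essImage X ↔ K.rightOrthogonal X := by
  have := Localization.essSurj L K.trW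
  have H (Y : D) : ∃ Z : T, K.rightOrthogonal Z ∧ Nonempty (L.obj Z ≅ Y) := by
    obtain ⟨Z, s, hZ, hs⟩ := hK (L.objPreimage Y)
    have := Localization.inverts L K.trW s hs
    exact ⟨Z, hZ, ⟨(asIso (L.map s)).symm ≪≫ L.objObjPreimageIso Y⟩⟩
  choose Z hZ hZ' using H
  let ε (Y : D) : L.obj (Z Y) ≅ Y := (hZ' Y).some
  let b (X : T) (Y : D) : (X ⟶ Z Y) ≃ (L.obj X ⟶ Y) :=
    (Equiv.ofBijective _
      (ObjectProperty.rightOrthogonal.map_bijective_of_isTriangulated (hZ Y) L X)).trans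
      ((Iso.refl _).homCongr (ε Y))
  have hb (X : T) (Y : D) (f : X ⟶ Z Y) : b X Y f = L.map f ≫ (ε Y).hom := by
    simp [b, Iso.homCongr]
  have he (X' X : T) (Y : D) (f : X' ⟶ X) (g : L.obj X ⟶ Y) :
      (b X' Y).symm (L.map f ≫ g) = f ≫ (b X Y).symm g := by
    obtain ⟨g, rfl⟩ := (b X Y).surjective g
    rw [Equiv.symm_apply_eq, Equiv.symm_apply_apply, hb, hb, L.map_comp, Category.assoc]
  obtain ⟨R, adj, hR, hc⟩ : ∃ (R : D ⥤ T) (adj : L ⊣ R), (∀ Y, K.rightOrthogonal (R.obj Y)) ∧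
      ∀ Y, IsIso (adj.counit.app Y) := by
    let adj := Adjunction.adjunctionOfEquivRight (fun X Y => (b X Y).symm) he
    refine ⟨_, adj, hZ, fun Y => ?_⟩
    have : adj.counit.app Y = (ε Y).hom := by
      simp [adj, hb]
    rw [this]
    infer_instance
  refine ⟨R, adj, NatIso.isIso_of_isIso_app _, fun X => ⟨?_, fun hX => ?_⟩⟩
  · rintro ⟨Y, ⟨e⟩⟩
    exact K.rightOrthogonal.prop_of_iso e (hR Y)
  · -- the unit at a local object is an isomorphism, since `L` is fully faithful on local objects
    have hu := adj.left_triangle_components X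
    have : IsIso (L.map (adj.unit.app X)) := by
      have : IsIso (L.map (adj.unit.app X) ≫ adj.counit.app (L.obj X)) := by
        rw [hu]
        exact IsIso.id _
      exact IsIso.of_isIso_comp_right _ (adj.counit.app (L.obj X))
    have hX' := ObjectProperty.rightOrthogonal.map_bijective_of_isTriangulated hX L
    have hY' := ObjectProperty.rightOrthogonal.map_bijective_of_isTriangulated
      (hR (L.obj X)) L
    obtain ⟨g, hg⟩ := (hX' (R.obj (L.obj X))).2 (inv (L.map (adj.unit.app X)))
    have : IsIso (adj.unit.app X) := by
      refine ⟨g, (hX' _).1 ?_, (hY' _).1 ?_⟩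
      · exact (L.map_comp _ _).trans (by rw [hg, IsIso.hom_inv_id]; exact (L.map_id _).symm)
      · exact (L.map_comp _ _).trans (by rw [hg, IsIso.inv_hom_id]; exact (L.map_id _).symm)
    exact ⟨L.obj X, ⟨(asIso (adj.unit.app X)).symm⟩⟩

include K in
/-- A Verdier quotient functor `T ⥤ T/K` has a fully faithful left adjoint, with essential image
the left orthogonal of `K`, if every object of `T` receives a morphism from a `K`-colocal object
whose cone is in `K`. -/
theorem exists_leftAdjoint_of_localization
    (hK : ∀ X : T, ∃ (Y : T) (s : Y ⟶ X), K.leftOrthogonal Y ∧ K.trW s) :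
    ∃ (R : D ⥤ T) (adj : R ⊣ L), IsIso adj.unit ∧ ∀ X, R.essImage X ↔ K.leftOrthogonal X := by
  have := Localization.essSurj L K.trW
  have H (Y : D) : ∃ Z : T, K.leftOrthogonal Z ∧ Nonempty (L.obj Z ≅ Y) := by
    obtain ⟨Z, s, hZ, hs⟩ := hK (L.objPreimage Y)
    have := Localization.inverts L K.trW s hs
    exact ⟨Z, hZ, ⟨asIso (L.map s) ≪≫ L.objObjPreimageIso Y⟩⟩
  choose Z hZ hZ' using H
  let ε (Y : D) : L.obj (Z Y) ≅ Y := (hZ' Y).some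
  let b (Y : D) (X : T) : (Z Y ⟶ X) ≃ (Y ⟶ L.obj X) :=
    (Equiv.ofBijective _
      (ObjectProperty.leftOrthogonal.map_bijective_of_isTriangulated (hZ Y) L X)).trans
      ((ε Y).homCongr (Iso.refl _))
  have hb (Y : D) (X : T) (f : Z Y ⟶ X) : b Y X f = (ε Y).inv ≫ L.map f := by
    simp [b, Iso.homCongr]
  have he (Y : D) (X X' : T) (f : X ⟶ X') (g : Z Y ⟶ X) :
      b Y X' (g ≫ f) = b Y X g ≫ L.map f := by
    rw [hb, hb, L.map_comp, Category.assoc]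
  obtain ⟨R, adj, hR, hc⟩ : ∃ (R : D ⥤ T) (adj : R ⊣ L), (∀ Y, K.leftOrthogonal (R.obj Y)) ∧
      ∀ Y, IsIso (adj.unit.app Y) := by
    let adj := Adjunction.adjunctionOfEquivLeft b he
    refine ⟨_, adj, hZ, fun Y => ?_⟩
    have : adj.unit.app Y = (ε Y).inv := by
      simp [adj, hb]
    rw [this]
    infer_instance
  refine ⟨R, adj, NatIso.isIso_of_isIso_app _, fun X => ⟨?_, fun hX => ?_⟩⟩
  · rintro ⟨Y, ⟨e⟩⟩
    exact K.leftOrthogonal.prop_of_iso e (hR Y)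
  · -- the counit at a colocal object is an isomorphism, since `L` is fully faithful on such objects
    have hu := adj.right_triangle_components X
    have : IsIso (L.map (adj.counit.app X)) := by
      have : IsIso (adj.unit.app (L.obj X) ≫ L.map (adj.counit.app X)) := by
        rw [hu]
        exact IsIso.id _
      exact IsIso.of_isIso_comp_left (adj.unit.app (L.obj X)) _
    have hX' := ObjectProperty.leftOrthogonal.map_bijective_of_isTriangulated hX L
    have hY' := ObjectProperty.leftOrthogonal.map_bijective_of_isTriangulated
      (hR (L.obj X)) L
    obtain ⟨g, hg⟩ := (hX' (R.obj (L.obj X))).2 (inv (L.map (adj.counit.app X)))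
    have : IsIso (adj.counit.app X) := by
      refine ⟨g, (hY' _).1 ?_, (hX' _).1 ?_⟩
      · exact (L.map_comp _ _).trans (by rw [hg, IsIso.hom_inv_id]; exact (L.map_id _).symm)
      · exact (L.map_comp _ _).trans (by rw [hg, IsIso.inv_hom_id]; exact (L.map_id _).symm)
    exact ⟨L.obj X, ⟨asIso (adj.counit.app X)⟩⟩

end Orthogonal

/-! ### Orthogonality to large shifts, and fractions -/

section EventuallyOrthogonal

variable {A : Type*} [Category* A]
  {T : Type*} [Category* T] [Preadditive T] [HasZeroObject T] [HasShift T ℤ]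
  [∀ n : ℤ, (shiftFunctor T n).Additive] [Pretriangulated T]

/-- The objects `P` of `T` without nonzero morphisms to the large shifts of the objects `Φ.obj Y`
for `Y` in `F`, where the bound is uniform in `Y`. -/
def eventuallyLeftOrthogonal (Φ : A ⥤ T) (F : ObjectProperty A) : ObjectProperty T := fun P =>
  ∃ k : ℤ, ∀ Y, F Y → ∀ n, k ≤ n → ∀ f : P ⟶ (Φ.obj Y)⟦n⟧, f = 0

/-- The objects `P` of `T` whose large shifts receive no nonzero morphism from the objects
`Φ.obj X` for `X` in `C`, where the bound is uniform in `X`. -/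
def eventuallyRightOrthogonal (Φ : A ⥤ T) (C : ObjectProperty A) : ObjectProperty T := fun P =>
  ∃ k : ℤ, ∀ X, C X → ∀ n, k ≤ n → ∀ f : Φ.obj X ⟶ P⟦n⟧, f = 0

variable (Φ : A ⥤ T) (F : ObjectProperty A)

instance : (eventuallyLeftOrthogonal Φ F).IsClosedUnderIsomorphisms where
  of_iso e := by
    rintro ⟨k, hk⟩
    exact ⟨k, fun Y hY n hn f => by
      rw [← cancel_epi e.hom, hk Y hY n hn (e.hom ≫ f), comp_zero]⟩

instance : (eventuallyRightOrthogonal Φ F).IsClosedUnderIsomorphisms where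
  of_iso e := by
    rintro ⟨k, hk⟩
    exact ⟨k, fun Y hY n hn f => by
      rw [← cancel_mono (e.inv⟦n⟧'), hk Y hY n hn (f ≫ e.inv⟦n⟧'), zero_comp]⟩

instance : (eventuallyLeftOrthogonal Φ F).IsTriangulated where
  exists_zero := ⟨_, isZero_zero T, 0, fun _ _ _ _ _ => (isZero_zero T).eq_of_src _ _⟩
  isStableUnderShiftBy a := ⟨by
    rintro P ⟨k, hk⟩
    refine ⟨k + a, fun Y hY n hn f => (shiftFunctor T (-a)).map_injective ?_⟩
    rw [Functor.map_zero, ← cancel_epi ((shiftFunctorCompIsoId T a (-a) (by lia)).inv.app P),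
      ← cancel_mono ((shiftFunctorAdd' T n (-a) (n - a) (by lia)).inv.app (Φ.obj Y)), comp_zero,
      zero_comp]
    exact hk Y hY (n - a) (by lia) _⟩
  toIsTriangulatedClosed₂ := .mk' (by
    rintro X hX ⟨k₁, h₁⟩ ⟨k₃, h₃⟩
    refine ⟨max k₁ k₃, fun Y hY n hn f => ?_⟩
    obtain ⟨g, rfl⟩ := Triangle.yoneda_exact₂ _ hX f (h₁ Y hY n (le_of_max_le_left hn) _)
    rw [h₃ Y hY n (le_of_max_le_right hn) g, comp_zero])

instance : (eventuallyRightOrthogonal Φ F).IsTriangulated where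
  exists_zero := ⟨_, isZero_zero T, 0, fun _ _ n _ _ =>
    (IsZero.of_iso (isZero_zero T) ((shiftFunctor T n).mapZeroObject)).eq_of_tgt _ _⟩
  isStableUnderShiftBy a := ⟨by
    rintro P ⟨k, hk⟩
    refine ⟨k - a, fun Y hY n hn f => ?_⟩
    rw [← cancel_mono ((shiftFunctorAdd' T a n (n + a) (by lia)).inv.app P), zero_comp]
    exact hk Y hY (n + a) (by lia) _⟩
  toIsTriangulatedClosed₂ := .mk' (by
    rintro X hX ⟨k₁, h₁⟩ ⟨k₃, h₃⟩
    refine ⟨max k₁ k₃, fun Y hY n hn f => ?_⟩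
    have hX' := Triangle.shift_distinguished X hX n
    obtain ⟨g, rfl⟩ := Triangle.coyoneda_exact₂ _ hX' f (h₃ Y hY n (le_of_max_le_right hn) _)
    exact (congrArg (· ≫ _) (h₁ Y hY n (le_of_max_le_left hn) g)).trans zero_comp)

end EventuallyOrthogonal

section Fractions

variable {T V : Type*} [Category* T] [Category* V] [Preadditive T] [HasZeroObject T] [HasShift T ℤ]
  [∀ n : ℤ, (shiftFunctor T n).Additive] [Pretriangulated T] [IsTriangulated T]
  (N : ObjectProperty T) [N.IsTriangulated] (Q : T ⥤ V) [Q.IsLocalization N.trW]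
  {A : Type*} [Category* A] (Φ : A ⥤ T)

include N in
/-- Morphisms in a Verdier quotient computed by the fractions whose denominator is a morphism
out of `Φ.obj Y` from a weakly initial family `c`. -/
theorem exists_map_eq_of_leftFractions {X Y : A}
    (H : ∀ {P : T} (s : Φ.obj Y ⟶ P), N.trW s → ∃ (P' : T) (c : Φ.obj Y ⟶ P') (t : P ⟶ P'),
      N.trW c ∧ s ≫ t = c ∧ ∀ g : Φ.obj X ⟶ P', ∃ f : X ⟶ Y, Φ.map f ≫ c = g)
    (h : Q.obj (Φ.obj X) ⟶ Q.obj (Φ.obj Y)) : ∃ f : X ⟶ Y, Q.map (Φ.map f) = h := by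
  obtain ⟨φ, rfl⟩ := Localization.exists_leftFraction Q N.trW h
  obtain ⟨P', c, t, hc, hst, hf⟩ := H φ.s φ.hs
  obtain ⟨f, hf⟩ := hf (φ.f ≫ t)
  have := Localization.inverts Q N.trW c hc
  have := Localization.inverts Q N.trW φ.s φ.hs
  refine ⟨f, ?_⟩
  rw [← cancel_mono (Q.map c), ← Q.map_comp, hf, ← hst, Q.map_comp, Q.map_comp,
    MorphismProperty.LeftFraction.map_comp_map_s_assoc]

include N in
theorem exists_comp_eq_zero_of_leftFractions [Preadditive V] [Q.Additive] {X Y : A} (f : X ⟶ Y)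
    (hf : Q.map (Φ.map f) = 0) : ∃ (P : T) (s : Φ.obj Y ⟶ P), N.trW s ∧ Φ.map f ≫ s = 0 := by
  obtain ⟨P, s, hs, h⟩ := (MorphismProperty.map_eq_iff_postcomp Q N.trW (Φ.map f) 0).1
    (by rw [hf, Q.map_zero])
  exact ⟨P, s, hs, by rw [h, zero_comp]⟩

include N in
/-- Morphisms in a Verdier quotient computed by the fractions whose denominator is a morphism
to `Φ.obj X` from a weakly terminal family `c`. -/
theorem exists_map_eq_of_rightFractions {X Y : A}
    (H : ∀ {P : T} (s : P ⟶ Φ.obj X), N.trW s → ∃ (P' : T) (c : P' ⟶ Φ.obj X) (t : P' ⟶ P),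
      N.trW c ∧ t ≫ s = c ∧ ∀ g : P' ⟶ Φ.obj Y, ∃ f : X ⟶ Y, c ≫ Φ.map f = g)
    (h : Q.obj (Φ.obj X) ⟶ Q.obj (Φ.obj Y)) : ∃ f : X ⟶ Y, Q.map (Φ.map f) = h := by
  obtain ⟨φ, rfl⟩ := Localization.exists_rightFraction Q N.trW h
  obtain ⟨P', c, t, hc, hst, hf⟩ := H φ.s φ.hs
  obtain ⟨f, hf⟩ := hf (t ≫ φ.f)
  have := Localization.inverts Q N.trW c hc
  have := Localization.inverts Q N.trW φ.s φ.hs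
  refine ⟨f, ?_⟩
  rw [← cancel_epi (Q.map c), ← Q.map_comp, hf, ← hst, Q.map_comp, Q.map_comp, Category.assoc,
    MorphismProperty.RightFraction.map_s_comp_map]

include N in
theorem exists_comp_eq_zero_of_rightFractions [Preadditive V] [Q.Additive] {X Y : A} (f : X ⟶ Y)
    (hf : Q.map (Φ.map f) = 0) : ∃ (P : T) (s : P ⟶ Φ.obj X), N.trW s ∧ s ≫ Φ.map f = 0 := by
  obtain ⟨P, s, hs, h⟩ := (MorphismProperty.map_eq_iff_precomp Q N.trW (Φ.map f) 0).1
    (by rw [hf, Q.map_zero])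
  exact ⟨P, s, hs, by rw [h, comp_zero]⟩

end Fractions

/-! ### Extensions in injective and projective models -/

section DerivedCategory

open Abelian DerivedCategory

universe w w'

variable {A : Type u} [Category.{v} A] [Abelian A] [HasDerivedCategory.{w} A]

variable (A) in
/-- The connecting morphisms of the derived category. -/
noncomputable def singleConnectingMorphisms : ConnectingMorphisms (singleFunctor A 0) where
  δ _ hS := hS.singleδ
  naturality φ hS hS' := (ShortComplex.ShortExact.singleTriangle.map hS hS' φ).comm₃
  distinguished _ hS := hS.singleTriangle_distinguished

lemma trW_ext_comp [HasExt.{w'} A] (N : ObjectProperty (DerivedCategory A)) [N.IsTriangulated]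
    {X Y Z : A} {a b c : ℕ} {x : Ext X Y a} {y : Ext Y Z b} (h : a + b = c) (hx : N.trW x.hom)
    (hy : N.trW y.hom) : N.trW (x.comp y h).hom := by
  rw [Ext.comp_hom]
  exact N.trW.comp_mem _ _ hx (N.trW.comp_mem _ _ (hy.shift _) (N.trW_of_isIso _))

/-- The cone of the class of an extension is a shift of the middle term. -/
lemma trW_extClass [HasExt.{w'} A] {N : ObjectProperty (DerivedCategory A)} [N.IsTriangulated]
    {S : ShortComplex A} (hS : S.ShortExact) (h : N ((singleFunctor A 0).obj S.X₂)) :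
    N.trW hS.extClass.hom := by
  rw [ShortComplex.ShortExact.extClass_hom]
  exact ObjectProperty.trW.mk' N (T := hS.singleTriangle.rotate)
    (rot_of_distTriang _ hS.singleTriangle_distinguished) h

namespace IsInjectiveModel

variable {M : ModelCategory A} (h : IsInjectiveModel M)

include h

omit [HasDerivedCategory.{w} A] in
/-- A weakly trivial object has no higher extensions by fibrant objects. In degree one, this is the
lifting property. The higher degrees follow by dimension shifting, as the fibrant objects are closed
under cokernels of monomorphisms. -/
theorem ext_eq_zero [HasExt.{w'} A] {W : A} (hW : weaklyTrivial M W) {n : ℕ} {Y : A}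
    (hY : fibrant M Y) (x : Ext W Y (n + 1)) : x = 0 := by
  induction n generalizing Y with
  | zero =>
    obtain ⟨J, i, hi, hJ, hJ'⟩ := exists_cof_weaklyTrivial M Y
    have := h.mono_of_cof hi
    have := h.injective hJ hJ'
    have hS := shortExact_cokernel i
    obtain ⟨x, rfl⟩ := Ext.covariant_sequence_exact₁ W hS x (Ext.eq_zero_of_injective _) rfl
    obtain ⟨f, rfl⟩ := (Ext.mk₀_bijective _ _).2 x
    obtain ⟨g, rfl⟩ := h.exists_lift hS hY hW f
    rw [← Ext.mk₀_comp_mk₀, Ext.comp_assoc (a₂₃ := 1) _ _ _ (by lia) (by lia) (by lia),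
      hS.comp_extClass, Ext.comp_zero]
  | succ n hn =>
    obtain ⟨J, i, hi, hJ, hJ'⟩ := exists_cof_weaklyTrivial M Y
    have := h.mono_of_cof hi
    have := h.injective hJ hJ'
    have hS := shortExact_cokernel i
    obtain ⟨x, rfl⟩ := Ext.covariant_sequence_exact₁ W hS x (Ext.eq_zero_of_injective _) rfl
    rw [hn (h.closedUnderCokernelsOfMonos_fibrant _ hS hY hJ) x, Ext.zero_comp]

theorem eventuallyLeftOrthogonal_of_weaklyTrivial {W : A} (hW : weaklyTrivial M W) :
    eventuallyLeftOrthogonal (singleFunctor A 0) (fibrant M) ((singleFunctor A 0).obj W) := by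
  have := hasExt_of_hasDerivedCategory A
  refine ⟨1, fun Y hY n hn f => ?_⟩
  obtain ⟨n, rfl⟩ : ∃ m : ℕ, n = ((m + 1 : ℕ) : ℤ) := ⟨(n - 1).toNat, by lia⟩
  obtain ⟨x, rfl⟩ := (Ext.homEquiv (C := A)).surjective f
  rw [h.ext_eq_zero hW hY x]
  exact Ext.zero_hom _ _ _

/-- The classes `c`, obtained by splicing short exact sequences `0 ⟶ Y'' ⟶ I ⟶ Y' ⟶ 0` with `I`
fibrant and weakly trivial, identify `Ext X Y' (k + 1)` with the quotient of `X ⟶ Y` by the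
morphisms that factor through a weakly trivial object, for all `X`. -/
theorem exists_ext [HasExt.{w'} A] {Y : A} (hY : fibrant M Y) (k : ℕ) :
    ∃ (Y' : A) (c : Ext Y Y' (k + 1)), fibrant M Y' ∧
      (eventuallyLeftOrthogonal (singleFunctor A 0) (fibrant M)).trW c.hom ∧ ∀ X : A,
      (∀ g : Ext X Y' (k + 1), ∃ f : X ⟶ Y, (Ext.mk₀ f).comp c (zero_add _) = g) ∧
      ∀ f : X ⟶ Y, (Ext.mk₀ f).comp c (zero_add _) = 0 →
        ∃ (J : A) (a : X ⟶ J) (b : J ⟶ Y), weaklyTrivial M J ∧ a ≫ b = f := by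
  induction k with
  | zero =>
    obtain ⟨I, p, hp, -, hI⟩ := exists_fib_weaklyTrivial M Y
    have := h.epi_of_fib hp
    have hS := shortExact_kernel p
    have := h.injective (fibrant_of_fib hp hY) hI
    refine ⟨_, hS.extClass, (h.fib_g_iff hS).1 hp,
      trW_extClass hS (h.eventuallyLeftOrthogonal_of_weaklyTrivial hI), fun X => ⟨fun g => ?_,
        fun f hf => ?_⟩⟩
    · obtain ⟨x, rfl⟩ := Ext.covariant_sequence_exact₁ X hS g (Ext.eq_zero_of_injective _) rfl
      obtain ⟨f, rfl⟩ := (Ext.mk₀_bijective _ _).2 x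
      exact ⟨f, rfl⟩
    · obtain ⟨x, hx⟩ := Ext.covariant_sequence_exact₃ X hS _ _ hf
      obtain ⟨a, rfl⟩ := (Ext.mk₀_bijective _ _).2 x
      refine ⟨I, a, p, hI, (Ext.mk₀_bijective _ _).1 ?_⟩
      rw [← hx, Ext.mk₀_comp_mk₀]
  | succ k hk =>
    obtain ⟨Y', c, hY', hc, H⟩ := hk
    obtain ⟨I, p, hp, -, hI⟩ := exists_fib_weaklyTrivial M Y'
    have := h.epi_of_fib hp
    have hS := shortExact_kernel p
    have := h.injective (fibrant_of_fib hp hY') hI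
    have hassoc {X : A} (f : X ⟶ Y) : (Ext.mk₀ f).comp (c.comp hS.extClass rfl) (zero_add _) =
        ((Ext.mk₀ f).comp c (zero_add _)).comp hS.extClass rfl :=
      (Ext.comp_assoc _ _ _ _ _ (by lia)).symm
    refine ⟨_, c.comp hS.extClass rfl, (h.fib_g_iff hS).1 hp, trW_ext_comp _ _ hc
      (trW_extClass hS (h.eventuallyLeftOrthogonal_of_weaklyTrivial hI)), fun X => ⟨fun g => ?_,
        fun f hf => ?_⟩⟩
    · obtain ⟨x, rfl⟩ := Ext.covariant_sequence_exact₁ X hS g (Ext.eq_zero_of_injective _) rfl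
      obtain ⟨f, rfl⟩ := (H X).1 x
      exact ⟨f, hassoc f⟩
    · rw [hassoc] at hf
      obtain ⟨x, hx⟩ := Ext.covariant_sequence_exact₃ X hS _ _ hf
      refine (H X).2 f ?_
      rw [← hx, show x = 0 from Ext.eq_zero_of_injective x, Ext.zero_comp]

/-- Every denominator out of a fibrant object divides one of the classes of `exists_ext`. -/
theorem exists_leftDenominator {X Y : A} (hY : fibrant M Y) {P : DerivedCategory A}
    (s : (singleFunctor A 0).obj Y ⟶ P)
    (hs : (eventuallyLeftOrthogonal (singleFunctor A 0) (fibrant M)).trW s) :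
    ∃ (P' : DerivedCategory A) (c : (singleFunctor A 0).obj Y ⟶ P') (t : P ⟶ P'),
      (eventuallyLeftOrthogonal (singleFunctor A 0) (fibrant M)).trW c ∧ s ≫ t = c ∧
      (∀ g : (singleFunctor A 0).obj X ⟶ P', ∃ f : X ⟶ Y, (singleFunctor A 0).map f ≫ c = g) ∧
      ∀ f : X ⟶ Y, (singleFunctor A 0).map f ≫ c = 0 →
        ∃ (J : A) (a : X ⟶ J) (b : J ⟶ Y), weaklyTrivial M J ∧ a ≫ b = f := by
  have := hasExt_of_hasDerivedCategory A
  obtain ⟨Z, f, δ, hT, m, hm⟩ := ((ObjectProperty.trW_iff' _ _).1 hs)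
  obtain ⟨Y', c, hY', hc, H⟩ := h.exists_ext hY m.toNat
  have hfc : f ≫ c.hom = 0 := hm Y' hY' _ (by lia) _
  obtain ⟨t, ht⟩ := Triangle.yoneda_exact₂ _ hT c.hom hfc
  refine ⟨_, c.hom, t, hc, ht.symm, fun g => ?_, fun f hf => (H X).2 f ?_⟩
  · obtain ⟨x, rfl⟩ := (Ext.homEquiv (C := A)).surjective g
    obtain ⟨f, rfl⟩ := (H X).1 x
    exact ⟨f, Ext.singleFunctor_map_comp_hom _ _⟩
  · ext
    rw [← Ext.singleFunctor_map_comp_hom, hf, Ext.zero_hom]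

end IsInjectiveModel

namespace IsProjectiveModel

variable {M : ModelCategory A} (h : IsProjectiveModel M)

include h

omit [HasDerivedCategory.{w} A] in
/-- A cofibrant object has no higher extensions by weakly trivial objects. -/
theorem ext_eq_zero [HasExt.{w'} A] {W : A} (hW : weaklyTrivial M W) {n : ℕ} {X : A}
    (hX : cofibrant M X) (x : Ext X W (n + 1)) : x = 0 := by
  induction n generalizing X with
  | zero =>
    obtain ⟨J, p, hp, hJ, hJ'⟩ := exists_fib_weaklyTrivial M X
    have := h.epi_of_fib hp
    have := h.projective hJ hJ'
    have hS := shortExact_kernel p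
    obtain ⟨x, rfl⟩ := Ext.contravariant_sequence_exact₃ hS W x
      (Ext.eq_zero_of_projective _) (add_comm 1 0)
    obtain ⟨f, rfl⟩ := (Ext.mk₀_bijective _ _).2 x
    obtain ⟨g, rfl⟩ := h.exists_extension hS hX hW f
    rw [← Ext.mk₀_comp_mk₀, hS.extClass_comp_assoc]
  | succ n hn =>
    obtain ⟨J, p, hp, hJ, hJ'⟩ := exists_fib_weaklyTrivial M X
    have := h.epi_of_fib hp
    have := h.projective hJ hJ'
    have hS := shortExact_kernel p
    obtain ⟨x, rfl⟩ := Ext.contravariant_sequence_exact₃ hS W (n₀ := n + 1) x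
      (Ext.eq_zero_of_projective _) (by lia)
    rw [hn (h.closedUnderKernelsOfEpis_cofibrant _ hS hJ hX) x, Ext.comp_zero]

theorem eventuallyRightOrthogonal_of_weaklyTrivial {W : A} (hW : weaklyTrivial M W) :
    eventuallyRightOrthogonal (singleFunctor A 0) (cofibrant M) ((singleFunctor A 0).obj W) := by
  have := hasExt_of_hasDerivedCategory A
  refine ⟨1, fun X hX n hn f => ?_⟩
  obtain ⟨n, rfl⟩ : ∃ m : ℕ, n = ((m + 1 : ℕ) : ℤ) := ⟨(n - 1).toNat, by lia⟩
  obtain ⟨x, rfl⟩ := (Ext.homEquiv (C := A)).surjective f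
  rw [h.ext_eq_zero hW hX x]
  exact Ext.zero_hom _ _ _

/-- The classes `c`, obtained by splicing short exact sequences `0 ⟶ X' ⟶ P ⟶ X'' ⟶ 0` with `P`
cofibrant and weakly trivial, identify `Ext X' Y (k + 1)` with the quotient of `X ⟶ Y` by the
morphisms that factor through a weakly trivial object, for all `Y`. -/
theorem exists_ext [HasExt.{w'} A] {X : A} (hX : cofibrant M X) (k : ℕ) :
    ∃ (X' : A) (c : Ext X' X (k + 1)), cofibrant M X' ∧
      (eventuallyRightOrthogonal (singleFunctor A 0) (cofibrant M)).trW c.hom ∧ ∀ Y : A,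
      (∀ g : Ext X' Y (k + 1), ∃ f : X ⟶ Y, c.comp (Ext.mk₀ f) (add_zero _) = g) ∧
      ∀ f : X ⟶ Y, c.comp (Ext.mk₀ f) (add_zero _) = 0 →
        ∃ (J : A) (a : X ⟶ J) (b : J ⟶ Y), weaklyTrivial M J ∧ a ≫ b = f := by
  induction k with
  | zero =>
    obtain ⟨P, i, hi, -, hP⟩ := exists_cof_weaklyTrivial M X
    have := h.mono_of_cof hi
    have hS := shortExact_cokernel i
    have := h.projective (cofibrant_of_cof hi hX) hP
    refine ⟨_, hS.extClass, (h.cof_f_iff hS).1 hi,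
      trW_extClass hS (h.eventuallyRightOrthogonal_of_weaklyTrivial hP), fun Y => ⟨fun g => ?_,
        fun f hf => ?_⟩⟩
    · obtain ⟨x, rfl⟩ := Ext.contravariant_sequence_exact₃ hS Y g
        (Ext.eq_zero_of_projective _) (add_comm 1 0)
      obtain ⟨f, rfl⟩ := (Ext.mk₀_bijective _ _).2 x
      exact ⟨f, rfl⟩
    · obtain ⟨x, hx⟩ := Ext.contravariant_sequence_exact₁ hS Y _ _ hf
      obtain ⟨b, rfl⟩ := (Ext.mk₀_bijective _ _).2 x
      refine ⟨P, i, b, hP, (Ext.mk₀_bijective _ _).1 ?_⟩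
      rw [← hx, Ext.mk₀_comp_mk₀]
  | succ k hk =>
    obtain ⟨X', c, hX', hc, H⟩ := hk
    obtain ⟨P, i, hi, -, hP⟩ := exists_cof_weaklyTrivial M X'
    have := h.mono_of_cof hi
    have hS := shortExact_cokernel i
    have := h.projective (cofibrant_of_cof hi hX') hP
    have h1 : 1 + (k + 1) = k + 1 + 1 := by lia
    have hassoc {Y : A} (f : X ⟶ Y) : (hS.extClass.comp c h1).comp (Ext.mk₀ f) (add_zero _) =
        hS.extClass.comp (c.comp (Ext.mk₀ f) (add_zero _)) h1 :=
      Ext.comp_assoc _ _ _ _ _ (by lia)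
    refine ⟨_, hS.extClass.comp c h1, (h.cof_f_iff hS).1 hi, trW_ext_comp _ _
      (trW_extClass hS (h.eventuallyRightOrthogonal_of_weaklyTrivial hP)) hc,
        fun Y => ⟨fun g => ?_, fun f hf => ?_⟩⟩
    · obtain ⟨x, rfl⟩ := Ext.contravariant_sequence_exact₃ hS Y g (Ext.eq_zero_of_projective _) h1
      obtain ⟨f, rfl⟩ := (H Y).1 x
      exact ⟨f, hassoc f⟩
    · rw [hassoc] at hf
      obtain ⟨x, hx⟩ := Ext.contravariant_sequence_exact₁ hS Y _ _ hf
      refine (H Y).2 f ?_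
      rw [← hx, show x = 0 from Ext.eq_zero_of_projective x, Ext.comp_zero]

/-- Every denominator to a cofibrant object divides a shift of one of the classes of
`exists_ext`. -/
theorem exists_rightDenominator {X Y : A} (hX : cofibrant M X) {P : DerivedCategory A}
    (s : P ⟶ (singleFunctor A 0).obj X)
    (hs : (eventuallyRightOrthogonal (singleFunctor A 0) (cofibrant M)).trW s) :
    ∃ (P' : DerivedCategory A) (c : P' ⟶ (singleFunctor A 0).obj X) (t : P' ⟶ P),
      (eventuallyRightOrthogonal (singleFunctor A 0) (cofibrant M)).trW c ∧ t ≫ s = c ∧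
      (∀ g : P' ⟶ (singleFunctor A 0).obj Y, ∃ f : X ⟶ Y, c ≫ (singleFunctor A 0).map f = g) ∧
      ∀ f : X ⟶ Y, c ≫ (singleFunctor A 0).map f = 0 →
        ∃ (J : A) (a : X ⟶ J) (b : J ⟶ Y), weaklyTrivial M J ∧ a ≫ b = f := by
  have := hasExt_of_hasDerivedCategory A
  obtain ⟨Z, f, δ, hT, m, hm⟩ := ((ObjectProperty.trW_iff _ _).1 hs)
  obtain ⟨X', c, hX', hc, H⟩ := h.exists_ext hX m.toNat
  let n : ℤ := ((m.toNat + 1 : ℕ) : ℤ)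
  let e := shiftEquiv' (DerivedCategory A) (-n) n (by lia)
  let adj : shiftFunctor (DerivedCategory A) (-n) ⊣ shiftFunctor (DerivedCategory A) n :=
    e.toAdjunction
  let c' := (adj.homEquiv _ _).symm c.hom
  have hc' {Z : DerivedCategory A} (f : (singleFunctor A 0).obj X ⟶ Z) :
      adj.homEquiv _ _ (c' ≫ f) = c.hom ≫ f⟦n⟧' := by
    rw [adj.homEquiv_naturality_right, Equiv.apply_symm_apply]
  have hf : c' ≫ f = 0 := by
    apply (adj.homEquiv _ _).injective
    rw [hc', hm X' hX' n (by lia) (c.hom ≫ f⟦n⟧'), adj.homEquiv_unit, Functor.map_zero, comp_zero]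
  obtain ⟨t, ht⟩ := Triangle.coyoneda_exact₂ _ hT c' hf
  refine ⟨_, c', t, ?_, ht.symm, fun g => ?_, fun f hf => (H Y).2 f ?_⟩
  · have : c' = c.hom⟦-n⟧' ≫ adj.counit.app _ := adj.homEquiv_counit ..
    have : IsIso (adj.counit.app ((singleFunctor A 0).obj X)) :=
      inferInstanceAs (IsIso (e.counitIso.hom.app _))
    rw [‹c' = _›]
    exact MorphismProperty.comp_mem _ _ _ (hc.shift (-n)) (ObjectProperty.trW_of_isIso _ _)
  · obtain ⟨x, hx⟩ := (Ext.homEquiv (C := A)).surjective (adj.homEquiv _ _ g)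
    obtain ⟨f, rfl⟩ := (H Y).1 x
    refine ⟨f, (adj.homEquiv _ _).injective ?_⟩
    rw [hc', ← hx]
    exact Ext.hom_comp_singleFunctor_map_shift _ _
  · ext
    rw [← Ext.hom_comp_singleFunctor_map_shift, Ext.zero_hom]
    exact (hc' _).symm.trans (by rw [hf, adj.homEquiv_unit, Functor.map_zero, comp_zero])

end IsProjectiveModel

end DerivedCategory

/-! ### The triangulation of the homotopy category -/

section PresentsHo

variable {A : Type u} [Category.{v} A] [Abelian A] {M : ModelCategory A}

/-- A functor `Φ` which inverts the weak equivalences of `M`, which is full on morphisms from a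
cofibrant to a fibrant object, and which kills only such morphisms that factor through a weakly
trivial object. -/
structure PresentsHo {V : Type*} [Category* V] [Preadditive V] (M : ModelCategory A)
    (Φ : A ⥤ V) : Prop where
  inverts : (weq M).IsInvertedBy Φ
  surjective {X Y : A} (hX : cofibrant M X) (hY : fibrant M Y) (g : Φ.obj X ⟶ Φ.obj Y) :
    ∃ f : X ⟶ Y, Φ.map f = g
  factors {X Y : A} (hX : cofibrant M X) (hY : fibrant M Y) (f : X ⟶ Y) (hf : Φ.map f = 0) :
    ∃ (J : A) (a : X ⟶ J) (b : J ⟶ Y), weaklyTrivial M J ∧ a ≫ b = f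

/-- Morphisms whose difference factors through a weakly trivial object become equal in the
homotopy category. -/
lemma IsAbelianModel.toHo_map_eq (h : IsAbelianModel M) {X Y J : A} (f g : X ⟶ Y) (a : X ⟶ J)
    (b : J ⟶ Y) (hJ : weaklyTrivial M J) (hfg : a ≫ b = f - g) :
    (toHo M).map f = (toHo M).map g := by
  have hS : (ShortComplex.mk (biprod.inr : J ⟶ X ⊞ J) (biprod.fst : X ⊞ J ⟶ X)
      (by simp)).ShortExact :=
    { exact := ShortComplex.Splitting.exact
        { r := biprod.snd, s := biprod.inl, id := by simp [add_comm, biprod.total] } }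
  have := isIso_toHo_map (h.weq_g hS hJ)
  -- the two morphisms are obtained from two sections of the weak equivalence `X ⊞ J ⟶ X`
  have hs : (toHo M).map (biprod.lift (𝟙 X) a) = (toHo M).map (biprod.lift (𝟙 X) 0) := by
    rw [← cancel_mono ((toHo M).map (biprod.fst : X ⊞ J ⟶ X)), ← Functor.map_comp,
      ← Functor.map_comp, biprod.lift_fst, biprod.lift_fst]
  have h₁ : f = biprod.lift (𝟙 X) a ≫ biprod.desc g b := by
    rw [biprod.lift_desc, Category.id_comp, hfg, add_sub_cancel]
  have h₂ : g = biprod.lift (𝟙 X) 0 ≫ biprod.desc g b := by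
    rw [biprod.lift_desc, Category.id_comp, zero_comp, add_zero]
  rw [h₁, Functor.map_comp, hs, ← Functor.map_comp, ← h₂]

/-- A functor out of a homotopy category is fully faithful if it is so on morphisms from a
cofibrant to a fibrant object. -/
lemma full_faithful_of_bijective {V : Type*} [Category* V] (G : Ho M ⥤ V)
    (hG : ∀ X Y : A, cofibrant M X → fibrant M Y → Function.Bijective
      (G.map : ((toHo M).obj X ⟶ (toHo M).obj Y) → _)) : G.Full ∧ G.Faithful := by
  have H (X Y : Ho M) : Function.Bijective (G.map : (X ⟶ Y) → _) := by
    obtain ⟨X', hX, -, ⟨eX⟩⟩ := exists_bifibrant_iso X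
    obtain ⟨Y', -, hY, ⟨eY⟩⟩ := exists_bifibrant_iso Y
    refine ⟨fun f g hfg => ?_, fun g => ?_⟩
    · rw [← cancel_epi eX.hom, ← cancel_mono eY.inv]
      apply (hG _ _ hX hY).1
      simp only [Functor.map_comp, hfg]
    · obtain ⟨f, hf⟩ := (hG _ _ hX hY).2 (G.map eX.hom ≫ g ≫ G.map eY.inv)
      refine ⟨eX.inv ≫ f ≫ eY.hom, ?_⟩
      rw [G.map_comp, G.map_comp, hf, Category.assoc, Category.assoc, ← G.map_comp, eY.inv_hom_id,
        ← G.map_comp_assoc, eX.inv_hom_id]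
      simp
  exact ⟨⟨fun {X Y} => (H X Y).2⟩, ⟨fun {X Y} _ _ h => (H X Y).1 h⟩⟩

lemma isZero_of_inverts {V : Type*} [Category* V] [Preadditive V] {Φ : A ⥤ V} [Φ.Additive]
    (hΦ : (weq M).IsInvertedBy Φ) {X : A} (hX : weaklyTrivial M X) :
    IsZero (Φ.obj X) := by
  have := hΦ _ ((weaklyTrivial_iff_of_isZero (isZero_zero A) ((isZero_zero A).to_ X)).1 hX)
  exact (Φ.map_isZero (isZero_zero A)).of_iso (asIso (Φ.map ((isZero_zero A).to_ X))).symm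

namespace PresentsHo

variable {V : Type*} [Category* V] [Preadditive V] {Φ : A ⥤ V} (hΦ : PresentsHo M Φ)

include hΦ

lemma toHo_map_eq [Φ.Additive] (hM : IsAbelianModel M) {X Y : A} (hX : cofibrant M X)
    (hY : fibrant M Y) (f g : X ⟶ Y) (hfg : Φ.map f = Φ.map g) :
    (toHo M).map f = (toHo M).map g := by
  obtain ⟨J, a, b, hJ, hab⟩ := hΦ.factors hX hY (f - g) (by rw [Φ.map_sub, hfg, sub_self])
  exact hM.toHo_map_eq f g a b hJ hab

/-- The induced functor on the homotopy category is fully faithful. -/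
lemma exists_fullyFaithful [Φ.Additive] (hM : IsAbelianModel M) :
    ∃ (G : Ho M ⥤ V) (_ : toHo M ⋙ G ≅ Φ), G.Full ∧ G.Faithful := by
  refine ⟨_, Localization.fac Φ hΦ.inverts (toHo M), full_faithful_of_bijective _
    fun X Y hX hY => ?_⟩
  have e := Localization.fac Φ hΦ.inverts (toHo M)
  refine ⟨fun f g hfg => ?_, fun g => ?_⟩
  · obtain ⟨f, rfl⟩ := toHo_map_surjective hX hY f
    obtain ⟨g, rfl⟩ := toHo_map_surjective hX hY g
    refine hΦ.toHo_map_eq hM hX hY f g ?_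
    rw [← cancel_epi (e.hom.app X), ← e.hom.naturality, ← e.hom.naturality]
    exact congrArg (· ≫ e.hom.app Y) hfg
  · obtain ⟨f, hf⟩ := hΦ.surjective hX hY (e.inv.app X ≫ g ≫ e.hom.app Y)
    refine ⟨(toHo M).map f, ?_⟩
    rw [← cancel_mono (e.hom.app Y)]
    refine (e.hom.naturality f).trans ?_
    rw [hf, Iso.hom_inv_id_app_assoc]

/-- The objects which vanish in the homotopy category are weakly trivial: the identity of a
bifibrant replacement factors through a weakly trivial object. -/
lemma weaklyTrivial_of_isZero [Φ.Additive] {X : A} (hX : IsZero ((toHo M).obj X)) :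
    weaklyTrivial M X := by
  obtain ⟨Q, p, hQ, -, hp⟩ := exists_cofibrant_replacement M X
  obtain ⟨B, i, hB, hi, hi'⟩ := exists_fibrant_replacement M Q
  have := isIso_toHo_map hp
  have := isIso_toHo_map hi'
  have hB' : IsZero ((toHo M).obj B) :=
    hX.of_iso ((asIso ((toHo M).map i)).symm ≪≫ asIso ((toHo M).map p))
  have hB'' : Φ.map (𝟙 B) = 0 := by
    have e := Localization.fac Φ hΦ.inverts (toHo M)
    rw [← Φ.map_zero, ← cancel_epi (e.hom.app B), ← e.hom.naturality, ← e.hom.naturality]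
    exact congrArg (fun f => (Localization.lift Φ hΦ.inverts (toHo M)).map f ≫ e.hom.app B)
      (hB'.eq_of_src ((toHo M).map (𝟙 B)) ((toHo M).map 0))
  obtain ⟨J, a, b, hJ, hab⟩ := hΦ.factors (cofibrant_of_cof hi hQ) hB (𝟙 B) hB''
  rw [← weaklyTrivial_of_weq hp, weaklyTrivial_of_weq hi']
  exact (weaklyTrivial M).prop_of_retract ⟨a, b, hab⟩ hJ

end PresentsHo

end PresentsHo

section

variable {A : Type u} [Category.{v} A] [Abelian A] {M : ModelCategory A}
  {V : Type*} [Category* V] [Preadditive V] [HasZeroObject V] [HasShift V ℤ]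
  [∀ n : ℤ, (shiftFunctor V n).Additive] [Pretriangulated V] {Φ : A ⥤ V} [Φ.Additive]

namespace PresentsHo

variable (hΦ : PresentsHo M Φ) (E : ConnectingMorphisms Φ) (hM : IsAbelianModel M)

include hΦ E hM

/-- The objects isomorphic to some `Φ.obj X` are a triangulated subcategory. -/
lemma isTriangulated_essImage (G : Ho M ⥤ V) (e : toHo M ⋙ G ≅ Φ) [G.Full] :
    G.essImage.IsTriangulated := by
  have hmem {P : V} (X : A) (f : Φ.obj X ≅ P) : G.essImage P := ⟨_, ⟨e.app X ≪≫ f⟩⟩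
  have hmap : G.essImage = (⊤ : ObjectProperty A).map Φ := by
    ext P
    rw [ObjectProperty.prop_map_iff]
    refine ⟨?_, fun ⟨X, _, ⟨f⟩⟩ => hmem X f⟩
    rintro ⟨X, ⟨f⟩⟩
    obtain ⟨B, -, -, ⟨g⟩⟩ := exists_bifibrant_iso X
    exact ⟨B, trivial, ⟨(e.app B).symm ≪≫ G.mapIso g ≪≫ f⟩⟩
  have : G.essImage.IsStableUnderShift ℤ := by
    rw [hmap]
    refine E.isStableUnderShift_map _ (fun X _ => ?_) (fun X _ => ?_)
    · obtain ⟨J, i, hi, -, hJ⟩ := exists_cof_weaklyTrivial M X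
      exact ⟨J, i, hM.mono_of_cof hi, isZero_of_inverts hΦ.inverts hJ, trivial⟩
    · obtain ⟨J, p, hp, -, hJ⟩ := exists_fib_weaklyTrivial M X
      exact ⟨J, p, hM.epi_of_fib hp, isZero_of_inverts hΦ.inverts hJ, trivial⟩
  have : G.essImage.IsTriangulatedClosed₃ := .mk' (by
    rintro T hT ⟨X, ⟨f⟩⟩ ⟨Y, ⟨g⟩⟩
    obtain ⟨φ, hφ⟩ := G.map_surjective (f.hom ≫ T.mor₁ ≫ g.inv)
    obtain ⟨S, hS, ⟨ε⟩⟩ := hM.exists_arrow_iso_map_f φ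
    have ε₁ : Arrow.mk T.mor₁ ≅ Arrow.mk (G.map φ) :=
      Arrow.isoMk f.symm g.symm (by simp [hφ])
    have ε₂ : Arrow.mk (G.map ((toHo M).map S.f)) ≅ Arrow.mk (Φ.map S.f) :=
      Arrow.isoMk (e.app _) (e.app _) (e.hom.naturality S.f).symm
    obtain ⟨ε₃, -⟩ := exists_iso_of_arrow_iso T _ hT (E.distinguished S hS)
      (ε₁ ≪≫ G.mapArrow.mapIso ε ≪≫ ε₂)
    exact hmem _ (Triangle.π₃.mapIso ε₃).symm)
  have : G.essImage.IsTriangulatedClosed₂ := .of_isTriangulatedClosed₃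
  exact { exists_zero := ⟨_, Φ.map_isZero (isZero_zero A), hmem _ (Iso.refl _)⟩ }

/-- The homotopy category inherits a triangulation, in which the zero objects are the weakly
trivial objects. -/
theorem exists_hoTriangulation [IsTriangulated V] :
    ∃ _ : HoTriangulation M, ∀ X : A, IsZero ((toHo M).obj X) ↔ weaklyTrivial M X := by
  obtain ⟨G, e, _, _⟩ := hΦ.exists_fullyFaithful hM
  have := hΦ.isTriangulated_essImage E hM G e
  let Ψ : A ⥤ G.EssImageSubcategory := toHo M ⋙ G.toEssImage
  let ι : G.EssImageSubcategory ⥤ V := G.essImage.ι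
  have e' : Φ ≅ Ψ ⋙ ι := e.symm
  have : (Ψ ⋙ ι).Additive := Functor.additive_of_iso e'
  have : Ψ.Additive := Functor.additive_of_comp_faithful Ψ ι
  have : G.toEssImage.IsEquivalence := {}
  -- the equivalence is the Verdier quotient by the class `K` of the zero objects
  let K := (⊤ : ObjectProperty G.EssImageSubcategory).rightOrthogonal
  have hK : K.trW ≤ MorphismProperty.isomorphisms _ := by
    intro X Y f hf
    obtain ⟨Z, g, h, hT, hZ⟩ := (ObjectProperty.trW_iff _ _).1 hf
    exact (Triangle.isZero₃_iff_isIso₁ _ hT).1 ((IsZero.iff_id_eq_zero _).2 (hZ _ trivial))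
  have : G.toEssImage.inv.IsLocalization K.trW := .of_isEquivalence _ _ hK
  obtain ⟨t, -⟩ := AbModel.exists_hoTriangulation hM ((E.ofIso e').ofCompFullyFaithful ι) K
    G.toEssImage.inv (Functor.isoWhiskerLeft (toHo M) G.toEssImage.asEquivalence.unitIso.symm)
  let := t.preadditive
  have := t.toHo_additive
  exact ⟨t, fun X => ⟨hΦ.weaklyTrivial_of_isZero,
    isZero_of_inverts fun _ _ _ hf => isIso_toHo_map hf⟩⟩

end PresentsHo

end

section Existence

open DerivedCategory

variable {A : Type u} [Category.{v} A] [Abelian A] {M : ModelCategory A}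

/-- A functor inverts the weak equivalences if it comes from a Verdier quotient of the derived
category which kills the weakly trivial objects. -/
lemma IsAbelianModel.isInvertedBy_singleFunctor_comp [HasDerivedCategory A]
    (hM : IsAbelianModel M) (N : ObjectProperty (DerivedCategory A)) [N.IsTriangulated]
    (hN : ∀ X, weaklyTrivial M X → N ((singleFunctor A 0).obj X)) :
    (weq M).IsInvertedBy (singleFunctor A 0 ⋙ N.trW.Q) := by
  intro X Y f hf
  obtain ⟨Z, i, p, rfl, hi, hi', hp⟩ := exists_trivialCof_fib M f
  have hp' : weq M p := (weq M).of_precomp _ _ hi' hf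
  have := hM.mono_of_cof hi
  have := hM.epi_of_fib hp
  have h₁ : N.trW ((singleFunctor A 0).map i) := ObjectProperty.trW.mk N
    (shortExact_cokernel i).singleTriangle_distinguished
    (hN _ (IsAbelianModel.weaklyTrivial_of_trivialCof (shortExact_cokernel i) hi hi'))
  have h₂ : N.trW ((singleFunctor A 0).map p) := ObjectProperty.trW.mk' N
    (shortExact_kernel p).singleTriangle_distinguished
    (hN _ (IsAbelianModel.weaklyTrivial_of_trivialFib (shortExact_kernel p) hp hp'))
  have := Localization.inverts N.trW.Q N.trW _ h₁
  have := Localization.inverts N.trW.Q N.trW _ h₂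
  change IsIso (N.trW.Q.map ((singleFunctor A 0).map (i ≫ p)))
  rw [Functor.map_comp, Functor.map_comp]
  infer_instance

/-- The homotopy category of an injective abelian model structure is triangulated. -/
theorem IsInjectiveModel.exists_hoTriangulation (h : IsInjectiveModel M) :
    ∃ _ : HoTriangulation M, ∀ X : A, IsZero ((toHo M).obj X) ↔ weaklyTrivial M X := by
  let := HasDerivedCategory.standard A
  let N := eventuallyLeftOrthogonal (singleFunctor A 0) (fibrant M)
  have hΦ : PresentsHo M (singleFunctor A 0 ⋙ N.trW.Q) :=
    { inverts := h.isInvertedBy_singleFunctor_comp N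
        fun X hX => h.eventuallyLeftOrthogonal_of_weaklyTrivial hX
      surjective := fun {X Y} _ hY g =>
        exists_map_eq_of_leftFractions N N.trW.Q (singleFunctor A 0) (fun s hs => by
          obtain ⟨P', c, t, hc, hst, H, -⟩ := h.exists_leftDenominator (X := X) hY s hs
          exact ⟨P', c, t, hc, hst, H⟩) g
      factors := fun {X Y} _ hY f hf => by
        obtain ⟨P, s, hs, hfs⟩ := exists_comp_eq_zero_of_leftFractions N N.trW.Q _ f hf
        obtain ⟨P', c, t, hc, hst, -, H⟩ := h.exists_leftDenominator (X := X) hY s hs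
        exact H f (by rw [← hst, reassoc_of% hfs, zero_comp]) }
  exact hΦ.exists_hoTriangulation ((singleConnectingMorphisms A).comp N.trW.Q) h.toIsAbelianModel

/-- The homotopy category of a projective abelian model structure is triangulated. -/
theorem IsProjectiveModel.exists_hoTriangulation (h : IsProjectiveModel M) :
    ∃ _ : HoTriangulation M, ∀ X : A, IsZero ((toHo M).obj X) ↔ weaklyTrivial M X := by
  let := HasDerivedCategory.standard A
  let N := eventuallyRightOrthogonal (singleFunctor A 0) (cofibrant M)
  have hΦ : PresentsHo M (singleFunctor A 0 ⋙ N.trW.Q) :=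
    { inverts := h.isInvertedBy_singleFunctor_comp N
        fun X hX => h.eventuallyRightOrthogonal_of_weaklyTrivial hX
      surjective := fun {X Y} hX _ g =>
        exists_map_eq_of_rightFractions N N.trW.Q (singleFunctor A 0) (fun s hs => by
          obtain ⟨P', c, t, hc, hst, H, -⟩ := h.exists_rightDenominator (Y := Y) hX s hs
          exact ⟨P', c, t, hc, hst, H⟩) g
      factors := fun {X Y} hX _ f hf => by
        obtain ⟨P, s, hs, hfs⟩ := exists_comp_eq_zero_of_rightFractions N N.trW.Q _ f hf
        obtain ⟨P', c, t, hc, hst, -, H⟩ := h.exists_rightDenominator (Y := Y) hX s hs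
        exact H f (by rw [← hst, Category.assoc, hfs, comp_zero]) }
  exact hΦ.exists_hoTriangulation ((singleConnectingMorphisms A).comp N.trW.Q) h.toIsAbelianModel

end Existence

/-! ### Semiorthogonal decompositions, and weak equivalences detected by cones -/

section Triangulated

open ZeroObject

variable {T : Type*} [Category* T] [Preadditive T] [HasZeroObject T] [HasShift T ℤ]
  [∀ n : ℤ, (shiftFunctor T n).Additive] [Pretriangulated T]

instance (P : ObjectProperty T) : P.rightOrthogonal.IsStableUnderRetracts where
  of_retract r hY X f hX := by
    rw [← Category.comp_id f, ← r.retract, reassoc_of% hY (f ≫ r.i) hX, zero_comp]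

instance (P : ObjectProperty T) : P.leftOrthogonal.IsStableUnderRetracts where
  of_retract r hX Y f hY := by
    rw [← Category.id_comp f, ← r.retract, Category.assoc, hX (r.r ≫ f) hY, comp_zero]

/-- By the octahedral axiom, the cones of two composable morphisms and of their composition are
the terms of a distinguished triangle. -/
instance [IsTriangulated T] (P : ObjectProperty T) [P.IsTriangulated] :
    P.trW.HasTwoOutOfThreeProperty where
  of_postcomp := by
    rw [← P.trW_isoClosure]
    intro X Y Z f g hg hfg
    obtain ⟨Z₁₂, v₁₂, w₁₂, H₁₂⟩ := distinguished_cocone_triangle f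
    obtain ⟨Z₂₃, v₂₃, w₂₃, H₂₃⟩ := distinguished_cocone_triangle g
    obtain ⟨Z₁₃, v₁₃, w₁₃, H₁₃⟩ := distinguished_cocone_triangle (f ≫ g)
    refine (P.isoClosure.trW_iff_of_distinguished _ H₁₂).2 ?_
    have H := (Triangulated.someOctahedron rfl H₁₂ H₂₃ H₁₃).mem
    exact P.isoClosure.ext_of_isTriangulatedClosed₁ _ H
      ((P.isoClosure.trW_iff_of_distinguished _ H₁₃).1 hfg)
      ((P.isoClosure.trW_iff_of_distinguished _ H₂₃).1 hg)
  of_precomp := by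
    rw [← P.trW_isoClosure]
    intro X Y Z f g hf hfg
    obtain ⟨Z₁₂, v₁₂, w₁₂, H₁₂⟩ := distinguished_cocone_triangle f
    obtain ⟨Z₂₃, v₂₃, w₂₃, H₂₃⟩ := distinguished_cocone_triangle g
    obtain ⟨Z₁₃, v₁₃, w₁₃, H₁₃⟩ := distinguished_cocone_triangle (f ≫ g)
    refine (P.isoClosure.trW_iff_of_distinguished _ H₂₃).2 ?_
    have H := (Triangulated.someOctahedron rfl H₁₂ H₂₃ H₁₃).mem
    have H' := P.isoClosure.ext_of_isTriangulatedClosed₃ _ H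
      ((P.isoClosure.trW_iff_of_distinguished _ H₁₂).1 hf)
      ((P.isoClosure.trW_iff_of_distinguished _ H₁₃).1 hfg)
    exact H'

/-- The kernel of the Verdier quotient by a thick subcategory `K` is `K`. -/
lemma isZero_obj_iff_of_isLocalization [IsTriangulated T] (K : ObjectProperty T) [K.IsTriangulated]
    [K.IsStableUnderRetracts] {D : Type*} [Category* D] [Preadditive D] (L : T ⥤ D) [L.Additive]
    [L.IsLocalization K.trW] (X : T) : IsZero (L.obj X) ↔ K X := by
  refine ⟨fun hX => ?_, fun hX => ?_⟩
  · obtain ⟨Y, s, hs, h⟩ := (MorphismProperty.map_eq_iff_postcomp L K.trW (𝟙 X) 0).1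
      (hX.eq_of_src _ _)
    obtain ⟨Z, g, δ, hT, hZ⟩ := (ObjectProperty.trW_iff _ _).1 hs
    have hs : s = 0 := by rw [← Category.id_comp s, h, zero_comp]
    -- the cone of the zero morphism `s` contains `X⟦1⟧` as a direct summand
    obtain ⟨r, hr⟩ := Triangle.coyoneda_exact₁ _ hT (𝟙 (X⟦(1 : ℤ)⟧)) (by
      change 𝟙 (X⟦(1 : ℤ)⟧) ≫ s⟦(1 : ℤ)⟧' = 0
      rw [hs, Functor.map_zero, comp_zero])
    have h : K (X⟦(1 : ℤ)⟧) := K.prop_of_retract ⟨r, δ, hr.symm⟩ hZ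
    exact K.prop_of_iso ((shiftFunctorCompIsoId T (1 : ℤ) (-1) (by lia)).app X)
      (K.le_shift (-1 : ℤ) _ h)
  · have : IsIso (L.map (0 : 0 ⟶ X)) := Localization.inverts L K.trW _ (ObjectProperty.trW.mk K
      (contractible_distinguished₁ X) hX)
    exact (L.map_isZero (isZero_zero T)).of_iso (asIso (L.map (0 : 0 ⟶ X))).symm

/-- A semiorthogonal decomposition of a triangulated category: `U` and `V` are each other's
orthogonals, and every object is an extension of an object of `V` by an object of `U`. -/
structure IsSemiorthogonal (U V : ObjectProperty T) : Prop where
  stable : U.IsStableUnderShift ℤ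
  right : U.rightOrthogonal = V
  left : V.leftOrthogonal = U
  exists_triangle (Z : T) : ∃ (X Y : T) (f : X ⟶ Z) (g : Z ⟶ Y) (h : Y ⟶ X⟦(1 : ℤ)⟧),
    U X ∧ V Y ∧ Triangle.mk f g h ∈ distTriang T

/-- Two orthogonal classes which generate the triangulated category by extensions are contained
in the two parts of a semiorthogonal decomposition. -/
theorem exists_isSemiorthogonal (U₀ V₀ : ObjectProperty T)
    (horth : ∀ {X Y : T} (f : X ⟶ Y), U₀ X → V₀ Y → f = 0)
    (hs : U₀.IsStableUnderShift ℤ ∨ V₀.IsStableUnderShift ℤ)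
    (htri : ∀ Z : T, ∃ T' ∈ distTriang T, U₀ T'.obj₁ ∧ V₀ T'.obj₃ ∧ Nonempty (T'.obj₂ ≅ Z)) :
    ∃ U V : ObjectProperty T, IsSemiorthogonal U V ∧ U₀ ≤ U ∧ V₀ ≤ V := by
  have htri' (Z : T) : ∃ (X Y : T) (f : X ⟶ Z) (g : Z ⟶ Y) (h : Y ⟶ X⟦(1 : ℤ)⟧),
      U₀ X ∧ V₀ Y ∧ Triangle.mk f g h ∈ distTriang T := by
    obtain ⟨T', hT', hU, hV, ⟨e⟩⟩ := htri Z
    exact ⟨_, _, T'.mor₁ ≫ e.hom, e.inv ≫ T'.mor₂, T'.mor₃, hU, hV, isomorphic_distinguished _ hT' _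
      (Triangle.isoMk _ _ (Iso.refl _) e.symm (Iso.refl _)
        (by change (T'.mor₁ ≫ e.hom) ≫ e.inv = 𝟙 T'.obj₁ ≫ T'.mor₁; simp)
        (by change (e.inv ≫ T'.mor₂) ≫ 𝟙 T'.obj₃ = e.inv ≫ T'.mor₂; simp)
        (by change T'.mor₃ ≫ (𝟙 T'.obj₁)⟦(1 : ℤ)⟧' = 𝟙 T'.obj₃ ≫ T'.mor₃; simp))⟩
  obtain hs | hs := hs
  · have hU : U₀ ≤ U₀.rightOrthogonal.leftOrthogonal := fun X hX Y f hY => hY f hX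
    have hV : V₀ ≤ U₀.rightOrthogonal := fun Y hY X f hX => horth f hX hY
    refine ⟨_, U₀.rightOrthogonal, ⟨inferInstance, ?_, rfl, fun Z => ?_⟩, hU, hV⟩
    · exact le_antisymm (fun Y hY X f hX => hY f (hU _ hX)) fun Y hY X f hX => hX f hY
    · obtain ⟨X, Y, f, g, h, hX, hY, hT⟩ := htri' Z
      exact ⟨X, Y, f, g, h, hU _ hX, hV _ hY, hT⟩
  · have hV : V₀ ≤ V₀.leftOrthogonal.rightOrthogonal := fun X hX Y f hY => hY f hX
    have hU : U₀ ≤ V₀.leftOrthogonal := fun X hX Y f hY => horth f hX hY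
    refine ⟨V₀.leftOrthogonal, _, ⟨inferInstance, rfl, ?_, fun Z => ?_⟩, hU, hV⟩
    · exact le_antisymm (fun Y hY X f hX => hY f (hV _ hX)) fun Y hY X f hX => hX f hY
    · obtain ⟨X, Y, f, g, h, hX, hY, hT⟩ := htri' Z
      exact ⟨X, Y, f, g, h, hU _ hX, hV _ hY, hT⟩

namespace IsSemiorthogonal

variable {U V : ObjectProperty T} (h : IsSemiorthogonal U V)

include h

lemma isTriangulated_right : V.IsTriangulated := by
  have := h.stable
  rw [← h.right]
  infer_instance

lemma isTriangulated_left : U.IsTriangulated := by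
  have := h.isTriangulated_right
  rw [← h.left]
  infer_instance

lemma isStableUnderRetracts_right : V.IsStableUnderRetracts := by
  rw [← h.right]
  infer_instance

lemma isStableUnderRetracts_left : U.IsStableUnderRetracts := by
  rw [← h.left]
  infer_instance

lemma isClosedUnderIsomorphisms_right : V.IsClosedUnderIsomorphisms := by
  rw [← h.right]
  infer_instance

lemma isClosedUnderIsomorphisms_left : U.IsClosedUnderIsomorphisms := by
  rw [← h.left]
  infer_instance

lemma isZero {X : T} (hU : U X) (hV : V X) : IsZero X := by
  rw [← h.right] at hV
  exact (IsZero.iff_id_eq_zero X).2 (hV _ hU)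

lemma isZero_iff (X : T) : IsZero X ↔ U X ∧ V X := by
  have := h.isTriangulated_left
  have := h.isTriangulated_right
  have := h.isClosedUnderIsomorphisms_left
  have := h.isClosedUnderIsomorphisms_right
  exact ⟨fun hX => ⟨U.prop_of_isZero hX, V.prop_of_isZero hX⟩, fun hX => h.isZero hX.1 hX.2⟩

variable [IsTriangulated T] {D : Type*} [Category* D] (L : T ⥤ D)

/-- The quotient by `U` has a fully faithful right adjoint with essential image `V`. -/
lemma exists_rightAdjoint [L.IsLocalization U.trW] :
    ∃ (R : D ⥤ T) (adj : L ⊣ R), IsIso adj.counit ∧ ∀ X, R.essImage X ↔ V X := by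
  have := h.isTriangulated_left
  rw [← h.right]
  refine exists_rightAdjoint_of_localization U L fun Z => ?_
  obtain ⟨X, Y, f, g, δ, hX, hY, hT⟩ := h.exists_triangle Z
  exact ⟨Y, g, by rwa [h.right], ObjectProperty.trW.mk' U hT hX⟩

/-- The quotient by `V` has a fully faithful left adjoint with essential image `U`. -/
lemma exists_leftAdjoint [L.IsLocalization V.trW] :
    ∃ (R : D ⥤ T) (adj : R ⊣ L), IsIso adj.unit ∧ ∀ X, R.essImage X ↔ U X := by
  have := h.isTriangulated_right
  rw [← h.left]
  refine exists_leftAdjoint_of_localization V L fun Z => ?_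
  obtain ⟨X, Y, f, g, δ, hX, hY, hT⟩ := h.exists_triangle Z
  exact ⟨X, f, by rwa [h.left], ObjectProperty.trW.mk V hT hY⟩

end IsSemiorthogonal

end Triangulated

section Exact

variable {A : Type u} [Category.{v} A] [Abelian A]
  {T : Type*} [Category* T] [Preadditive T] [HasZeroObject T] [HasShift T ℤ]
  [∀ n : ℤ, (shiftFunctor T n).Additive] [Pretriangulated T] {Φ : A ⥤ T}

namespace ConnectingMorphisms

variable (E : ConnectingMorphisms Φ) (K : ObjectProperty T) [K.IsTriangulated]
  [K.IsClosedUnderIsomorphisms] {S : ShortComplex A} (hS : S.ShortExact)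

include E hS

omit [K.IsTriangulated] in
lemma trW_map_f_iff : K.trW (Φ.map S.f) ↔ K (Φ.obj S.X₃) :=
  K.trW_iff_of_distinguished _ (E.distinguished S hS)

lemma trW_map_g_iff : K.trW (Φ.map S.g) ↔ K (Φ.obj S.X₁) :=
  K.trW_iff_of_distinguished' _ (E.distinguished S hS)

omit hS

/-- The inverse image of a thick subcategory under an exact functor is thick. -/
lemma isThick_inverseImage [K.IsStableUnderRetracts] : IsThick (K.inverseImage Φ) where
  summands := ⟨fun r hY => K.prop_of_retract (r.map Φ) hY⟩
  extensions S hS := K.ext_of_isTriangulatedClosed₂ _ (E.distinguished S hS)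
  kernels S hS := K.ext_of_isTriangulatedClosed₁ _ (E.distinguished S hS)
  cokernels S hS := K.ext_of_isTriangulatedClosed₃ _ (E.distinguished S hS)

omit [K.IsTriangulated] in
lemma trW_map_iff_of_isZero {Z X : A} (hZ : IsZero Z) (f : Z ⟶ X) :
    K.trW (Φ.map f) ↔ K (Φ.obj X) := by
  have hS : (ShortComplex.mk f (𝟙 X) (hZ.eq_of_src _ _)).ShortExact :=
    ShortComplex.Splitting.shortExact
      { r := 0, s := 𝟙 X, f_r := hZ.eq_of_src _ _, s_g := by simp, id := by simp }
  exact E.trW_map_f_iff K hS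

/-- The weak equivalences of an abelian model structure are determined by the weakly trivial
objects. -/
lemma weq_iff_trW [IsTriangulated T] {M : ModelCategory A} (hM : IsAbelianModel M)
    (hK : ∀ X, weaklyTrivial M X ↔ K (Φ.obj X)) {X Y : A} (f : X ⟶ Y) :
    weq M f ↔ K.trW (Φ.map f) := by
  obtain ⟨Z, i, p, rfl, hi, hi', hp⟩ := exists_trivialCof_fib M f
  have := hM.mono_of_cof hi
  have := hM.epi_of_fib hp
  have hi'' : K.trW (Φ.map i) := (E.trW_map_f_iff K (shortExact_cokernel i)).2
    ((hK _).1 (IsAbelianModel.weaklyTrivial_of_trivialCof (shortExact_cokernel i) hi hi'))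
  rw [Functor.map_comp, K.trW.precomp_iff _ _ hi'', E.trW_map_g_iff K (shortExact_kernel p), ← hK,
    (weq M).precomp_iff _ _ hi']
  exact ⟨IsAbelianModel.weaklyTrivial_of_trivialFib (shortExact_kernel p) hp,
    hM.weq_g (shortExact_kernel p)⟩

end ConnectingMorphisms

end Exact

section ModelCategory

variable {A : Type u} [Category.{v} A]

/-- A model structure is determined by its three classes of morphisms. -/
lemma exists_modelCategory [HasFiniteLimits A] [HasFiniteColimits A] (C F W : MorphismProperty A)
    [W.HasTwoOutOfThreeProperty] (h₁ : (C ⊓ W).IsWeakFactorizationSystem F)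
    (h₂ : C.IsWeakFactorizationSystem (F ⊓ W)) :
    ∃ M : ModelCategory A, cof M = C ∧ fib M = F ∧ weq M = W := by
  let : CategoryWithCofibrations A := ⟨C⟩
  let : CategoryWithFibrations A := ⟨F⟩
  let : CategoryWithWeakEquivalences A := ⟨W⟩
  have : (weakEquivalences A).HasTwoOutOfThreeProperty :=
    inferInstanceAs W.HasTwoOutOfThreeProperty
  have : (cofibrations A).IsWeakFactorizationSystem (trivialFibrations A) := h₂
  have : (trivialCofibrations A).IsWeakFactorizationSystem (fibrations A) := h₁
  exact ⟨ModelCategory.mk' A, rfl, rfl, rfl⟩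

end ModelCategory

section Localization

variable {A : Type u} [Category.{v} A] [Abelian A] {M₁ M : ModelCategory A}
  [Preadditive (Ho M₁)] [HasZeroObject (Ho M₁)] [HasShift (Ho M₁) ℤ]
  [∀ n : ℤ, (shiftFunctor (Ho M₁) n).Additive] [Pretriangulated (Ho M₁)]

/-- A homotopy category is a Verdier quotient of another one if the weak equivalences are those
morphisms whose cone belongs to the given triangulated subcategory. -/
lemma exists_isLocalization (hM₁ : IsAbelianModel M₁) (K : ObjectProperty (Ho M₁))
    [K.IsTriangulated] (h : ∀ {X Y : A} (f : X ⟶ Y), weq M f ↔ K.trW ((toHo M₁).map f)) :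
    ∃ (L : Ho M₁ ⥤ Ho M) (_ : toHo M₁ ⋙ L ≅ toHo M), L.IsLocalization K.trW := by
  have hle : weq M₁ ≤ weq M := fun X Y f hf => by
    have := isIso_toHo_map hf
    exact (h f).2 (K.trW_of_isIso _)
  have hinv : (weq M₁).IsInvertedBy (toHo M) := fun X Y f hf => isIso_toHo_map (hle f hf)
  let L := Localization.lift (toHo M) hinv (toHo M₁)
  let e : toHo M₁ ⋙ L ≅ toHo M := Localization.fac (toHo M) hinv (toHo M₁)
  have : (toHo M₁ ⋙ L).IsLocalization (weq M) := .of_iso (weq M) e.symm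
  refine ⟨L, e, .of_comp (toHo M₁) L (weq M₁) K.trW (weq M) hle (le_antisymm ?_ ?_)⟩
  · intro X Y f hf
    obtain ⟨S, hS, ⟨ε⟩⟩ := hM₁.exists_arrow_iso_map_f f
    refine ⟨_, _, S.f, (h _).2 ((K.trW.arrow_mk_iso_iff ε).1 hf), ⟨ε.symm⟩⟩
  · rintro X Y f ⟨X', Y', g, hg, ⟨ε⟩⟩
    exact (K.trW.arrow_mk_iso_iff ε).1 ((h g).1 hg)

end Localization

/-! ### Derived functors of the identity -/

section DerivedFunctors

variable {A : Type*} [Category* A] {D D' : Type*} [Category* D] [Category* D']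
  {p : A ⥤ D} {q : A ⥤ D'} {L : D ⥤ D'} {R : D' ⥤ D} (W : MorphismProperty A) [p.IsLocalization W]

include W in
/-- If `L` is induced by `q` on the localization `p`, then the right adjoint of `L` is the left Kan
extension of `p` along `q`. -/
theorem isLeftKanExtension_of_adjunction (e : p ⋙ L ≅ q) (adj : L ⊣ R) (α : p ⟶ q ⋙ R)
    (hα : ∀ X, α.app X = adj.unit.app (p.obj X) ≫ R.map (e.hom.app X)) :
    R.IsLeftKanExtension α := by
  have hex (G : D' ⥤ D) (β : p ⟶ q ⋙ G) :
      ∃ γ : R ⟶ G, α ≫ Functor.whiskerLeft q γ = β := by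
    -- `β` extends to a natural transformation `τ` on the localization, and `γ` is its mate
    obtain ⟨τ, hτ⟩ : ∃ τ : 𝟭 D ⟶ L ⋙ G, ∀ X, τ.app (p.obj X) = β.app X ≫ G.map (e.inv.app X) :=
      ⟨Localization.liftNatTrans p W p (p ⋙ L ⋙ G) (𝟭 D) (L ⋙ G)
        (β ≫ Functor.whiskerRight e.inv G), fun X => by
          refine (Localization.liftNatTrans_app ..).trans ?_
          exact (Category.id_comp _).trans (Category.comp_id _)⟩
    refine ⟨{ app := fun Z => τ.app (R.obj Z) ≫ G.map (adj.counit.app Z)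
              naturality := fun Z Z' f => ?_ }, ?_⟩
    · have h₁ : R.map f ≫ τ.app (R.obj Z') = τ.app (R.obj Z) ≫ G.map (L.map (R.map f)) :=
        τ.naturality (R.map f)
      have h₂ : L.map (R.map f) ≫ adj.counit.app Z' = adj.counit.app Z ≫ f :=
        adj.counit.naturality f
      rw [reassoc_of% h₁, ← G.map_comp, h₂, G.map_comp, Category.assoc]
    · ext X
      have h : (adj.unit.app (p.obj X) ≫ R.map (e.hom.app X)) ≫ τ.app (R.obj (q.obj X)) =
          τ.app (p.obj X) ≫ G.map (L.map (adj.unit.app (p.obj X) ≫ R.map (e.hom.app X))) :=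
        τ.naturality _
      have h' : L.map (adj.unit.app (p.obj X) ≫ R.map (e.hom.app X)) ≫
          adj.counit.app (q.obj X) = e.hom.app X := by simp
      change α.app X ≫ τ.app (R.obj (q.obj X)) ≫ G.map (adj.counit.app (q.obj X)) = β.app X
      rw [hα, ← Category.assoc, h, Category.assoc, ← G.map_comp, h', hτ, Category.assoc,
        ← G.map_comp, e.inv_hom_id_app]
      exact (congrArg _ (CategoryTheory.Functor.map_id G _)).trans (Category.comp_id _)
  have huniq {G : D' ⥤ D} (γ γ' : R ⟶ G)
      (h : α ≫ Functor.whiskerLeft q γ = α ≫ Functor.whiskerLeft q γ') : γ = γ' := by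
    -- the mates of `γ` and `γ'` agree on the image of the localization functor, hence everywhere
    have h₁ : adj.unit ≫ Functor.whiskerLeft L γ = adj.unit ≫ Functor.whiskerLeft L γ' := by
      refine Localization.natTrans_ext p W fun X => ?_
      rw [← cancel_mono (G.map (e.hom.app X))]
      have h₂ : α.app X ≫ γ.app (q.obj X) = α.app X ≫ γ'.app (q.obj X) := NatTrans.congr_app h X
      rw [hα, Category.assoc, Category.assoc, γ.naturality, γ'.naturality] at h₂
      simpa using h₂
    ext Z
    have h₂ : adj.unit.app (R.obj Z) ≫ γ.app (L.obj (R.obj Z)) =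
      adj.unit.app (R.obj Z) ≫ γ'.app (L.obj (R.obj Z)) := NatTrans.congr_app h₁ (R.obj Z)
    have h₃ (γ : R ⟶ G) : (adj.unit.app (R.obj Z) ≫ γ.app (L.obj (R.obj Z))) ≫
        G.map (adj.counit.app Z) = γ.app Z := by
      have h : R.map (adj.counit.app Z) ≫ γ.app Z =
        γ.app (L.obj (R.obj Z)) ≫ G.map (adj.counit.app Z) := γ.naturality (adj.counit.app Z)
      rw [Category.assoc, ← h]
      exact adj.right_triangle_components_assoc Z (γ.app Z)
    rw [← h₃ γ, h₂, h₃ γ']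
  choose γ hγ using hex
  exact ⟨⟨IsInitial.ofUniqueHom
    (fun G => StructuredArrow.homMk (γ G.right G.hom) (hγ G.right G.hom))
    fun G m => StructuredArrow.ext _ _
      (huniq _ _ ((StructuredArrow.w m).trans (hγ G.right G.hom).symm))⟩⟩

include W in
/-- If `L` is induced by `q` on the localization `p`, then the left adjoint of `L` is the right Kan
extension of `p` along `q`. -/
theorem isRightKanExtension_of_adjunction (e : p ⋙ L ≅ q) (adj : R ⊣ L) (α : q ⋙ R ⟶ p)
    (hα : ∀ X, α.app X = R.map (e.inv.app X) ≫ adj.counit.app (p.obj X)) :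
    R.IsRightKanExtension α := by
  have hex (G : D' ⥤ D) (β : q ⋙ G ⟶ p) :
      ∃ γ : G ⟶ R, Functor.whiskerLeft q γ ≫ α = β := by
    -- `β` extends to a natural transformation `τ` on the localization, and `γ` is its mate
    obtain ⟨τ, hτ⟩ : ∃ τ : L ⋙ G ⟶ 𝟭 D, ∀ X, τ.app (p.obj X) = G.map (e.hom.app X) ≫ β.app X :=
      ⟨Localization.liftNatTrans p W (p ⋙ L ⋙ G) p (L ⋙ G) (𝟭 D)
        (Functor.whiskerRight e.hom G ≫ β), fun X => by
          refine (Localization.liftNatTrans_app ..).trans ?_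
          exact (Category.id_comp _).trans (Category.comp_id _)⟩
    refine ⟨{ app := fun Z => G.map (adj.unit.app Z) ≫ τ.app (R.obj Z)
              naturality := fun Z Z' f => ?_ }, ?_⟩
    · have h₁ : G.map (L.map (R.map f)) ≫ τ.app (R.obj Z') = τ.app (R.obj Z) ≫ R.map f :=
        τ.naturality (R.map f)
      have h₂ : f ≫ adj.unit.app Z' = adj.unit.app Z ≫ L.map (R.map f) :=
        adj.unit.naturality f
      rw [Category.assoc, ← h₁, ← G.map_comp_assoc, ← G.map_comp_assoc, h₂]
    · ext X
      have h : G.map (L.map (R.map (e.inv.app X) ≫ adj.counit.app (p.obj X))) ≫ τ.app (p.obj X) =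
          τ.app (R.obj (q.obj X)) ≫ R.map (e.inv.app X) ≫ adj.counit.app (p.obj X) :=
        τ.naturality _
      have h' : adj.unit.app (q.obj X) ≫ L.map (R.map (e.inv.app X) ≫ adj.counit.app (p.obj X)) =
          e.inv.app X := by simp
      change (G.map (adj.unit.app (q.obj X)) ≫ τ.app (R.obj (q.obj X))) ≫ α.app X = β.app X
      rw [hα, Category.assoc, ← h, ← G.map_comp_assoc, h', hτ, ← G.map_comp_assoc,
        e.inv_hom_id_app]
      exact (congrArg (· ≫ _) (CategoryTheory.Functor.map_id G _)).trans (Category.id_comp _)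
  have huniq {G : D' ⥤ D} (γ γ' : G ⟶ R)
      (h : Functor.whiskerLeft q γ ≫ α = Functor.whiskerLeft q γ' ≫ α) : γ = γ' := by
    -- the mates of `γ` and `γ'` agree on the image of the localization functor, hence everywhere
    have h₁ : Functor.whiskerLeft L γ ≫ adj.counit = Functor.whiskerLeft L γ' ≫ adj.counit := by
      refine Localization.natTrans_ext p W fun X => ?_
      rw [← cancel_epi (G.map (e.inv.app X))]
      have h₂ : γ.app (q.obj X) ≫ α.app X = γ'.app (q.obj X) ≫ α.app X := NatTrans.congr_app h X
      rw [hα, ← NatTrans.naturality_assoc, ← NatTrans.naturality_assoc] at h₂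
      simpa using h₂
    ext Z
    have h₂ : γ.app (L.obj (R.obj Z)) ≫ adj.counit.app (R.obj Z) =
      γ'.app (L.obj (R.obj Z)) ≫ adj.counit.app (R.obj Z) := NatTrans.congr_app h₁ (R.obj Z)
    have h₃ (γ : G ⟶ R) : G.map (adj.unit.app Z) ≫ γ.app (L.obj (R.obj Z)) ≫
        adj.counit.app (R.obj Z) = γ.app Z := by
      have h : G.map (adj.unit.app Z) ≫ γ.app (L.obj (R.obj Z)) =
        γ.app Z ≫ R.map (adj.unit.app Z) := γ.naturality (adj.unit.app Z)
      rw [reassoc_of% h]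
      exact (congrArg _ (adj.left_triangle_components Z)).trans (Category.comp_id _)
    rw [← h₃ γ, h₂, h₃ γ']
  choose γ hγ using hex
  exact ⟨⟨IsTerminal.ofUniqueHom
    (fun G => CostructuredArrow.homMk (γ G.left G.hom) (hγ G.left G.hom))
    fun G m => CostructuredArrow.ext _ _
      (huniq _ _ ((CostructuredArrow.w m).trans (hγ G.left G.hom).symm))⟩⟩

end DerivedFunctors

section HoSequences

variable {A : Type u} [Category.{v} A] [Abelian A] {M₁ M₂ M : ModelCategory A}

omit [Abelian A] in
lemma isRightDerivedId_of_adjunction {L : Ho M₁ ⥤ Ho M} {R : Ho M ⥤ Ho M₁}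
    (e : toHo M₁ ⋙ L ≅ toHo M) (adj : L ⊣ R) : IsRightDerivedId M M₁ R := by
  let α : toHo M₁ ⟶ toHo M ⋙ R :=
    Functor.whiskerLeft (toHo M₁) adj.unit ≫ Functor.whiskerRight e.hom R
  have : R.IsLeftKanExtension α :=
    isLeftKanExtension_of_adjunction (weq M₁) e adj α fun X => rfl
  exact ⟨α, ⟨this⟩⟩

omit [Abelian A] in
lemma isLeftDerivedId_of_adjunction {L : Ho M₁ ⥤ Ho M} {R : Ho M ⥤ Ho M₁}
    (e : toHo M₁ ⋙ L ≅ toHo M) (adj : R ⊣ L) : IsLeftDerivedId M M₁ R := by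
  let α : toHo M ⋙ R ⟶ toHo M₁ :=
    Functor.whiskerRight e.inv R ≫ Functor.whiskerLeft (toHo M₁) adj.counit
  have : R.IsRightKanExtension α :=
    isRightKanExtension_of_adjunction (weq M₁) e adj α fun X => rfl
  exact ⟨α, ⟨this⟩⟩

/-- The connecting morphisms of a triangulation of the homotopy category. -/
def HoTriangulation.connectingMorphisms (t₁ : HoTriangulation M₁) :
    letI := t₁.preadditive
    letI := t₁.hasZeroObject
    letI := t₁.hasShift
    letI := t₁.shift_additive
    letI := t₁.pretriangulated
    ConnectingMorphisms (toHo M₁) :=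
  letI := t₁.preadditive
  letI := t₁.hasZeroObject
  letI := t₁.hasShift
  letI := t₁.shift_additive
  letI := t₁.pretriangulated
  { δ := t₁.δ
    naturality := t₁.δ_naturality
    distinguished := fun S hS => (t₁.distinguished_iff _).2 ⟨S, hS, ⟨Iso.refl _⟩⟩ }

/-- If the weak equivalences of `M₂` and of `M` are the morphisms with cone in the left part `U`,
respectively the right part `V`, of a semiorthogonal decomposition of `Ho M₁`, then the homotopy
categories form a colocalization sequence: `Ho M₂` is the quotient by `U`, embedded as `V` by the
right adjoint of the quotient functor, and `Ho M` is the quotient by `V`. -/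
theorem exists_isHoColocalizationSequence (hM₁ : IsAbelianModel M₁) (hM₂ : IsAbelianModel M₂)
    (hM : IsAbelianModel M) (t₁ : HoTriangulation M₁) :
    letI := t₁.preadditive
    letI := t₁.hasZeroObject
    letI := t₁.hasShift
    letI := t₁.shift_additive
    letI := t₁.pretriangulated
    ∀ {U V : ObjectProperty (Ho M₁)} (_ : IsSemiorthogonal U V)
      (_ : ∀ {X Y : A} (f : X ⟶ Y), weq M₂ f ↔ U.trW ((toHo M₁).map f))
      (_ : ∀ {X Y : A} (f : X ⟶ Y), weq M f ↔ V.trW ((toHo M₁).map f)),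
      ∃ (t₂ : HoTriangulation M₂) (t : HoTriangulation M) (F : Ho M₂ ⥤ Ho M₁) (G : Ho M₁ ⥤ Ho M),
        IsRightDerivedId M₂ M₁ F ∧ IsRightDerivedId M₁ M G ∧
        IsHoColocalizationSequence t₂ t₁ t F G := by
  let := t₁.preadditive
  have := t₁.hasZeroObject
  let := t₁.hasShift
  have := t₁.shift_additive
  let := t₁.pretriangulated
  have := t₁.isTriangulated
  have := t₁.toHo_additive
  intro U V h hU hV
  have := h.isTriangulated_left
  have := h.isTriangulated_right
  have := h.isStableUnderRetracts_right
  let E := t₁.connectingMorphisms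
  obtain ⟨L, e, _⟩ := exists_isLocalization hM₁ U hU
  obtain ⟨G, e', _⟩ := exists_isLocalization hM₁ V hV
  obtain ⟨t₂, hL⟩ := exists_hoTriangulation hM₂ E U L e
  obtain ⟨t, hG⟩ := exists_hoTriangulation hM E V G e'
  obtain ⟨F, adj, _, hF⟩ := h.exists_rightAdjoint L
  obtain ⟨Gl, adj', _, -⟩ := h.exists_leftAdjoint G
  refine ⟨t₂, t, F, G, isRightDerivedId_of_adjunction e adj,
    ⟨e'.inv, Functor.isRightDerivedFunctor_of_inverts (weq M₁) G e'⟩, ?_⟩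
  let := t₂.preadditive
  have := t₂.hasZeroObject
  let := t₂.hasShift
  have := t₂.shift_additive
  let := t₂.pretriangulated
  let := t.preadditive
  have := t.hasZeroObject
  let := t.hasShift
  have := t.shift_additive
  let := t.pretriangulated
  obtain ⟨_, _⟩ := hL
  refine { exact_left := ?_, exact_right := hG, adjoint_left := ⟨L, adj, inferInstance⟩,
           adjoint_right := ⟨Gl, adj', inferInstance⟩, kernel_eq := fun X => ?_ }
  · let := adj.rightAdjointCommShift ℤ
    have := adj.commShift_of_leftAdjoint ℤ
    exact ⟨_, adj.isTriangulated_rightAdjoint⟩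
  · obtain ⟨_, _⟩ := hG
    rw [hF, isZero_obj_iff_of_isLocalization V]

/-- If the weak equivalences of `M₂` and of `M` are the morphisms with cone in the right part `V`,
respectively the left part `U`, of a semiorthogonal decomposition of `Ho M₁`, then the homotopy
categories form a localization sequence: `Ho M₂` is the quotient by `V`, embedded as `U` by the
left adjoint of the quotient functor, and `Ho M` is the quotient by `U`. -/
theorem exists_isHoLocalizationSequence (hM₁ : IsAbelianModel M₁) (hM₂ : IsAbelianModel M₂)
    (hM : IsAbelianModel M) (t₁ : HoTriangulation M₁) :
    letI := t₁.preadditive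
    letI := t₁.hasZeroObject
    letI := t₁.hasShift
    letI := t₁.shift_additive
    letI := t₁.pretriangulated
    ∀ {U V : ObjectProperty (Ho M₁)} (_ : IsSemiorthogonal U V)
      (_ : ∀ {X Y : A} (f : X ⟶ Y), weq M₂ f ↔ V.trW ((toHo M₁).map f))
      (_ : ∀ {X Y : A} (f : X ⟶ Y), weq M f ↔ U.trW ((toHo M₁).map f)),
      ∃ (t₂ : HoTriangulation M₂) (t : HoTriangulation M) (F : Ho M₂ ⥤ Ho M₁) (G : Ho M₁ ⥤ Ho M),
        IsLeftDerivedId M₂ M₁ F ∧ IsLeftDerivedId M₁ M G ∧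
        IsHoLocalizationSequence t₂ t₁ t F G := by
  let := t₁.preadditive
  have := t₁.hasZeroObject
  let := t₁.hasShift
  have := t₁.shift_additive
  let := t₁.pretriangulated
  have := t₁.isTriangulated
  have := t₁.toHo_additive
  intro U V h hV hU
  have := h.isTriangulated_left
  have := h.isTriangulated_right
  have := h.isStableUnderRetracts_left
  let E := t₁.connectingMorphisms
  obtain ⟨L, e, _⟩ := exists_isLocalization hM₁ V hV
  obtain ⟨G, e', _⟩ := exists_isLocalization hM₁ U hU
  obtain ⟨t₂, hL⟩ := exists_hoTriangulation hM₂ E V L e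
  obtain ⟨t, hG⟩ := exists_hoTriangulation hM E U G e'
  obtain ⟨F, adj, _, hF⟩ := h.exists_leftAdjoint L
  obtain ⟨Gr, adj', _, -⟩ := h.exists_rightAdjoint G
  refine ⟨t₂, t, F, G, isLeftDerivedId_of_adjunction e adj,
    ⟨e'.hom, Functor.isLeftDerivedFunctor_of_inverts (weq M₁) G e'⟩, ?_⟩
  let := t₂.preadditive
  have := t₂.hasZeroObject
  let := t₂.hasShift
  have := t₂.shift_additive
  let := t₂.pretriangulated
  let := t.preadditive
  have := t.hasZeroObject
  let := t.hasShift
  have := t.shift_additive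
  let := t.pretriangulated
  obtain ⟨_, _⟩ := hL
  refine { exact_left := ?_, exact_right := hG, adjoint_left := ⟨L, adj, inferInstance⟩,
           adjoint_right := ⟨Gr, adj', inferInstance⟩, kernel_eq := fun X => ?_ }
  · let := adj.leftAdjointCommShift ℤ
    have := adj.commShift_of_rightAdjoint ℤ
    exact ⟨_, adj.isTriangulated_leftAdjoint⟩
  · obtain ⟨_, _⟩ := hG
    rw [hF, isZero_obj_iff_of_isLocalization U]

end HoSequences

/-! ### The semiorthogonal decomposition of two models -/

section

variable {A : Type u} [Category.{v} A] {M₁ M₂ : ModelCategory A}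

/-- The trivial cofibrations are the morphisms with the left lifting property with respect to the
fibrations. -/
lemma trivialCof_le (h : fib M₂ ≤ fib M₁) : cof M₁ ⊓ weq M₁ ≤ cof M₂ ⊓ weq M₂ := by
  have := wfs_trivialCof_fib M₁
  have := wfs_trivialCof_fib M₂
  rw [← MorphismProperty.llp_eq_of_wfs (cof M₁ ⊓ weq M₁) (fib M₁),
    ← MorphismProperty.llp_eq_of_wfs (cof M₂ ⊓ weq M₂) (fib M₂)]
  exact MorphismProperty.antitone_llp h

/-- The trivial fibrations are the morphisms with the right lifting property with respect to the
cofibrations. -/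
lemma trivialFib_le (h : cof M₂ ≤ cof M₁) : fib M₁ ⊓ weq M₁ ≤ fib M₂ ⊓ weq M₂ := by
  have := wfs_cof_trivialFib M₁
  have := wfs_cof_trivialFib M₂
  rw [← MorphismProperty.rlp_eq_of_wfs (cof M₁) (fib M₁ ⊓ weq M₁),
    ← MorphismProperty.rlp_eq_of_wfs (cof M₂) (fib M₂ ⊓ weq M₂)]
  exact MorphismProperty.antitone_rlp h

variable [Abelian A]

/-- The objects which vanish in a triangulated homotopy category form a thick class. -/
lemma isThick_weaklyTrivial {M : ModelCategory A} (t : HoTriangulation M)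
    (ht : ∀ X : A, IsZero ((toHo M).obj X) ↔ weaklyTrivial M X) : IsThick (weaklyTrivial M) := by
  let := t.preadditive
  have := t.hasZeroObject
  let := t.hasShift
  have := t.shift_additive
  let := t.pretriangulated
  let E := t.connectingMorphisms
  -- the zero objects, which are those that receive only zero morphisms
  let K := (⊤ : ObjectProperty (Ho M)).rightOrthogonal
  have hK : weaklyTrivial M = K.inverseImage (toHo M) := by
    ext X
    rw [← ht]
    exact ⟨fun hX Y f _ => hX.eq_of_tgt _ _, fun hX => (IsZero.iff_id_eq_zero _).2 (hX _ trivial)⟩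
  rw [hK]
  exact E.isThick_inverseImage K

lemma IsInjectiveModel.weaklyTrivial_iff {M : ModelCategory A} (h : IsInjectiveModel M) (X : A) :
    weaklyTrivial M X ↔ (cof M ⊓ weq M) (initial.to X) :=
  ⟨fun hX => ⟨h.cofibrant_all X, hX⟩, fun hX => hX.2⟩

lemma IsProjectiveModel.weaklyTrivial_iff {M : ModelCategory A} (h : IsProjectiveModel M) (X : A) :
    weaklyTrivial M X ↔ (fib M ⊓ weq M) (terminal.from X) := by
  rw [weaklyTrivial_iff_of_isZero' ((isZero_zero A).of_iso
    (terminalIsTerminal.uniqueUpToIso (isZero_zero A).isTerminal)) (terminal.from X)]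
  exact ⟨fun hX => ⟨h.fibrant_all X, hX⟩, fun hX => hX.2⟩

end

section Semiorthogonal

variable {A : Type u} [Category.{v} A] [Abelian A] {M₁ M₂ : ModelCategory A}
  [Preadditive (Ho M₁)] [HasZeroObject (Ho M₁)] [HasShift (Ho M₁) ℤ]
  [∀ n : ℤ, (shiftFunctor (Ho M₁) n).Additive] [Pretriangulated (Ho M₁)]
  (E : ConnectingMorphisms (toHo M₁))
  (hz : ∀ X : A, IsZero ((toHo M₁).obj X) ↔ weaklyTrivial M₁ X)
  (hthick : IsThick (weaklyTrivial M₂))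

include E hz hthick

/-- The weakly trivial objects and the fibrant objects of `M₂` are orthogonal in `Ho M₁`, and the
fibrant replacements of `M₂` generate `Ho M₁` by extensions of these. Both classes can be recovered
from the resulting semiorthogonal decomposition. -/
theorem IsInjectiveModel.exists_isSemiorthogonal (h₁ : IsInjectiveModel M₁)
    (h₂ : IsInjectiveModel M₂) (hF : fibrant M₂ ≤ fibrant M₁)
    (hW : weaklyTrivial M₁ ≤ weaklyTrivial M₂) :
    ∃ U V : ObjectProperty (Ho M₁), IsSemiorthogonal U V ∧
      (∀ X, weaklyTrivial M₂ X ↔ U ((toHo M₁).obj X)) ∧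
      ∀ X, fibrant M₂ X ↔ fibrant M₁ X ∧ V ((toHo M₁).obj X) := by
  have hstable : ((weaklyTrivial M₂).map (toHo M₁)).IsStableUnderShift ℤ := by
    refine E.isStableUnderShift_map _ (fun X hX => ?_) (fun X hX => ?_)
    · obtain ⟨J, i, hi, -, hJ⟩ := exists_cof_weaklyTrivial M₁ X
      have := h₁.mono_of_cof hi
      exact ⟨J, i, this, (hz J).2 hJ, hthick.cokernels _ (shortExact_cokernel i) hX (hW _ hJ)⟩
    · obtain ⟨J, p, hp, -, hJ⟩ := exists_fib_weaklyTrivial M₁ X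
      have := h₁.epi_of_fib hp
      exact ⟨J, p, this, (hz J).2 hJ, hthick.kernels _ (shortExact_kernel p) (hW _ hJ) hX⟩
  have horth {X Y : A} (hX : weaklyTrivial M₂ X) (hY : fibrant M₂ Y)
      (f : (toHo M₁).obj X ⟶ (toHo M₁).obj Y) : f = 0 := by
    -- the morphism extends along the embedding of `X` in an object which is weakly trivial in `M₁`
    obtain ⟨g, rfl⟩ := toHo_map_surjective (h₁.cofibrant_all X) (hF _ hY) f
    obtain ⟨J, i, hi, -, hJ⟩ := exists_cof_weaklyTrivial M₁ X
    have := h₁.mono_of_cof hi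
    obtain ⟨l, rfl⟩ := h₂.exists_extension (shortExact_cokernel i)
      (hthick.cokernels _ (shortExact_cokernel i) hX (hW _ hJ)) hY g
    rw [Functor.map_comp, ((hz J).2 hJ).eq_of_tgt ((toHo M₁).map i) 0, zero_comp]
  obtain ⟨U, V, h, hU, hV⟩ := AbModel.exists_isSemiorthogonal ((weaklyTrivial M₂).map (toHo M₁))
    ((fibrant M₂).map (toHo M₁)) (fun {Z Z'} f hZ hZ' => by
      obtain ⟨X, hX, ⟨e⟩⟩ := (ObjectProperty.prop_map_iff _ _ _).1 hZ
      obtain ⟨Y, hY, ⟨e'⟩⟩ := (ObjectProperty.prop_map_iff _ _ _).1 hZ'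
      rw [← cancel_epi e.hom, ← cancel_mono e'.inv, horth hX hY ((e.hom ≫ f) ≫ e'.inv), comp_zero,
        zero_comp]) (.inl hstable) (fun Z => by
      have := Localization.essSurj (toHo M₁) (weq M₁)
      obtain ⟨R, i, hR, hi, hi'⟩ := exists_fibrant_replacement M₂ ((toHo M₁).objPreimage Z)
      have := h₂.mono_of_cof hi
      have hS := shortExact_cokernel i
      refine ⟨_, inv_rot_of_distTriang _ (E.distinguished _ hS), ?_,
        ObjectProperty.prop_map_obj _ _ hR, ⟨(toHo M₁).objObjPreimageIso Z⟩⟩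
      exact ObjectProperty.le_shift _ (-1 : ℤ) _ (ObjectProperty.prop_map_obj _ _
        (IsAbelianModel.weaklyTrivial_of_trivialCof hS hi hi')))
  have := h.isTriangulated_left
  have := h.isTriangulated_right
  have := h.isClosedUnderIsomorphisms_left
  have := h.isClosedUnderIsomorphisms_right
  have hU' {X : A} (hX : weaklyTrivial M₂ X) : U ((toHo M₁).obj X) :=
    hU _ (ObjectProperty.prop_map_obj _ _ hX)
  have hV' {X : A} (hX : fibrant M₂ X) : V ((toHo M₁).obj X) :=
    hV _ (ObjectProperty.prop_map_obj _ _ hX)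
  refine ⟨U, V, h, fun X => ⟨hU', fun hX => ?_⟩,
    fun X => ⟨fun hX => ⟨hF _ hX, hV' hX⟩, fun hX => ?_⟩⟩
  · -- the replacement `R` lies in both parts of the decomposition, so that it vanishes
    obtain ⟨R, i, hR, hi, hi'⟩ := exists_fibrant_replacement M₂ X
    have := h₂.mono_of_cof hi
    have hS := shortExact_cokernel i
    have hUR := U.ext_of_isTriangulatedClosed₂ _ (E.distinguished _ hS) hX
      (hU' (IsAbelianModel.weaklyTrivial_of_trivialCof hS hi hi'))
    exact (weaklyTrivial_of_weq hi').2 (hW _ ((hz R).1 (h.isZero hUR (hV' hR))))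
  · obtain ⟨R, i, hR, hi, hi'⟩ := exists_fibrant_replacement M₂ X
    have := h₂.mono_of_cof hi
    have hS := shortExact_cokernel i
    have hVC := V.ext_of_isTriangulatedClosed₃ _ (E.distinguished _ hS) hX.2 (hV' hR)
    have hUC := hU' (IsAbelianModel.weaklyTrivial_of_trivialCof hS hi hi')
    -- the cokernel of `X ⟶ R` is weakly trivial in `M₁`, so that `X` is a direct summand of `R`
    obtain ⟨r, hr⟩ := h₁.exists_extension hS ((hz _).1 (h.isZero hUC hVC)) hX.1 (𝟙 X)
    exact (fibrant M₂).prop_of_retract ⟨i, r, hr⟩ hR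

/-- The cofibrant objects and the weakly trivial objects of `M₂` are the two parts of a
semiorthogonal decomposition of `Ho M₁`. -/
theorem IsProjectiveModel.exists_isSemiorthogonal (h₁ : IsProjectiveModel M₁)
    (h₂ : IsProjectiveModel M₂) (hC : cofibrant M₂ ≤ cofibrant M₁)
    (hW : weaklyTrivial M₁ ≤ weaklyTrivial M₂) :
    ∃ U V : ObjectProperty (Ho M₁), IsSemiorthogonal U V ∧
      (∀ X, weaklyTrivial M₂ X ↔ V ((toHo M₁).obj X)) ∧
      ∀ X, cofibrant M₂ X ↔ cofibrant M₁ X ∧ U ((toHo M₁).obj X) := by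
  have hstable : ((weaklyTrivial M₂).map (toHo M₁)).IsStableUnderShift ℤ := by
    refine E.isStableUnderShift_map _ (fun X hX => ?_) (fun X hX => ?_)
    · obtain ⟨J, i, hi, -, hJ⟩ := exists_cof_weaklyTrivial M₁ X
      have := h₁.mono_of_cof hi
      exact ⟨J, i, this, (hz J).2 hJ, hthick.cokernels _ (shortExact_cokernel i) hX (hW _ hJ)⟩
    · obtain ⟨J, p, hp, -, hJ⟩ := exists_fib_weaklyTrivial M₁ X
      have := h₁.epi_of_fib hp
      exact ⟨J, p, this, (hz J).2 hJ, hthick.kernels _ (shortExact_kernel p) (hW _ hJ) hX⟩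
  have horth {X Y : A} (hX : cofibrant M₂ X) (hY : weaklyTrivial M₂ Y)
      (f : (toHo M₁).obj X ⟶ (toHo M₁).obj Y) : f = 0 := by
    -- the morphism lifts to an object over `Y` which is weakly trivial in `M₁`
    obtain ⟨g, rfl⟩ := toHo_map_surjective (hC _ hX) (h₁.fibrant_all Y) f
    obtain ⟨J, p, hp, -, hJ⟩ := exists_fib_weaklyTrivial M₁ Y
    have := h₁.epi_of_fib hp
    obtain ⟨l, rfl⟩ := h₂.exists_lift (shortExact_kernel p)
      (hthick.kernels _ (shortExact_kernel p) (hW _ hJ) hY) hX g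
    rw [Functor.map_comp, ((hz J).2 hJ).eq_of_tgt ((toHo M₁).map l) 0, zero_comp]
  obtain ⟨U, V, h, hU, hV⟩ := AbModel.exists_isSemiorthogonal ((cofibrant M₂).map (toHo M₁))
    ((weaklyTrivial M₂).map (toHo M₁)) (fun {Z Z'} f hZ hZ' => by
      obtain ⟨X, hX, ⟨e⟩⟩ := (ObjectProperty.prop_map_iff _ _ _).1 hZ
      obtain ⟨Y, hY, ⟨e'⟩⟩ := (ObjectProperty.prop_map_iff _ _ _).1 hZ'
      rw [← cancel_epi e.hom, ← cancel_mono e'.inv, horth hX hY ((e.hom ≫ f) ≫ e'.inv), comp_zero,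
        zero_comp]) (.inr hstable) (fun Z => by
      have := Localization.essSurj (toHo M₁) (weq M₁)
      obtain ⟨Q, p, hQ, hp, hp'⟩ := exists_cofibrant_replacement M₂ ((toHo M₁).objPreimage Z)
      have := h₂.epi_of_fib hp
      have hS := shortExact_kernel p
      refine ⟨_, rot_of_distTriang _ (E.distinguished _ hS), ObjectProperty.prop_map_obj _ _ hQ, ?_,
        ⟨(toHo M₁).objObjPreimageIso Z⟩⟩
      exact ObjectProperty.le_shift _ (1 : ℤ) _ (ObjectProperty.prop_map_obj _ _
        (IsAbelianModel.weaklyTrivial_of_trivialFib hS hp hp')))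
  have := h.isTriangulated_left
  have := h.isTriangulated_right
  have := h.isClosedUnderIsomorphisms_left
  have := h.isClosedUnderIsomorphisms_right
  have hV' {X : A} (hX : weaklyTrivial M₂ X) : V ((toHo M₁).obj X) :=
    hV _ (ObjectProperty.prop_map_obj _ _ hX)
  have hU' {X : A} (hX : cofibrant M₂ X) : U ((toHo M₁).obj X) :=
    hU _ (ObjectProperty.prop_map_obj _ _ hX)
  refine ⟨U, V, h, fun X => ⟨hV', fun hX => ?_⟩,
    fun X => ⟨fun hX => ⟨hC _ hX, hU' hX⟩, fun hX => ?_⟩⟩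
  · -- the replacement `Q` lies in both parts of the decomposition, so that it vanishes
    obtain ⟨Q, p, hQ, hp, hp'⟩ := exists_cofibrant_replacement M₂ X
    have := h₂.epi_of_fib hp
    have hS := shortExact_kernel p
    have hVQ := V.ext_of_isTriangulatedClosed₂ _ (E.distinguished _ hS)
      (hV' (IsAbelianModel.weaklyTrivial_of_trivialFib hS hp hp')) hX
    exact (weaklyTrivial_of_weq hp').1 (hW _ ((hz Q).1 (h.isZero (hU' hQ) hVQ)))
  · obtain ⟨Q, p, hQ, hp, hp'⟩ := exists_cofibrant_replacement M₂ X
    have := h₂.epi_of_fib hp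
    have hS := shortExact_kernel p
    have hUK := U.ext_of_isTriangulatedClosed₁ _ (E.distinguished _ hS) (hU' hQ) hX.2
    have hVK := hV' (IsAbelianModel.weaklyTrivial_of_trivialFib hS hp hp')
    -- the kernel of `Q ⟶ X` is weakly trivial in `M₁`, so that `X` is a direct summand of `Q`
    obtain ⟨s, hs⟩ := h₁.exists_lift hS ((hz _).1 (h.isZero hUK hVK)) hX.1 (𝟙 X)
    exact (cofibrant M₂).prop_of_retract ⟨s, p, hs⟩ hQ

end Semiorthogonal

/-! ### The quotient model structure -/

section Quotient

variable {A : Type u} [Category.{v} A] [Abelian A] {M₁ M₂ : ModelCategory A}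


lemma IsInjectiveModel.trivialCof_iff (h : IsInjectiveModel M₂) {X Y : A} (f : X ⟶ Y) :
    (cof M₂ ⊓ weq M₂) f ↔ Mono f ∧ weaklyTrivial M₂ (cokernel f) := by
  refine ⟨fun hf => ?_, fun hf => ?_⟩
  · have := h.mono_of_cof hf.1
    exact ⟨this, IsAbelianModel.weaklyTrivial_of_trivialCof (shortExact_cokernel f) hf.1 hf.2⟩
  · have := hf.1
    exact ⟨h.cof_of_mono f, h.weq_f (shortExact_cokernel f) hf.2⟩

lemma IsProjectiveModel.trivialFib_iff (h : IsProjectiveModel M₂) {X Y : A} (f : X ⟶ Y) :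
    (fib M₂ ⊓ weq M₂) f ↔ Epi f ∧ weaklyTrivial M₂ (kernel f) := by
  refine ⟨fun hf => ?_, fun hf => ?_⟩
  · have := h.epi_of_fib hf.1
    exact ⟨this, IsAbelianModel.weaklyTrivial_of_trivialFib (shortExact_kernel f) hf.1 hf.2⟩
  · have := hf.1
    exact ⟨h.fib_of_epi f, h.weq_g (shortExact_kernel f) hf.2⟩

lemma IsInjectiveModel.weaklyTrivial_le (h₁ : IsInjectiveModel M₁) (h₂ : IsInjectiveModel M₂)
    (hF : fibrant M₂ ≤ fibrant M₁) : weaklyTrivial M₁ ≤ weaklyTrivial M₂ := fun X hX =>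
  (h₂.weaklyTrivial_iff X).2 (trivialCof_le (fun _ _ f hf =>
    (h₁.fib_iff f).2 ⟨((h₂.fib_iff f).1 hf).1, hF _ ((h₂.fib_iff f).1 hf).2⟩) _
      ((h₁.weaklyTrivial_iff X).1 hX))

lemma IsProjectiveModel.weaklyTrivial_le (h₁ : IsProjectiveModel M₁) (h₂ : IsProjectiveModel M₂)
    (hC : cofibrant M₂ ≤ cofibrant M₁) : weaklyTrivial M₁ ≤ weaklyTrivial M₂ := fun X hX =>
  (h₂.weaklyTrivial_iff X).2 (trivialFib_le (fun _ _ f hf =>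
    (h₁.cof_iff f).2 ⟨((h₂.cof_iff f).1 hf).1, hC _ ((h₂.cof_iff f).1 hf).2⟩) _
      ((h₁.weaklyTrivial_iff X).1 hX))

variable
  [Preadditive (Ho M₁)] [HasZeroObject (Ho M₁)] [HasShift (Ho M₁) ℤ]
  [∀ n : ℤ, (shiftFunctor (Ho M₁) n).Additive] [Pretriangulated (Ho M₁)]
  (E : ConnectingMorphisms (toHo M₁))
  (hz : ∀ X : A, IsZero ((toHo M₁).obj X) ↔ weaklyTrivial M₁ X)
  {U V : ObjectProperty (Ho M₁)} (h : IsSemiorthogonal U V)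

namespace IsInjectiveModel

variable (h₁ : IsInjectiveModel M₁)
  (hV : ∀ X, fibrant M₂ X ↔ fibrant M₁ X ∧ V ((toHo M₁).obj X))

include E hz h h₁ hV

/-- The quotient of two injective models: its weak equivalences are the morphisms whose cone in
`Ho M₁` belongs to `V`. Its trivial cofibrations are those of `M₁` since `U` and `V` have only the
zero objects in common, and its trivial fibrations are the fibrations of `M₂`, so that its weak
factorization systems are known from `M₁` and `M₂`. -/
theorem exists_quotient [IsTriangulated (Ho M₁)] (h₂ : IsInjectiveModel M₂)
    (hU : ∀ X, weaklyTrivial M₂ X ↔ U ((toHo M₁).obj X)) :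
    ∃ M : ModelCategory A, IsAbelianModel M ∧ cofibrant M = weaklyTrivial M₂ ∧
      fibrant M = fibrant M₁ ∧ weaklyTrivial M = V.inverseImage (toHo M₁) := by
  have := h.isTriangulated_right
  have := h.isStableUnderRetracts_right
  have := h.isClosedUnderIsomorphisms_right
  have e₁ : (cof M₂ ⊓ weq M₂) ⊓ V.trW.inverseImage (toHo M₁) = cof M₁ ⊓ weq M₁ := by
    ext X Y f
    change (cof M₂ ⊓ weq M₂) f ∧ V.trW ((toHo M₁).map f) ↔ _
    rw [h₁.trivialCof_iff, h₂.trivialCof_iff, and_assoc]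
    refine and_congr_right fun hf => ?_
    rw [E.trW_map_f_iff V (shortExact_cokernel f), hU, ← hz, h.isZero_iff]
  have e₂ : fib M₁ ⊓ V.trW.inverseImage (toHo M₁) = fib M₂ := by
    ext X Y f
    change fib M₁ f ∧ V.trW ((toHo M₁).map f) ↔ _
    rw [h₁.fib_iff, h₂.fib_iff, and_assoc]
    refine and_congr_right fun hf => ?_
    rw [E.trW_map_g_iff V (shortExact_kernel f), hV]
  obtain ⟨M, hC, hF, hW⟩ := exists_modelCategory (cof M₂ ⊓ weq M₂) (fib M₁)
    (V.trW.inverseImage (toHo M₁)) (e₁ ▸ wfs_trivialCof_fib M₁) (e₂ ▸ wfs_trivialCof_fib M₂)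
  have hCM : cofibrant M = weaklyTrivial M₂ := by
    ext X
    rw [h₂.weaklyTrivial_iff, ← hC]
    rfl
  have hFM : fibrant M = fibrant M₁ := by
    ext X
    change fib M _ ↔ fib M₁ _
    rw [hF]
  refine ⟨M, ⟨fun f => ?_, fun f => ?_⟩, hCM, hFM, ?_⟩
  · rw [hC, hCM, h₂.trivialCof_iff]
  · rw [hF, hFM, h₁.fib_iff]
  · ext X
    change weq M _ ↔ _
    rw [hW]
    exact E.trW_map_iff_of_isZero V ((isZero_zero A).of_iso
      (initialIsInitial.uniqueUpToIso (isZero_zero A).isInitial)) _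

theorem inverseImage_eq_kernelClass :
    V.inverseImage (toHo M₁) = kernelClass (fibrant M₂) (weaklyTrivial M₁) := by
  have := h.isTriangulated_right
  have := h.isClosedUnderIsomorphisms_right
  ext X
  constructor
  · intro hX
    obtain ⟨R, i, hR, hi, hi'⟩ := exists_fibrant_replacement M₁ X
    have := h₁.mono_of_cof hi
    have := isIso_toHo_map hi'
    exact ⟨R, _, i, _, _, shortExact_cokernel i,
      (hV R).2 ⟨hR, V.prop_of_iso (asIso ((toHo M₁).map i)) hX⟩,
      IsAbelianModel.weaklyTrivial_of_trivialCof (shortExact_cokernel i) hi hi'⟩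
  · rintro ⟨K, L, f, g, w, hS, hK, hL⟩
    exact V.ext_of_isTriangulatedClosed₁ _ (E.distinguished _ hS) ((hV K).1 hK).2
      ((h.isZero_iff _).1 ((hz L).2 hL)).2

theorem inverseImage_eq_cokernelClass :
    V.inverseImage (toHo M₁) = cokernelClass (fibrant M₂) (weaklyTrivial M₁) := by
  have := h.isTriangulated_right
  have := h.isClosedUnderIsomorphisms_right
  ext X
  constructor
  · intro hX
    obtain ⟨J, p, hp, -, hJ⟩ := exists_fib_weaklyTrivial M₁ X
    have := h₁.epi_of_fib hp
    have hS := shortExact_kernel p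
    exact ⟨_, J, _, p, _, hS, (hV _).2 ⟨(h₁.fib_g_iff hS).1 hp,
      V.ext_of_isTriangulatedClosed₁ _ (E.distinguished _ hS)
        ((h.isZero_iff _).1 ((hz J).2 hJ)).2 hX⟩, hJ⟩
  · rintro ⟨K, L, f, g, w, hS, hK, hL⟩
    exact V.ext_of_isTriangulatedClosed₃ _ (E.distinguished _ hS) ((hV K).1 hK).2
      ((h.isZero_iff _).1 ((hz L).2 hL)).2

omit E hz h₁ in
theorem inverseImage_iff_essImage (X : A) : V.inverseImage (toHo M₁) X ↔
    ((fibrant M₂).ι ⋙ toHo M₁).essImage ((toHo M₁).obj X) := by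
  have := h.isClosedUnderIsomorphisms_right
  constructor
  · intro hX
    obtain ⟨R, i, hR, hi, hi'⟩ := exists_fibrant_replacement M₁ X
    have := isIso_toHo_map hi'
    exact ⟨⟨R, (hV R).2 ⟨hR, V.prop_of_iso (asIso ((toHo M₁).map i)) hX⟩⟩,
      ⟨(asIso ((toHo M₁).map i)).symm⟩⟩
  · rintro ⟨⟨R, hR⟩, ⟨e⟩⟩
    exact V.prop_of_iso e ((hV R).1 hR).2

end IsInjectiveModel

namespace IsProjectiveModel

variable (h₁ : IsProjectiveModel M₁)
  (hU : ∀ X, cofibrant M₂ X ↔ cofibrant M₁ X ∧ U ((toHo M₁).obj X))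

include E hz h h₁ hU

/-- The quotient of two projective models: its weak equivalences are the morphisms whose cone in
`Ho M₁` belongs to `U`. Its trivial fibrations are those of `M₁`, and its trivial cofibrations are
the cofibrations of `M₂`. -/
theorem exists_quotient [IsTriangulated (Ho M₁)] (h₂ : IsProjectiveModel M₂)
    (hV : ∀ X, weaklyTrivial M₂ X ↔ V ((toHo M₁).obj X)) :
    ∃ M : ModelCategory A, IsAbelianModel M ∧ cofibrant M = cofibrant M₁ ∧
      fibrant M = weaklyTrivial M₂ ∧ weaklyTrivial M = U.inverseImage (toHo M₁) := by
  have := h.isTriangulated_left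
  have := h.isStableUnderRetracts_left
  have := h.isClosedUnderIsomorphisms_left
  have e₁ : (fib M₂ ⊓ weq M₂) ⊓ U.trW.inverseImage (toHo M₁) = fib M₁ ⊓ weq M₁ := by
    ext X Y f
    change (fib M₂ ⊓ weq M₂) f ∧ U.trW ((toHo M₁).map f) ↔ _
    rw [h₁.trivialFib_iff, h₂.trivialFib_iff, and_assoc]
    refine and_congr_right fun hf => ?_
    rw [E.trW_map_g_iff U (shortExact_kernel f), hV, ← hz, h.isZero_iff, and_comm]
  have e₂ : cof M₁ ⊓ U.trW.inverseImage (toHo M₁) = cof M₂ := by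
    ext X Y f
    change cof M₁ f ∧ U.trW ((toHo M₁).map f) ↔ _
    rw [h₁.cof_iff, h₂.cof_iff, and_assoc]
    refine and_congr_right fun hf => ?_
    rw [E.trW_map_f_iff U (shortExact_cokernel f), hU]
  obtain ⟨M, hC, hF, hW⟩ := exists_modelCategory (cof M₁) (fib M₂ ⊓ weq M₂)
    (U.trW.inverseImage (toHo M₁)) (e₂ ▸ wfs_cof_trivialFib M₂) (e₁ ▸ wfs_cof_trivialFib M₁)
  have hCM : cofibrant M = cofibrant M₁ := by
    ext X
    change cof M _ ↔ cof M₁ _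
    rw [hC]
  have hFM : fibrant M = weaklyTrivial M₂ := by
    ext X
    rw [h₂.weaklyTrivial_iff, ← hF]
    rfl
  refine ⟨M, ⟨fun f => ?_, fun f => ?_⟩, hCM, hFM, ?_⟩
  · rw [hC, hCM, h₁.cof_iff]
  · rw [hF, hFM, h₂.trivialFib_iff]
  · ext X
    change weq M _ ↔ _
    rw [hW]
    exact E.trW_map_iff_of_isZero U ((isZero_zero A).of_iso
      (initialIsInitial.uniqueUpToIso (isZero_zero A).isInitial)) _

theorem inverseImage_eq_cokernelClass :
    U.inverseImage (toHo M₁) = cokernelClass (weaklyTrivial M₁) (cofibrant M₂) := by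
  have := h.isTriangulated_left
  have := h.isClosedUnderIsomorphisms_left
  ext X
  constructor
  · intro hX
    obtain ⟨Q, p, hQ, hp, hp'⟩ := exists_cofibrant_replacement M₁ X
    have := h₁.epi_of_fib hp
    have := isIso_toHo_map hp'
    exact ⟨_, Q, _, p, _, shortExact_kernel p,
      IsAbelianModel.weaklyTrivial_of_trivialFib (shortExact_kernel p) hp hp',
      (hU Q).2 ⟨hQ, U.prop_of_iso (asIso ((toHo M₁).map p)).symm hX⟩⟩
  · rintro ⟨K, L, f, g, w, hS, hK, hL⟩
    exact U.ext_of_isTriangulatedClosed₃ _ (E.distinguished _ hS)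
      ((h.isZero_iff _).1 ((hz K).2 hK)).1 ((hU L).1 hL).2

theorem inverseImage_eq_kernelClass :
    U.inverseImage (toHo M₁) = kernelClass (weaklyTrivial M₁) (cofibrant M₂) := by
  have := h.isTriangulated_left
  have := h.isClosedUnderIsomorphisms_left
  ext X
  constructor
  · intro hX
    obtain ⟨J, i, hi, -, hJ⟩ := exists_cof_weaklyTrivial M₁ X
    have := h₁.mono_of_cof hi
    have hS := shortExact_cokernel i
    exact ⟨J, _, i, _, _, hS, hJ, (hU _).2 ⟨(h₁.cof_f_iff hS).1 hi,
      U.ext_of_isTriangulatedClosed₃ _ (E.distinguished _ hS) hX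
        ((h.isZero_iff _).1 ((hz J).2 hJ)).1⟩⟩
  · rintro ⟨K, L, f, g, w, hS, hK, hL⟩
    exact U.ext_of_isTriangulatedClosed₁ _ (E.distinguished _ hS)
      ((h.isZero_iff _).1 ((hz K).2 hK)).1 ((hU L).1 hL).2

omit E hz h₁ in
theorem inverseImage_iff_essImage (X : A) : U.inverseImage (toHo M₁) X ↔
    ((cofibrant M₂).ι ⋙ toHo M₁).essImage ((toHo M₁).obj X) := by
  have := h.isClosedUnderIsomorphisms_left
  constructor
  · intro hX
    obtain ⟨Q, p, hQ, hp, hp'⟩ := exists_cofibrant_replacement M₁ X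
    have := isIso_toHo_map hp'
    exact ⟨⟨Q, (hU Q).2 ⟨hQ, U.prop_of_iso (asIso ((toHo M₁).map p)).symm hX⟩⟩,
      ⟨asIso ((toHo M₁).map p)⟩⟩
  · rintro ⟨⟨Q, hQ⟩, ⟨e⟩⟩
    exact U.prop_of_iso e ((hU Q).1 hQ).2

end IsProjectiveModel

end Quotient

end AbModel

theorem mainTheorem3 {A : Type u} [Category.{v} A] [Abelian A] [HasLimits A] [HasColimits A]
    (M₁ M₂ : ModelCategory A) :
    (IsInjectiveModel M₁ → IsInjectiveModel M₂ → fibrant M₂ ≤ fibrant M₁ →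
      ∃ M : ModelCategory A, IsHereditaryModel M ∧
        cofibrant M = weaklyTrivial M₂ ∧ fibrant M = fibrant M₁ ∧
        weaklyTrivial M = kernelClass (fibrant M₂) (weaklyTrivial M₁) ∧
        weaklyTrivial M = cokernelClass (fibrant M₂) (weaklyTrivial M₁) ∧
        IsThick (weaklyTrivial M) ∧
        (∀ X : A, weaklyTrivial M X ↔
          ((fibrant M₂).ι ⋙ toHo M₁).essImage ((toHo M₁).obj X)) ∧
        ∃ (t₂ : HoTriangulation M₂) (t₁ : HoTriangulation M₁) (t : HoTriangulation M)
          (F : Ho M₂ ⥤ Ho M₁) (G : Ho M₁ ⥤ Ho M),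
          IsRightDerivedId M₂ M₁ F ∧ IsRightDerivedId M₁ M G ∧
          IsHoColocalizationSequence t₂ t₁ t F G) ∧
    (IsProjectiveModel M₁ → IsProjectiveModel M₂ → cofibrant M₂ ≤ cofibrant M₁ →
      ∃ M : ModelCategory A, IsHereditaryModel M ∧
        cofibrant M = cofibrant M₁ ∧ fibrant M = weaklyTrivial M₂ ∧
        weaklyTrivial M = kernelClass (weaklyTrivial M₁) (cofibrant M₂) ∧
        weaklyTrivial M = cokernelClass (weaklyTrivial M₁) (cofibrant M₂) ∧
        IsThick (weaklyTrivial M) ∧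
        (∀ X : A, weaklyTrivial M X ↔
          ((cofibrant M₂).ι ⋙ toHo M₁).essImage ((toHo M₁).obj X)) ∧
        ∃ (t₂ : HoTriangulation M₂) (t₁ : HoTriangulation M₁) (t : HoTriangulation M)
          (F : Ho M₂ ⥤ Ho M₁) (G : Ho M₁ ⥤ Ho M),
          IsLeftDerivedId M₂ M₁ F ∧ IsLeftDerivedId M₁ M G ∧
          IsHoLocalizationSequence t₂ t₁ t F G) := by
  refine ⟨fun h₁ h₂ hF => ?_, fun h₁ h₂ hC => ?_⟩
  · obtain ⟨t₁, hz⟩ := h₁.exists_hoTriangulation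
    obtain ⟨t₂, hz₂⟩ := h₂.exists_hoTriangulation
    let := t₁.preadditive
    have := t₁.hasZeroObject
    let := t₁.hasShift
    have := t₁.shift_additive
    let := t₁.pretriangulated
    have := t₁.isTriangulated
    let E := t₁.connectingMorphisms
    have hthick₁ := isThick_weaklyTrivial t₁ hz
    have hthick₂ := isThick_weaklyTrivial t₂ hz₂
    obtain ⟨U, V, h, hU, hV⟩ :=
      h₁.exists_isSemiorthogonal E hz hthick₂ h₂ hF (h₁.weaklyTrivial_le h₂ hF)
    obtain ⟨M, hM, hCM, hFM, hWM⟩ := h₁.exists_quotient E hz h hV h₂ hU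
    have hVM (X : A) : weaklyTrivial M X ↔ V ((toHo M₁).obj X) := by
      rw [hWM]
      rfl
    have := h.isTriangulated_left
    have := h.isTriangulated_right
    have := h.isClosedUnderIsomorphisms_left
    have := h.isClosedUnderIsomorphisms_right
    have := h.isStableUnderRetracts_right
    -- the classes of the two hereditary cotorsion pairs are those of `M₁` and `M₂`
    have e₁ : weaklyTrivial M ⊓ fibrant M = fibrant M₂ := by
      ext X
      rw [hFM, hV, ← hVM]
      exact and_comm
    have e₂ : cofibrant M ⊓ weaklyTrivial M = weaklyTrivial M₁ := by
      ext X
      rw [hCM, ← hz, h.isZero_iff, ← hU, ← hVM]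
      rfl
    refine ⟨M, ⟨hM, ?_, ?_, ?_, ?_⟩, hCM, hFM,
      hWM.trans (h₁.inverseImage_eq_kernelClass E hz h hV),
      hWM.trans (h₁.inverseImage_eq_cokernelClass E hz h hV),
      hWM ▸ E.isThick_inverseImage V, hWM ▸ IsInjectiveModel.inverseImage_iff_essImage h hV, ?_⟩
    · exact hCM ▸ hthick₂.kernels
    · exact e₁ ▸ h₂.closedUnderCokernelsOfMonos_fibrant
    · exact e₂ ▸ hthick₁.kernels
    · exact hFM ▸ h₁.closedUnderCokernelsOfMonos_fibrant
    · obtain ⟨t₂, t, F, G, hF, hG, hFG⟩ := exists_isHoColocalizationSequence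
        h₁.toIsAbelianModel h₂.toIsAbelianModel hM t₁ h
        (fun f => E.weq_iff_trW U h₂.toIsAbelianModel hU f) (fun f => E.weq_iff_trW V hM hVM f)
      exact ⟨t₂, t₁, t, F, G, hF, hG, hFG⟩
  · obtain ⟨t₁, hz⟩ := h₁.exists_hoTriangulation
    obtain ⟨t₂, hz₂⟩ := h₂.exists_hoTriangulation
    let := t₁.preadditive
    have := t₁.hasZeroObject
    let := t₁.hasShift
    have := t₁.shift_additive
    let := t₁.pretriangulated
    have := t₁.isTriangulated
    let E := t₁.connectingMorphisms
    have hthick₁ := isThick_weaklyTrivial t₁ hz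
    have hthick₂ := isThick_weaklyTrivial t₂ hz₂
    obtain ⟨U, V, h, hV, hU⟩ :=
      h₁.exists_isSemiorthogonal E hz hthick₂ h₂ hC (h₁.weaklyTrivial_le h₂ hC)
    obtain ⟨M, hM, hCM, hFM, hWM⟩ := h₁.exists_quotient E hz h hU h₂ hV
    have hUM (X : A) : weaklyTrivial M X ↔ U ((toHo M₁).obj X) := by
      rw [hWM]
      rfl
    have := h.isTriangulated_left
    have := h.isTriangulated_right
    have := h.isClosedUnderIsomorphisms_left
    have := h.isClosedUnderIsomorphisms_right
    have := h.isStableUnderRetracts_left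
    -- the classes of the two hereditary cotorsion pairs are those of `M₁` and `M₂`
    have e₁ : cofibrant M ⊓ weaklyTrivial M = cofibrant M₂ := by
      ext X
      rw [hCM, hU, ← hUM]
      rfl
    have e₂ : weaklyTrivial M ⊓ fibrant M = weaklyTrivial M₁ := by
      ext X
      rw [hFM, ← hz, h.isZero_iff, ← hV, ← hUM]
      rfl
    refine ⟨M, ⟨hM, ?_, ?_, ?_, ?_⟩, hCM, hFM,
      hWM.trans (h₁.inverseImage_eq_kernelClass E hz h hU),
      hWM.trans (h₁.inverseImage_eq_cokernelClass E hz h hU),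
      hWM ▸ E.isThick_inverseImage U, hWM ▸ IsProjectiveModel.inverseImage_iff_essImage h hU, ?_⟩
    · exact hCM ▸ h₁.closedUnderKernelsOfEpis_cofibrant
    · exact e₂ ▸ hthick₁.cokernels
    · exact e₁ ▸ h₂.closedUnderKernelsOfEpis_cofibrant
    · exact hFM ▸ hthick₂.cokernels
    · obtain ⟨t₂, t, F, G, hF, hG, hFG⟩ := exists_isHoLocalizationSequence
        h₁.toIsAbelianModel h₂.toIsAbelianModel hM t₁ h
        (fun f => E.weq_iff_trW V h₂.toIsAbelianModel hV f) (fun f => E.weq_iff_trW U hM hUM f)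
      exact ⟨t₂, t₁, t, F, G, hF, hG, hFG⟩
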